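/- Let $n,k$ be integers with $1\le k<n$ and let $p,q$ be real numbers with $2\le p<n$, $p\neq k$ and $p<q\le \frac{np}{n-p}$. Let $\Omega\subset\mathbb R^n$ be a bounded domain (nonempty, open, connected) and let $K\subset\mathbb R^n$ be a compact embedded $C^2$ manifold without boundary, of codimension $k$. If $k=1$ assume that $K=\partial\Omega$; if $1<k<n$ assume that $K\cap\overline\Omega\neq\emptyset$. Put $d(x)=\operatorname{dist}(x,K)$, and let $C_0^\infty(\Omega\setminus K)$ be the set of smooth real functions with compact support in $\Omega\setminus K$. Condition (C) says that $-\Delta_p\, d^{\frac{p-k}{p-1}}\ge 0$ on $\Omega\setminus K$ in the sense of distributions, where $\Delta_p w=\operatorname{div}(|\nabla w|^{p-2}\nabla w)$; that is, with $w=d^{\frac{p-k}{p-1}}$, $\int_{\Omega\setminus K}|\nabla w|^{p-2}\nabla w\cdot\nabla\varphi\,dx\ge 0$ for every nonnegative $\varphi\in C_0^\infty(\Omega\setminus K)$. (i) If $\Omega$ and $K$ satisfy condition (C), then there is a constant $c>0$, depending on $n,k,p,q,\Omega,K$, such that for all $u\in C_0^\infty(\Omega\setminus K)$ $$\int_\Omega|\nabla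 u|^p\,dx-\left|\frac{p-k}{p}\right|^p\int_\Omega\frac{|u|^p}{d^p}\,dx\ \ge\ c\left(\int_\Omega d^{-q+\frac{q-p}{p}n}|u|^q\,dx\right)^{\frac pq}.$$ (ii) Without assuming condition (C), there are a constant $c>0$, depending only on $n,k,p,q$ (and not on $\Omega$, $K$), and a constant $M>0$, depending on $n,k,p,q,\Omega,K$, such that for all $u\in C_0^\infty(\Omega\setminus K)$ $$\int_\Omega|\nabla u|^p\,dx-\left|\frac{p-k}{p}\right|^p\int_\Omega\frac{|u|^p}{d^p}\,dx+M\int_\Omega|u|^p\,dx\ \ge\ c\left(\int_\Omega d^{-q+\frac{q-p}{p}n}|u|^q\,dx\right)^{\frac pq}.$$ -/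

import Mathlib

open MeasureTheory Set
open scoped ContDiff Gradient

noncomputable section

/-- `C_0^∞(U)`: smooth real functions on `ℝⁿ` whose support is a compact subset of `U`. -/
structure IsTestFunction {n : ℕ} (U : Set (EuclideanSpace ℝ (Fin n)))
    (u : EuclideanSpace ℝ (Fin n) → ℝ) : Prop where
  smooth : ContDiff ℝ ∞ u
  compact_support : HasCompactSupport u
  support_subset : tsupport u ⊆ U

/-- `K` is an embedded `C²` submanifold (without boundary) of `ℝⁿ` of codimension `k`: near each of
its points there is a `C²` diffeomorphism from an open set of `ℝⁿ` to an open set of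
`ℝᵏ × ℝⁿ⁻ᵏ` that carries `K` to the slice where the first component vanishes. -/
def IsC2Submanifold {n : ℕ} (k : ℕ) (K : Set (EuclideanSpace ℝ (Fin n))) : Prop :=
  ∀ x ∈ K, ∃ e : OpenPartialHomeomorph (EuclideanSpace ℝ (Fin n))
      (EuclideanSpace ℝ (Fin k) × EuclideanSpace ℝ (Fin (n - k))),
    x ∈ e.source ∧ ContDiffOn ℝ 2 e e.source ∧ ContDiffOn ℝ 2 e.symm e.target ∧
      ∀ y ∈ e.source, (y ∈ K ↔ (e y).1 = 0)

/-- The standing assumptions on the pair `(Ω, K)`: `Ω` is a bounded domain of `ℝⁿ`, `K` is a compact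
embedded `C²` manifold without boundary of codimension `k`, equal to `∂Ω` if `k = 1` and
meeting the closure of `Ω` if `k > 1`. -/
structure IsAdmissiblePair {n : ℕ} (k : ℕ) (Ω K : Set (EuclideanSpace ℝ (Fin n))) : Prop where
  isOpen : IsOpen Ω
  isConnected : IsConnected Ω
  isBounded : Bornology.IsBounded Ω
  isCompact : IsCompact K
  isC2Submanifold : IsC2Submanifold k K
  eq_frontier : k = 1 → K = frontier Ω
  inter_closure_nonempty : 1 < k → (K ∩ closure Ω).Nonempty

/-- `-Δ_p w ≥ 0` on the open set `U`, in the sense of distributions, for a locally Lipschitz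
function `w` on `U`:
`∫_U |∇w|^{p-2} ∇w · ∇φ ≥ 0` for all nonnegative `φ ∈ C_0^∞(U)`.
Such a `w` is differentiable almost everywhere, and its pointwise gradient is its weak gradient. -/
def IsWeaklyPSuperharmonicOn {n : ℕ} (p : ℝ) (w : EuclideanSpace ℝ (Fin n) → ℝ)
    (U : Set (EuclideanSpace ℝ (Fin n))) : Prop :=
  ∀ φ : EuclideanSpace ℝ (Fin n) → ℝ, IsTestFunction U φ → (∀ x, 0 ≤ φ x) →
    0 ≤ ∫ x in U, ‖∇ w x‖ ^ (p - 2) * inner ℝ (∇ w x) (∇ φ x)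

/-- Condition (C): `-Δ_p d^{(p-k)/(p-1)} ≥ 0` on `Ω \ K`, where `d(x) = dist(x, K)`. -/
def ConditionC {n : ℕ} (k : ℕ) (p : ℝ) (Ω K : Set (EuclideanSpace ℝ (Fin n))) : Prop :=
  IsWeaklyPSuperharmonicOn p (fun x => Metric.infDist x K ^ ((p - k) / (p - 1))) (Ω \ K)

/-- The Hardy functional
`∫_Ω |∇u|^p dx - |(p-k)/p|^p ∫_Ω |u|^p / d^p dx`, where `d(x) = dist(x, K)`. -/
def hardyFunctional {n : ℕ} (k : ℕ) (p : ℝ) (Ω K : Set (EuclideanSpace ℝ (Fin n)))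
    (u : EuclideanSpace ℝ (Fin n) → ℝ) : ℝ :=
  (∫ x in Ω, ‖∇ u x‖ ^ p) -
    |(p - k) / p| ^ p * ∫ x in Ω, |u x| ^ p / Metric.infDist x K ^ p

/-- The critical term
`(∫_Ω d^{-q + (q-p)n/p} |u|^q dx)^{p/q}`, where `d(x) = dist(x, K)`. -/
def criticalTerm {n : ℕ} (p q : ℝ) (Ω K : Set (EuclideanSpace ℝ (Fin n)))
    (u : EuclideanSpace ℝ (Fin n) → ℝ) : ℝ :=
  (∫ x in Ω, Metric.infDist x K ^ (-q + (q - p) / p * n) * |u x| ^ q) ^ (p / q)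

end

/-!
Write `d` for the distance to `K`, `α = (p - k) / p`, and call `∫ d ^ (-q + (q - p) n / p) |u| ^ q`
the critical integral.

*Geometry.* The only property of `K` that is used is that `Δ (d² / 2) = k + O(d)` near `K` in the
weak sense (`WeakLaplacianBound`). No regularity of `d` beyond its Lipschitz continuity enters.
Since `K` is `C²`, it deviates quadratically from its tangent planes, uniformly
(`IsC2Submanifold.exists_isNormalSpaceWith`); hence near a point `x₀` close to `K` the function `d`
agrees with the distance to the tangent plane at the nearest point of `x₀`, up to an error quadratic
in the tangential displacement (`IsC2Submanifold.exists_abs_infDist_sub_le`). This determines the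
discrete Laplacian of `d²` up to `O(d)`, and discrete integration by parts gives the weak statement
(`IsC2Submanifold.exists_weak_laplacian_bound`).

*Near `K`.* Substitute `u = d ^ α v`. The uniform convexity of `|·| ^ p` bounds the Hardy functional
of `u` from below by a multiple of `∫ d ^ (p - k) |∇ v| ^ p`, up to a term
`∫ d ^ (1 - k) ∇ d · ∇ |v| ^ p`, which by the weak Laplacian bound is of lower order and can be
absorbed (`exists_near_remainder`). On the other hand, the weak Laplacian bound tested with powers
of `d` gives a weighted `L¹` Hardy inequality; interpolated with the `L¹` Sobolev inequality for
`d ^ a z`, and applied to `z = |v| ^ s`, it bounds the critical integral by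
`∫ d ^ (p - k) |∇ v| ^ p` (`exists_near_const`). Of the constants in these inequalities only the
width of the neighbourhood and the coefficient of `∫ |u| ^ p` depend on `K`.

*Away from `K`.* The weight `d ^ (-p)` is bounded there, and the critical integral interpolates
between the Hardy term and Sobolev's inequality (`exists_far_const`). A cutoff function of `d` joins
both regions at the cost of a multiple of `∫ |u| ^ p` (`exists_hardy_sobolev_const`), which is the
second part.

*Under condition (C)* the field `d ^ (1 - k) ∇ d` has a divergence of one sign
(`ConditionC.integral_nonneg`). Testing with `d ^ (k - p) exp (∓ κ (p - 1) d ^ p) |u| ^ p`, instead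
of the `d ^ (k - p) |u| ^ p` that proves Hardy's inequality, leaves a multiple of `∫ |u| ^ p` on the
right (`ConditionC.exists_mul_integral_le`), so the first part follows from the second.

All integrations by parts are carried out with compactly supported Lipschitz functions
(`IsLipschitzTest`), a class that contains `h(d) u` and `|u| ^ s` along with `u`, and that is
reached from smooth test functions by mollification (`IsLipschitzTest.exists_approx`).
-/

set_option linter.unusedSectionVars false

/-! ### Vector inequalities, Lipschitz test functions and gradients -/

section VectorInequality

variable {E : Type*} [NormedAddCommGroup E] [InnerProductSpace ℝ E]

lemma young_mul_rpow_sub_one {p x y : ℝ} (hp : 1 < p) (hx : 0 ≤ x) (hy : 0 ≤ y) :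
    p * (x * y ^ (p - 1)) ≤ x ^ p + (p - 1) * y ^ p := by
  have hpq : p.HolderConjugate (p / (p - 1)) := Real.HolderConjugate.conjExponent hp
  have h := Real.young_inequality_of_nonneg hx (Real.rpow_nonneg hy (p - 1)) hpq
  rw [← Real.rpow_mul hy, mul_div_cancel₀ p (by linarith : p - 1 ≠ 0)] at h
  have hp0 : 0 < p := by linarith
  calc p * (x * y ^ (p - 1)) ≤ p * (x ^ p / p + y ^ p / (p / (p - 1))) := by gcongr
    _ = x ^ p + (p - 1) * y ^ p := by field_simp

/-- A version of Young's inequality with a small constant at the second summand. -/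
lemma mul_rpow_sub_one_le_quarter {p x y : ℝ} (hp : 1 < p) (hx : 0 ≤ x) (hy : 0 ≤ y) :
    p * (x * y ^ (p - 1)) ≤ y ^ p / 4 + (4 * p) ^ p * x ^ p := by
  have hp0 : 0 < p := by linarith
  have e : ∀ z : ℝ, 0 ≤ z → z ^ p = z * z ^ (p - 1) := fun z hz => by
    rcases hz.eq_or_lt with rfl | hz
    · simp [hp0.ne']
    · rw [Real.rpow_sub_one hz.ne']; field_simp
  by_cases h : 4 * p * x ≤ y
  · have h1 : p * (x * y ^ (p - 1)) ≤ y ^ p / 4 := by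
      rw [e y hy]
      have : 0 ≤ y ^ (p - 1) := Real.rpow_nonneg hy _
      nlinarith
    have : 0 ≤ (4 * p) ^ p * x ^ p := by positivity
    linarith
  · push Not at h
    have h1 : y ^ (p - 1) ≤ (4 * p * x) ^ (p - 1) :=
      Real.rpow_le_rpow hy h.le (by linarith)
    have h2 : (4 * p) ^ p * x ^ p = (4 * p * x) * (4 * p * x) ^ (p - 1) := by
      rw [← Real.mul_rpow (by positivity) hx, e _ (by positivity)]
    have h3 : 0 ≤ y ^ p := Real.rpow_nonneg hy _
    have h4 : 0 ≤ p * x := by positivity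
    have h5 : 0 ≤ (4 * p * x) ^ (p - 1) := by positivity
    rw [h2]
    nlinarith [mul_le_mul_of_nonneg_left h1 h4, mul_nonneg h4 h5]

/-- First-order convexity of `‖·‖ ^ p`. -/
lemma norm_rpow_add_inner_le (a b : E) {p : ℝ} (hp : 2 ≤ p) :
    ‖a‖ ^ p + p * (‖a‖ ^ (p - 2) * inner ℝ a b) ≤ ‖a + b‖ ^ p := by
  have hy := young_mul_rpow_sub_one (p := p) (by linarith) (norm_nonneg (a + b)) (norm_nonneg a)
  have h1 : inner ℝ a (a + b) ≤ ‖a‖ * ‖a + b‖ := real_inner_le_norm _ _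
  rw [inner_add_right, real_inner_self_eq_norm_sq] at h1
  rcases (norm_nonneg a).eq_or_lt with h0 | h0
  · have : a = 0 := norm_eq_zero.1 h0.symm
    subst this
    have hp0 : p ≠ 0 := by linarith
    simp only [norm_zero, inner_zero_left, mul_zero, add_zero, zero_add, Real.zero_rpow hp0]
    positivity
  have e1 : ‖a‖ ^ (p - 1) = ‖a‖ ^ (p - 2) * ‖a‖ := by
    rw [← Real.rpow_add_one h0.ne']; ring_nf
  have e2 : ‖a‖ ^ p = ‖a‖ ^ (p - 2) * ‖a‖ ^ 2 := by
    rw [← Real.rpow_natCast, ← Real.rpow_add h0]; norm_num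
  have h2 : 0 ≤ ‖a‖ ^ (p - 2) := by positivity
  have h3 := mul_le_mul_of_nonneg_left h1 (mul_nonneg (by linarith : 0 ≤ p) h2)
  rw [e1] at hy
  rw [e2] at hy ⊢
  nlinarith

/-- A quantitative form of the uniform convexity of `‖·‖ ^ p` for `2 ≤ p`. It follows from
Clarkson's inequality, applied to `a` and `a + b`, and the first-order convexity. -/
lemma norm_rpow_add_inner_add_le (a b : E) {p : ℝ} (hp : 2 ≤ p) :
    ‖a‖ ^ p + p * (‖a‖ ^ (p - 2) * inner ℝ a b) + 2 ^ (1 - p) * ‖b‖ ^ p ≤ ‖a + b‖ ^ p := by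
  have hp2 : 1 ≤ p / 2 := by linarith
  have e : ∀ z : E, ‖z‖ ^ p = (‖z‖ ^ 2) ^ (p / 2) := fun z => by
    rw [← Real.rpow_natCast, ← Real.rpow_mul (norm_nonneg _)]; congr 1; push_cast; ring
  set c : E := (2⁻¹ : ℝ) • b with hc
  have hb : b = c + c := by rw [hc, ← add_smul]; norm_num
  have h1 := norm_rpow_add_inner_le a c hp
  have h2 : ‖c‖ ^ p = 2 ^ (-p) * ‖b‖ ^ p := by
    rw [hc, norm_smul, Real.mul_rpow (by positivity) (by positivity), Real.rpow_neg (by norm_num)]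
    rw [Real.norm_of_nonneg (by norm_num), Real.inv_rpow (by norm_num)]
  have h3 : inner ℝ a c = 2⁻¹ * inner ℝ a b := by rw [hc, inner_smul_right]
  have h4 : ‖a + c‖ ^ p + ‖c‖ ^ p ≤ (‖a‖ ^ p + ‖a + b‖ ^ p) / 2 := by
    have hA : ‖a + c‖ ^ 2 + ‖c‖ ^ 2 = (‖a‖ ^ 2 + ‖a + b‖ ^ 2) / 2 := by
      rw [hb]
      simp only [← real_inner_self_eq_norm_sq, inner_add_left, inner_add_right,
        real_inner_comm a c]
      ring
    calc ‖a + c‖ ^ p + ‖c‖ ^ p ≤ (‖a + c‖ ^ 2 + ‖c‖ ^ 2) ^ (p / 2) := by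
          rw [e, e]
          exact Real.add_rpow_le_rpow_add (by positivity) (by positivity) hp2
      _ = ((‖a‖ ^ 2 + ‖a + b‖ ^ 2) / 2) ^ (p / 2) := by rw [hA]
      _ ≤ (‖a‖ ^ p + ‖a + b‖ ^ p) / 2 := by
          have := (convexOn_rpow hp2).2 (sq_nonneg ‖a‖ : _ ∈ Ici (0:ℝ))
            (sq_nonneg ‖a + b‖ : _ ∈ Ici (0:ℝ)) (by norm_num : (0:ℝ) ≤ 1/2)
            (by norm_num : (0:ℝ) ≤ 1/2) (by norm_num)
          simp only [smul_eq_mul] at this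
          rw [e a, e (a + b)]
          have e3 : (‖a‖ ^ 2 + ‖a + b‖ ^ 2) / 2 = 1 / 2 * ‖a‖ ^ 2 + 1 / 2 * ‖a + b‖ ^ 2 := by ring
          rw [e3]
          linarith
  have h5 : (2:ℝ) ^ (1 - p) = 2 * 2 ^ (-p) := by
    rw [sub_eq_add_neg, Real.rpow_add (by norm_num), Real.rpow_one]
  rw [h3] at h1
  rw [h2] at h4
  rw [h5]
  linarith

lemma norm_add_rpow_le (a b : E) {p : ℝ} (hp : 1 ≤ p) :
    ‖a + b‖ ^ p ≤ 2 ^ (p - 1) * (‖a‖ ^ p + ‖b‖ ^ p) := by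
  refine (Real.rpow_le_rpow (norm_nonneg _) (norm_add_le a b) (by linarith)).trans ?_
  have := (convexOn_rpow hp).2 (norm_nonneg a : _ ∈ Ici (0:ℝ))
            (norm_nonneg b : _ ∈ Ici (0:ℝ)) (by norm_num : (0:ℝ) ≤ 1/2)
            (by norm_num : (0:ℝ) ≤ 1/2) (by norm_num)
  simp only [smul_eq_mul] at this
  rw [← mul_add, ← mul_add, Real.mul_rpow (by norm_num) (by positivity)] at this
  have h5 : (2:ℝ) ^ (p - 1) * (1/2) ^ p = 1 / 2 := by
    rw [Real.rpow_sub_one (by norm_num), one_div, Real.inv_rpow (by norm_num)]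
    field_simp
  have h6 := mul_le_mul_of_nonneg_left this (by positivity : (0:ℝ) ≤ 2 ^ (p - 1))
  rw [← mul_assoc, h5] at h6
  linarith

end VectorInequality

/-- Globally Lipschitz functions with compact support in `U`. Their pointwise gradient, which exists
almost everywhere by Rademacher's theorem, is their weak gradient. -/
structure IsLipschitzTest {E : Type*} [NormedAddCommGroup E] (U : Set E) (w : E → ℝ) : Prop where
  lipschitz : ∃ C, LipschitzWith C w
  compact_support : HasCompactSupport w
  support_subset : tsupport w ⊆ U

section Basic

variable {E : Type*} [NormedAddCommGroup E] [InnerProductSpace ℝ E] [FiniteDimensional ℝ E]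
  {U K : Set E} {w f g : E → ℝ}

lemma IsTestFunction.isLipschitzTest {n : ℕ} {U : Set (EuclideanSpace ℝ (Fin n))}
    {u : EuclideanSpace ℝ (Fin n) → ℝ} (hu : IsTestFunction U u) : IsLipschitzTest U u :=
  ⟨hu.smooth.lipschitzWith_of_hasCompactSupport hu.compact_support (by simp), hu.compact_support,
    hu.support_subset⟩

namespace IsLipschitzTest

lemma mono {V : Set E} (hw : IsLipschitzTest U w) (hUV : U ⊆ V) : IsLipschitzTest V w :=
  ⟨hw.lipschitz, hw.compact_support, hw.support_subset.trans hUV⟩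

lemma continuous (hw : IsLipschitzTest U w) : Continuous w :=
  let ⟨_, h⟩ := hw.lipschitz; h.continuous

lemma exists_bound (hw : IsLipschitzTest U w) : ∃ B, 0 ≤ B ∧ ∀ x, |w x| ≤ B := by
  obtain ⟨B, hB⟩ := hw.compact_support.exists_bound_of_continuous hw.continuous
  exact ⟨B, (norm_nonneg _).trans (hB 0), hB⟩

lemma lipschitz_mul_of_bounded {A B : ℝ} {C D : NNReal} (hf : LipschitzWith C f)
    (hg : LipschitzWith D g) (hA : ∀ x, |f x| ≤ A) (hB : ∀ x, |g x| ≤ B) :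
    ∃ C, LipschitzWith C (fun x => f x * g x) := by
  refine ⟨(A * D + B * C).toNNReal, LipschitzWith.of_dist_le_mul fun x y => ?_⟩
  have hA0 : 0 ≤ A := (abs_nonneg _).trans (hA 0)
  have hB0 : 0 ≤ B := (abs_nonneg _).trans (hB 0)
  rw [Real.coe_toNNReal _ (by positivity), Real.dist_eq]
  have h1 := hf.dist_le_mul x y
  have h2 := hg.dist_le_mul x y
  rw [Real.dist_eq] at h1 h2
  calc |f x * g x - f y * g y| = |f x * (g x - g y) + (f x - f y) * g y| := by ring_nf
    _ ≤ |f x| * |g x - g y| + |f x - f y| * |g y| := by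
      rw [← abs_mul, ← abs_mul]; exact abs_add_le _ _
    _ ≤ A * (D * dist x y) + C * dist x y * B := by
      gcongr
      · exact hA x
      · exact hB y
    _ = _ := by ring

lemma of_comp (hw : IsLipschitzTest U w) {F : ℝ → ℝ} (hF : ContDiff ℝ 1 F) (h0 : F 0 = 0) :
    IsLipschitzTest U (fun x => F (w x)) := by
  obtain ⟨B, hB0, hB⟩ := hw.exists_bound
  obtain ⟨C, hC⟩ := hw.lipschitz
  have hsub : Function.support (fun x => F (w x)) ⊆ Function.support w := fun x hx hx' =>
    hx (by simp only [hx', h0])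
  refine ⟨?_, hw.compact_support.mono hsub, (closure_mono hsub).trans hw.support_subset⟩
  obtain ⟨D, hD⟩ := isCompact_Icc.exists_bound_of_continuousOn
    (f := deriv F) (s := Icc (-B) B) (hF.continuous_deriv le_rfl).continuousOn
  have hl : LipschitzOnWith D.toNNReal F (Icc (-B) B) := by
    refine Convex.lipschitzOnWith_of_nnnorm_deriv_le
      (fun x _ => (hF.differentiable (by simp)) x) (fun x hx => ?_) (convex_Icc _ _)
    rw [← NNReal.coe_le_coe, coe_nnnorm]
    exact (hD x hx).trans (Real.le_coe_toNNReal D)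
  refine ⟨D.toNNReal * C, ?_⟩
  have := hl.comp (hC.lipschitzOnWith (s := univ)) (fun x _ => abs_le.1 (hB x))
  exact lipschitzOnWith_univ.1 this

/-- `x ^ s` on nonnegative numbers, or `|x| ^ s`, preserves Lipschitz functions with compact
support. -/
lemma abs_rpow (hw : IsLipschitzTest U w) {s : ℝ} (hs : 1 < s) :
    IsLipschitzTest U (fun x => |w x| ^ s) :=
  hw.of_comp (F := fun t => |t| ^ s) (contDiff_norm_rpow (E := ℝ) hs)
    (by simp [(by linarith : s ≠ 0)])

lemma exists_infDist_bounds (hK : IsClosed K) (hw : IsLipschitzTest Kᶜ w) (hne : K.Nonempty) :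
    ∃ a b, 0 < a ∧ a ≤ b ∧ ∀ x ∈ tsupport w, Metric.infDist x K ∈ Icc a b := by
  have hc : IsCompact (tsupport w) := hw.compact_support
  rcases (tsupport w).eq_empty_or_nonempty with h | h
  · exact ⟨1, 1, one_pos, le_rfl, by simp [h]⟩
  have hcont : ContinuousOn (fun x => Metric.infDist x K) (tsupport w) :=
    (Metric.continuous_infDist_pt K).continuousOn
  obtain ⟨x, hx, hxm⟩ := hc.exists_isMinOn h hcont
  obtain ⟨y, hy, hym⟩ := hc.exists_isMaxOn h hcont
  exact ⟨_, _, (hK.notMem_iff_infDist_pos hne).1 (hw.support_subset hx), hym hx,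
    fun z hz => ⟨hxm hz, hym hz⟩⟩

/-- Multiplication by a `C¹` function of the distance to `K` preserves Lipschitz functions with
compact support off `K`. -/
lemma infDist_mul (hK : IsClosed K) (hne : K.Nonempty) (hU : U ⊆ Kᶜ) (hw : IsLipschitzTest U w)
    {h : ℝ → ℝ} (hh : ContDiffOn ℝ 1 h (Ioi 0)) :
    IsLipschitzTest U (fun x => h (Metric.infDist x K) * w x) := by
  obtain ⟨a, b, ha, hab, hS⟩ := (hw.mono hU).exists_infDist_bounds hK hne
  have hsubI : Icc a b ⊆ Ioi 0 := fun t ht => ha.trans_le ht.1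
  have hsub : Function.support (fun x => h (Metric.infDist x K) * w x) ⊆ Function.support w :=
    fun x hx hx' => hx (by simp only [hx', mul_zero])
  refine ⟨?_, hw.compact_support.mono hsub, (closure_mono hsub).trans hw.support_subset⟩
  obtain ⟨B, hB0, hB⟩ := hw.exists_bound
  obtain ⟨C, hC⟩ := hw.lipschitz
  have hdc : ContinuousOn (deriv h) (Icc a b) :=
    (hh.continuousOn_deriv_of_isOpen isOpen_Ioi le_rfl).mono hsubI
  obtain ⟨D, hD⟩ := isCompact_Icc.exists_bound_of_continuousOn hdc
  obtain ⟨A, hA⟩ := isCompact_Icc.exists_bound_of_continuousOn (hh.continuousOn.mono hsubI)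
  have hl : LipschitzOnWith D.toNNReal h (Icc a b) := by
    refine Convex.lipschitzOnWith_of_nnnorm_deriv_le (fun x hx =>
      (hh.differentiableOn (by simp)).differentiableAt (isOpen_Ioi.mem_nhds (hsubI hx)))
      (fun x hx => ?_) (convex_Icc _ _)
    rw [← NNReal.coe_le_coe, coe_nnnorm]
    exact (hD x hx).trans (Real.le_coe_toNNReal D)
  -- clamping the distance to `[a, b]` does not change the product
  have hp : ∀ t, (projIcc a b hab t : ℝ) ∈ Icc a b := fun t => (projIcc a b hab t).2
  have hl2 : LipschitzWith D.toNNReal (fun x => h (projIcc a b hab (Metric.infDist x K))) := by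
    have h1 : LipschitzWith 1 (fun x => (projIcc a b hab (Metric.infDist x K) : ℝ)) := by
      have := ((LipschitzWith.subtype_val (Icc a b)).comp (LipschitzWith.projIcc hab)).comp
        (Metric.lipschitz_infDist_pt K)
      simp only [mul_one] at this
      exact this
    have := hl.comp (h1.lipschitzOnWith (s := univ)) (fun x _ => hp _)
    rw [mul_one] at this
    exact lipschitzOnWith_univ.1 this
  obtain ⟨L, hL⟩ := lipschitz_mul_of_bounded hl2 hC (fun x => hA _ (hp _)) hB
  refine ⟨L, ?_⟩
  convert hL using 2 with x
  by_cases hx : x ∈ tsupport w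
  · rw [projIcc_of_mem hab (hS x hx)]
  · rw [image_eq_zero_of_notMem_tsupport hx, mul_zero, mul_zero]

end IsLipschitzTest

lemma norm_gradient_eq_norm_fderiv (f : E → ℝ) (x : E) : ‖∇ f x‖ = ‖fderiv ℝ f x‖ := by
  rw [gradient, LinearIsometryEquiv.norm_map]

lemma norm_gradient_le_of_lipschitzWith {C : NNReal} (hf : LipschitzWith C f) (x : E) :
    ‖∇ f x‖ ≤ C := by
  rw [norm_gradient_eq_norm_fderiv]; exact norm_fderiv_le_of_lipschitz ℝ hf

lemma gradient_eq_zero_of_notMem_tsupport {x : E} (hx : x ∉ tsupport f) : ∇ f x = 0 := by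
  have : fderiv ℝ f x = 0 := by
    by_contra h
    exact hx (support_fderiv_subset ℝ h)
  rw [gradient, this, map_zero]

lemma measurable_gradient [MeasurableSpace E] [BorelSpace E] (f : E → ℝ) : Measurable (∇ f) :=
  (LinearIsometryEquiv.continuous _).measurable.comp (measurable_fderiv ℝ f)

/-- The distance to a nonempty closed set has a unit gradient wherever it is differentiable off the
set: it decreases with unit speed along the segment to a nearest point. -/
lemma norm_gradient_infDist (hK : IsCompact K) (hne : K.Nonempty) {x : E} (hx : x ∉ K)
    (hd : DifferentiableAt ℝ (fun x => Metric.infDist x K) x) :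
    ‖∇ (fun x => Metric.infDist x K) x‖ = 1 := by
  refine le_antisymm ?_ ?_
  · simpa using norm_gradient_le_of_lipschitzWith (Metric.lipschitz_infDist_pt K) x
  have hpos : 0 < Metric.infDist x K := (hK.isClosed.notMem_iff_infDist_pos hne).1 hx
  obtain ⟨y, hy, hxy⟩ := hK.exists_infDist_eq_dist hne x
  have hline : HasDerivAt (fun t : ℝ => x + t • (y - x)) (y - x) 0 := by
    have := ((hasDerivAt_id (0:ℝ)).smul_const (y - x)).const_add x
    simpa using this
  have hg := hd.hasGradientAt.hasFDerivAt
  have hg' : HasFDerivAt (fun x => Metric.infDist x K)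
      (InnerProductSpace.toDual ℝ E (∇ (fun x => Metric.infDist x K) x))
      (x + (0:ℝ) • (y - x)) := by simpa using hg
  have h1 := (hg'.comp_hasDerivAt (0:ℝ) hline).hasDerivWithinAt (s := Icc 0 1)
  have h2 : HasDerivWithinAt (fun t : ℝ => (1 - t) * Metric.infDist x K)
      (- Metric.infDist x K) (Icc 0 1) 0 := by
    have := ((hasDerivAt_id (0:ℝ)).const_sub 1).mul_const (Metric.infDist x K)
    simpa using this.hasDerivWithinAt
  have h3 : ∀ t ∈ Icc (0:ℝ) 1, (1 - t) * Metric.infDist x K =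
      ((fun x => Metric.infDist x K) ∘ fun t : ℝ => x + t • (y - x)) t := by
    intro t ht
    simp only [Function.comp]
    refine le_antisymm ?_ ?_
    · have := Metric.infDist_le_infDist_add_dist (s := K) (x := x) (y := x + t • (y - x))
      rw [dist_eq_norm, sub_add_cancel_left, norm_neg, norm_smul, Real.norm_of_nonneg ht.1,
        ← dist_eq_norm, dist_comm, ← hxy] at this
      linarith
    · have := Metric.infDist_le_dist_of_mem (x := x + t • (y - x)) hy
      rw [dist_eq_norm] at this
      have e : x + t • (y - x) - y = (1 - t) • (x - y) := by module
      rw [e, norm_smul, Real.norm_of_nonneg (by linarith [ht.2]), ← dist_eq_norm, ← hxy] at this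
      exact this
  have h4 := h1.congr h3 (h3 0 (by simp))
  have h5 := (uniqueDiffOn_Icc (zero_lt_one' ℝ) 0 (by simp)).eq_deriv _ h4 h2
  rw [InnerProductSpace.toDual_apply_apply] at h5
  have h6 := abs_real_inner_le_norm (∇ (fun x => Metric.infDist x K) x) (y - x)
  rw [h5, abs_neg, abs_of_pos hpos, ← dist_eq_norm, dist_comm y x, ← hxy] at h6
  exact le_of_mul_le_mul_right (by simpa using h6) hpos

lemma hasGradientAt_infDist_mul {x : E} (hd : DifferentiableAt ℝ (fun x => Metric.infDist x K) x)
    (hw : DifferentiableAt ℝ w x) {h : ℝ → ℝ} {h' : ℝ}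
    (hh : HasDerivAt h h' (Metric.infDist x K)) :
    HasGradientAt (fun x => h (Metric.infDist x K) * w x)
      (h (Metric.infDist x K) • ∇ w x + (h' * w x) • ∇ (fun x => Metric.infDist x K) x) x := by
  rw [hasGradientAt_iff_hasFDerivAt]
  have h1 := hh.comp_hasFDerivAt x hd.hasGradientAt.hasFDerivAt
  have h2 := h1.mul hw.hasGradientAt.hasFDerivAt
  refine h2.congr_fderiv ?_
  ext y
  simp
  ring

lemma hasGradientAt_comp {x : E} (hw : DifferentiableAt ℝ w x) {F : ℝ → ℝ} {F' : ℝ}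
    (hF : HasDerivAt F F' (w x)) :
    HasGradientAt (fun x => F (w x)) (F' • ∇ w x) x := by
  rw [hasGradientAt_iff_hasFDerivAt]
  refine (hF.comp_hasFDerivAt x hw.hasGradientAt.hasFDerivAt).congr_fderiv ?_
  ext y
  simp

lemma hasGradientAt_abs_rpow {x : E} (hw : DifferentiableAt ℝ w x) {s : ℝ} (hs : 1 < s) :
    HasGradientAt (fun x => |w x| ^ s) ((s * |w x| ^ (s - 2) * w x) • ∇ w x) x :=
  hasGradientAt_comp hw (hasDerivAt_abs_rpow (w x) hs)

variable [MeasurableSpace E] [BorelSpace E]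

lemma IsLipschitzTest.integrable (hw : IsLipschitzTest U w) : Integrable w :=
  hw.continuous.integrable_of_hasCompactSupport hw.compact_support

lemma IsLipschitzTest.ae_differentiableAt (hw : IsLipschitzTest U w) :
    ∀ᵐ x : E, DifferentiableAt ℝ w x :=
  let ⟨_, h⟩ := hw.lipschitz; h.ae_differentiableAt

lemma ae_differentiableAt_infDist (K : Set E) :
    ∀ᵐ x : E, DifferentiableAt ℝ (fun x => Metric.infDist x K) x :=
  (Metric.lipschitz_infDist_pt K).ae_differentiableAt

/-- A bounded measurable function that vanishes off the compact support of `w` is integrable,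
also after multiplication by a function of the distance that is continuous off `K`. -/
lemma IsLipschitzTest.integrable_infDist_mul (hK : IsClosed K) (hne : K.Nonempty)
    (hw : IsLipschitzTest Kᶜ w) {h : ℝ → ℝ} (hm : Measurable h) (hc : ContinuousOn h (Ioi 0))
    (hg : Measurable g) (hb : ∃ B, ∀ x, |g x| ≤ B) (h0 : ∀ x, x ∉ tsupport w → g x = 0) :
    Integrable (fun x => h (Metric.infDist x K) * g x) := by
  obtain ⟨a, b, ha, hab, hS⟩ := hw.exists_infDist_bounds hK hne
  obtain ⟨B, hB⟩ := hb
  obtain ⟨A, hA⟩ := isCompact_Icc.exists_bound_of_continuousOn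
    (hc.mono (fun t ht => ha.trans_le ht.1 : Icc a b ⊆ Ioi 0))
  have hsupp : Function.support (fun x => h (Metric.infDist x K) * g x) ⊆ tsupport w := by
    intro x hx
    by_contra hx'
    exact hx (by simp only [h0 x hx', mul_zero])
  rw [← integrableOn_iff_integrable_of_support_subset hsupp]
  refine Measure.integrableOn_of_bounded (M := A * B) hw.compact_support.measure_lt_top.ne
    ((hm.comp (Metric.continuous_infDist_pt K).measurable).mul hg).aestronglyMeasurable ?_
  refine (ae_restrict_iff' (isClosed_tsupport w).measurableSet).2 (ae_of_all _ fun x hx => ?_)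
  rw [norm_mul]
  have := hA _ (hS x hx)
  exact mul_le_mul this (hB x) (norm_nonneg _) ((norm_nonneg _).trans this)

lemma IsLipschitzTest.integrable_gradient_rpow (hK : IsClosed K) (hne : K.Nonempty)
    (hw : IsLipschitzTest Kᶜ w) {h : ℝ → ℝ} (hm : Measurable h) (hc : ContinuousOn h (Ioi 0))
    {s : ℝ} (hs : 0 < s) :
    Integrable (fun x => h (Metric.infDist x K) * ‖∇ w x‖ ^ s) := by
  obtain ⟨C, hC⟩ := hw.lipschitz
  refine hw.integrable_infDist_mul hK hne hm hc ((measurable_gradient w).norm.pow_const s)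
    ⟨(C:ℝ) ^ s, fun x => ?_⟩ fun x hx => ?_
  · rw [abs_of_nonneg (by positivity)]
    exact Real.rpow_le_rpow (norm_nonneg _) (norm_gradient_le_of_lipschitzWith hC x) hs.le
  · rw [gradient_eq_zero_of_notMem_tsupport hx, norm_zero, Real.zero_rpow hs.ne']

lemma IsLipschitzTest.integrable_inner_gradient (hK : IsClosed K) (hne : K.Nonempty)
    (hw : IsLipschitzTest Kᶜ w) {h : ℝ → ℝ} (hm : Measurable h) (hc : ContinuousOn h (Ioi 0)) :
    Integrable (fun x => h (Metric.infDist x K) *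
      inner ℝ (∇ (fun x => Metric.infDist x K) x) (∇ w x)) := by
  obtain ⟨C, hC⟩ := hw.lipschitz
  refine hw.integrable_infDist_mul hK hne hm hc
    ((measurable_gradient _).inner (measurable_gradient w)) ⟨C, fun x => ?_⟩ fun x hx => ?_
  · refine (abs_real_inner_le_norm _ _).trans ?_
    have h1 := norm_gradient_le_of_lipschitzWith (Metric.lipschitz_infDist_pt K) x
    calc _ ≤ ((1 : NNReal) : ℝ) * C := by
          gcongr
          exact norm_gradient_le_of_lipschitzWith hC x
      _ = C := by simp
  · rw [gradient_eq_zero_of_notMem_tsupport hx, inner_zero_right]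

end Basic

/-! ### Mollification of Lipschitz test functions, and Sobolev's inequality -/

section Mollification

open Filter Topology Convolution

variable {n : ℕ} {U : Set (EuclideanSpace ℝ (Fin n))} {w : EuclideanSpace ℝ (Fin n) → ℝ}

/-- The derivative of a mollified Lipschitz function is the mollified derivative. -/
lemma hasFDerivAt_normed_convolution {C : NNReal} (hw : LipschitzWith C w)
    (ρ : ContDiffBump (0 : EuclideanSpace ℝ (Fin n))) (x : EuclideanSpace ℝ (Fin n)) :
    HasFDerivAt (ρ.normed volume ⋆[ContinuousLinearMap.lsmul ℝ ℝ, volume] w)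
      ((ρ.normed volume ⋆[ContinuousLinearMap.lsmul ℝ ℝ, volume] (fderiv ℝ w)) x) x := by
  have hcont : Continuous (ρ.normed volume) := ρ.continuous_normed
  have key := hasFDerivAt_integral_of_dominated_loc_of_lip
    (μ := (volume : Measure (EuclideanSpace ℝ (Fin n)))) (𝕜 := ℝ) (x₀ := x) (s := univ)
    (F := fun y a => ρ.normed volume a * w (y - a))
    (F' := fun a => ρ.normed volume a • fderiv ℝ w (x - a))
    (bound := fun a => ρ.normed volume a * C) univ_mem
    (Eventually.of_forall fun y =>
      (hcont.mul (hw.continuous.comp (continuous_const.sub continuous_id))).aestronglyMeasurable)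
    ((hcont.mul (hw.continuous.comp (continuous_const.sub continuous_id))
      ).integrable_of_hasCompactSupport (ρ.hasCompactSupport_normed.mul_right))
    (hcont.aestronglyMeasurable.smul
      ((measurable_fderiv ℝ w).comp (measurable_const.sub measurable_id)).aestronglyMeasurable)
    (ae_of_all _ fun a => LipschitzOnWith.of_dist_le_mul fun y _ z _ => ?_)
    (ρ.integrable_normed.mul_const _) ?_
  · exact key.2
  · have h0 : 0 ≤ ρ.normed volume a * (C : ℝ) := mul_nonneg (ρ.nonneg_normed a) C.coe_nonneg
    have := hw.dist_le_mul (y - a) (z - a)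
    rw [dist_sub_right] at this
    simp only [Real.coe_nnabs]
    rw [abs_of_nonneg h0, Real.dist_eq, ← mul_sub, abs_mul, abs_of_nonneg (ρ.nonneg_normed a),
      mul_assoc, ← Real.dist_eq]
    exact mul_le_mul_of_nonneg_left this (ρ.nonneg_normed a)
  · have hq : Measure.QuasiMeasurePreserving (fun a : EuclideanSpace ℝ (Fin n) => x - a)
        volume volume := (Measure.measurePreserving_sub_left volume x).quasiMeasurePreserving
    filter_upwards [hq.ae hw.ae_differentiableAt] with a ha
    have h1 : HasFDerivAt (fun y => w (y - a)) (fderiv ℝ w (x - a)) x :=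
      ha.hasFDerivAt.comp x ((hasFDerivAt_id x).sub_const a)
    exact h1.const_mul (ρ.normed volume a)

lemma norm_normed_convolution_le {F : Type*} [NormedAddCommGroup F] [NormedSpace ℝ F]
    {g : EuclideanSpace ℝ (Fin n) → F} {B : ℝ} (hB : ∀ x, ‖g x‖ ≤ B)
    (ρ : ContDiffBump (0 : EuclideanSpace ℝ (Fin n))) (x : EuclideanSpace ℝ (Fin n)) :
    ‖(ρ.normed volume ⋆[ContinuousLinearMap.lsmul ℝ ℝ, volume] g) x‖ ≤ B := by
  calc ‖∫ t, ρ.normed volume t • g (x - t)‖ ≤ ∫ t, ρ.normed volume t * B := by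
        refine norm_integral_le_of_norm_le (ρ.integrable_normed.mul_const _)
          (ae_of_all _ fun t => ?_)
        rw [norm_smul, Real.norm_of_nonneg (ρ.nonneg_normed t)]
        exact mul_le_mul_of_nonneg_left (hB _) (ρ.nonneg_normed t)
    _ = B := by rw [integral_mul_const, ρ.integral_normed, one_mul]

/-- Mollification: a compactly supported Lipschitz function is the limit of test functions with
bounded gradients that converge almost everywhere. -/
lemma IsLipschitzTest.exists_approx (hU : IsOpen U) (hw : IsLipschitzTest U w) :
    ∃ (B : ℝ) (S : Set (EuclideanSpace ℝ (Fin n))) (φ : ℕ → EuclideanSpace ℝ (Fin n) → ℝ),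
      IsCompact S ∧ S ⊆ U ∧ (∀ m, IsTestFunction U (φ m)) ∧
      ((∀ x, 0 ≤ w x) → ∀ m x, 0 ≤ φ m x) ∧ (∀ m x, |φ m x| ≤ B) ∧ (∀ m x, ‖∇ (φ m) x‖ ≤ B) ∧
      (∀ m, tsupport (φ m) ⊆ S) ∧ (∀ x, Tendsto (fun m => φ m x) atTop (𝓝 (w x))) ∧
      ∀ᵐ x, Tendsto (fun m => ∇ (φ m) x) atTop (𝓝 (∇ w x)) := by
  obtain ⟨C, hC⟩ := hw.lipschitz
  obtain ⟨A, hA0, hA⟩ := hw.exists_bound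
  obtain ⟨δ, hδ, hδU⟩ := hw.compact_support.exists_cthickening_subset_open hU hw.support_subset
  set r : ℕ → ℝ := fun m => δ / (m + 1) with hr
  have hrpos : ∀ m, 0 < r m := fun m => by positivity
  have hrle : ∀ m, r m ≤ δ := fun m => by
    rw [hr]; exact div_le_self hδ.le (by linarith [Nat.cast_nonneg (α := ℝ) m])
  let ρ : ℕ → ContDiffBump (0 : EuclideanSpace ℝ (Fin n)) := fun m =>
    ⟨r m / 2, r m, half_pos (hrpos m), half_lt_self (hrpos m)⟩
  have hr0 : Tendsto (fun m => (ρ m).rOut) atTop (𝓝 0) := by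
    have := tendsto_one_div_add_atTop_nhds_zero_nat (𝕜 := ℝ)
    have := this.const_mul δ
    simp only [mul_zero, mul_one_div] at this
    exact this
  set φ : ℕ → EuclideanSpace ℝ (Fin n) → ℝ := fun m =>
    ((ρ m).normed volume ⋆[ContinuousLinearMap.lsmul ℝ ℝ, volume] w) with hφ
  have hS : IsCompact (Metric.cthickening δ (tsupport w)) := hw.compact_support.isCompact.cthickening
  have hsupp : ∀ m, tsupport (φ m) ⊆ Metric.cthickening δ (tsupport w) := by
    intro m
    refine closure_minimal (fun x hx => ?_) hS.isClosed
    by_contra hx'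
    apply hx
    rw [hφ]
    refine integral_eq_zero_of_ae (ae_of_all _ fun t => ?_)
    simp only [ContinuousLinearMap.lsmul_apply, smul_eq_mul, Pi.zero_apply, mul_eq_zero]
    by_contra! h
    apply hx'
    have ht : t ∈ Function.support ((ρ m).normed volume) := h.1
    rw [(ρ m).support_normed_eq, Metric.mem_ball, dist_zero_right] at ht
    refine Metric.mem_cthickening_of_dist_le x (x - t) δ _ (subset_tsupport _ h.2) ?_
    rw [dist_eq_norm, sub_sub_cancel]
    exact ht.le.trans (hrle m)
  have hgrad : ∀ m x, ∇ (φ m) x = (InnerProductSpace.toDual ℝ _).symm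
      (((ρ m).normed volume ⋆[ContinuousLinearMap.lsmul ℝ ℝ, volume] (fderiv ℝ w)) x) := by
    intro m x
    rw [gradient, (hasFDerivAt_normed_convolution hC (ρ m) x).fderiv]
  have hfb : ∀ x, ‖fderiv ℝ w x‖ ≤ C := fun x => norm_fderiv_le_of_lipschitz ℝ hC
  refine ⟨max A C, _, φ, hS, hδU, fun m => ⟨?_, ?_, (hsupp m).trans hδU⟩, fun h0 m x => ?_,
    fun m x => ?_, fun m x => ?_, hsupp, fun x => ?_, ?_⟩
  · exact (ρ m).hasCompactSupport_normed.contDiff_convolution_left _ (ρ m).contDiff_normed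
      hC.continuous.locallyIntegrable
  · exact hS.of_isClosed_subset (isClosed_tsupport _) (hsupp m)
  · exact integral_nonneg fun t => mul_nonneg ((ρ m).nonneg_normed t) (h0 _)
  · exact (norm_normed_convolution_le (g := w) (B := A) hA (ρ m) x).trans (le_max_left _ _)
  · rw [hgrad, LinearIsometryEquiv.norm_map]
    exact (norm_normed_convolution_le hfb (ρ m) x).trans (le_max_right _ _)
  · exact ContDiffBump.convolution_tendsto_right_of_continuous hr0 hC.continuous x
  · have hloc : LocallyIntegrable (fderiv ℝ w) := by
      refine (locallyIntegrable_const (C : ℝ)).mono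
        (measurable_fderiv ℝ w).aestronglyMeasurable (ae_of_all _ fun x => ?_)
      simpa using hfb x
    have h2 : ∀ᶠ i in atTop (α := ℕ), (ρ i).rOut ≤ 2 * (ρ i).rIn :=
      Eventually.of_forall fun i => by
        change r i ≤ 2 * (r i / 2)
        linarith
    filter_upwards [ContDiffBump.ae_convolution_tendsto_right_of_locallyIntegrable
      (μ := volume) hr0 h2 hloc] with x hx
    simp only [hgrad]
    exact ((LinearIsometryEquiv.continuous _).tendsto _).comp hx

/-- Sobolev's inequality for compactly supported Lipschitz functions. -/
lemma exists_sobolev_const (p : ℝ) (hp : 1 ≤ p) (hpn : p < n) :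
    ∃ C : ℝ, 0 < C ∧ ∀ (U : Set (EuclideanSpace ℝ (Fin n))) (w : EuclideanSpace ℝ (Fin n) → ℝ),
      IsLipschitzTest U w →
      (∫ x, |w x| ^ (n * p / (n - p))) ^ ((n - p) / n) ≤ C * ∫ x, ‖∇ w x‖ ^ p := by
  have hp0 : 0 < p := by linarith
  have hn0 : (0:ℝ) < n := by linarith
  have hnp : 0 < (n:ℝ) - p := by linarith
  set q : ℝ := n * p / (n - p) with hq
  have hq0 : 0 < q := by positivity
  have hqp : 1 / q = 1 / p - 1 / n := by rw [hq]; field_simp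
  set c : NNReal := SNormLESNormFDerivOfEqConst ℝ
    (volume : Measure (EuclideanSpace ℝ (Fin n))) p with hc
  have smooth : ∀ φ : EuclideanSpace ℝ (Fin n) → ℝ, IsTestFunction univ φ →
      (∫ x, |φ x| ^ q) ^ ((n - p) / n) ≤ (c : ℝ) ^ p * ∫ x, ‖∇ φ x‖ ^ p := by
    intro φ hφ
    have h1 := eLpNorm_le_eLpNorm_fderiv_of_eq (volume : Measure (EuclideanSpace ℝ (Fin n)))
      (u := φ) (hφ.smooth.of_le (by simp)) hφ.compact_support (p := p.toNNReal) (p' := q.toNNReal)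
      (by rw [← NNReal.coe_le_coe, Real.coe_toNNReal _ hp0.le]; exact_mod_cast hp)
      (by rw [finrank_euclideanSpace_fin]; exact_mod_cast hn0)
      (by rw [NNReal.coe_inv, Real.coe_toNNReal _ hp0.le, Real.coe_toNNReal _ hq0.le,
            finrank_euclideanSpace_fin]
          simpa using hqp)
    rw [Real.coe_toNNReal _ hp0.le, ← hc] at h1
    have m1 : MemLp φ q.toNNReal volume :=
      hφ.smooth.continuous.memLp_of_hasCompactSupport hφ.compact_support
    have hfc : Continuous (fderiv ℝ φ) := hφ.smooth.continuous_fderiv (by simp)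
    have m2 : MemLp (fderiv ℝ φ) p.toNNReal volume :=
      hfc.memLp_of_hasCompactSupport (hφ.compact_support.fderiv ℝ)
    rw [m1.eLpNorm_eq_integral_rpow_norm (by simpa using hq0) (by simp),
      m2.eLpNorm_eq_integral_rpow_norm (by simpa using hp0) (by simp)] at h1
    simp only [ENNReal.coe_toReal, Real.coe_toNNReal _ hp0.le, Real.coe_toNNReal _ hq0.le] at h1
    have hI : 0 ≤ ∫ x, ‖fderiv ℝ φ x‖ ^ p := integral_nonneg fun x => by positivity
    have hJ : 0 ≤ ∫ x, |φ x| ^ q := integral_nonneg fun x => by positivity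
    rw [← ENNReal.ofReal_coe_nnreal, ← ENNReal.ofReal_mul c.coe_nonneg,
      ENNReal.ofReal_le_ofReal_iff (by positivity)] at h1
    have h2 := Real.rpow_le_rpow (by positivity) h1 hp0.le
    rw [Real.mul_rpow c.coe_nonneg (by positivity), ← Real.rpow_mul hI, inv_mul_cancel₀ hp0.ne',
      Real.rpow_one] at h2
    simp only [norm_gradient_eq_norm_fderiv]
    refine le_trans (le_of_eq ?_) h2
    simp only [Real.norm_eq_abs]
    rw [← Real.rpow_mul hJ]
    congr 1
    rw [hq]; field_simp
  refine ⟨(c : ℝ) ^ p + 1, by positivity, fun U w hw => ?_⟩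
  obtain ⟨B, S, φ, hS, -, hφ, -, hb, hgb, hsupp, hlim, hglim⟩ :=
    (hw.mono (subset_univ U)).exists_approx isOpen_univ
  have hB : 0 ≤ B := (abs_nonneg _).trans (hb 0 0)
  have hind : ∀ M : ℝ, Integrable (S.indicator fun _ => M) := fun M =>
    (integrableOn_const hS.measure_lt_top.ne).integrable_indicator hS.isClosed.measurableSet
  have hz : ∀ m x, x ∉ S → φ m x = 0 ∧ ∇ (φ m) x = 0 := fun m x hx =>
    ⟨image_eq_zero_of_notMem_tsupport fun h => hx (hsupp m h),
      gradient_eq_zero_of_notMem_tsupport fun h => hx (hsupp m h)⟩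
  have t1 : Tendsto (fun m => ∫ x, |φ m x| ^ q) atTop (𝓝 (∫ x, |w x| ^ q)) := by
    refine tendsto_integral_of_dominated_convergence (S.indicator fun _ => B ^ q)
      (fun m => ?_) (hind _) (fun m => ae_of_all _ fun x => ?_) (ae_of_all _ fun x => ?_)
    · exact ((hφ m).smooth.continuous.abs.rpow_const fun _ => Or.inr hq0.le).aestronglyMeasurable
    · rw [Real.norm_of_nonneg (by positivity)]
      by_cases hx : x ∈ S
      · rw [indicator_of_mem hx]
        exact Real.rpow_le_rpow (abs_nonneg _) (hb m x) hq0.le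
      · rw [indicator_of_notMem hx, (hz m x hx).1, abs_zero, Real.zero_rpow hq0.ne']
    · exact ((hlim x).abs).rpow_const (Or.inr hq0.le)
  have t2 : Tendsto (fun m => ∫ x, ‖∇ (φ m) x‖ ^ p) atTop (𝓝 (∫ x, ‖∇ w x‖ ^ p)) := by
    refine tendsto_integral_of_dominated_convergence (S.indicator fun _ => B ^ p)
      (fun m => ?_) (hind _) (fun m => ae_of_all _ fun x => ?_) ?_
    · exact ((measurable_gradient _).norm.pow_const p).aestronglyMeasurable
    · rw [Real.norm_of_nonneg (by positivity)]
      by_cases hx : x ∈ S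
      · rw [indicator_of_mem hx]
        exact Real.rpow_le_rpow (norm_nonneg _) (hgb m x) hp0.le
      · rw [indicator_of_notMem hx, (hz m x hx).2, norm_zero, Real.zero_rpow hp0.ne']
    · filter_upwards [hglim] with x hx
      exact hx.norm.rpow_const (Or.inr hp0.le)
  have h3 := le_of_tendsto_of_tendsto' (t1.rpow_const (Or.inr (by positivity : 0 ≤ (n - p) / n)))
    (t2.const_mul ((c : ℝ) ^ p)) (fun m => smooth _ (hφ m))
  refine h3.trans ?_
  have : 0 ≤ ∫ x, ‖∇ w x‖ ^ p := integral_nonneg fun x => by positivity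
  linarith

end Mollification

/-! ### Uniform normal spaces of a compact `C²` submanifold -/

section Geometry

open Filter Topology

/-- A `C²` map has a uniformly quadratic first-order Taylor remainder near a point. -/
lemma exists_quadratic_taylor_remainder {E F : Type*} [NormedAddCommGroup E] [NormedSpace ℝ E]
    [NormedAddCommGroup F] [NormedSpace ℝ F] {f : E → F} {x : E} (hf : ContDiffAt ℝ 2 f x) :
    ∃ A r : ℝ, 0 < A ∧ 0 < r ∧ (∀ y ∈ Metric.ball x r, DifferentiableAt ℝ f y) ∧
      (∀ y ∈ Metric.ball x r, ‖fderiv ℝ f y‖ ≤ A) ∧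
      ∀ y ∈ Metric.ball x r, ∀ z ∈ Metric.ball x r,
        ‖f z - f y - fderiv ℝ f y (z - y)‖ ≤ A * ‖z - y‖ ^ 2 := by
  have h1 : ContDiffAt ℝ 1 (fderiv ℝ f) x := hf.fderiv_right (by norm_num)
  obtain ⟨C, t, ht, hC⟩ := h1.exists_lipschitzOnWith
  have h2 : ∀ᶠ y in 𝓝 x, DifferentiableAt ℝ f y :=
    (hf.eventually (by simp)).mono fun y hy => hy.differentiableAt (by simp)
  obtain ⟨r, hr, hball⟩ := Metric.mem_nhds_iff.1 (inter_mem ht h2)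
  refine ⟨C + ‖fderiv ℝ f x‖ + 1, min r 1, by positivity, by positivity, ?_, ?_, ?_⟩
  · exact fun y hy => (hball (Metric.ball_subset_ball (min_le_left _ _) hy)).2
  · intro y hy
    have hy1 : dist y x ≤ 1 := (Metric.mem_ball.1 hy).le.trans (min_le_right _ _)
    have h3 := hC.dist_le_mul y (hball (Metric.ball_subset_ball (min_le_left _ _) hy)).1 x
      (mem_of_mem_nhds ht)
    have h4 : ‖fderiv ℝ f y‖ ≤ dist (fderiv ℝ f y) (fderiv ℝ f x) + ‖fderiv ℝ f x‖ := by
      rw [dist_eq_norm]; simpa using norm_add_le (fderiv ℝ f y - fderiv ℝ f x) (fderiv ℝ f x)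
    have h5 : (C:ℝ) * dist y x ≤ C * 1 := mul_le_mul_of_nonneg_left hy1 C.coe_nonneg
    linarith
  · intro y hy z hz
    have hseg : ∀ w ∈ segment ℝ y z, w ∈ t ∩ {y | DifferentiableAt ℝ f y} := fun w hw =>
      hball (Metric.ball_subset_ball (min_le_left _ _) ((convex_ball x (min r 1)).segment_subset
        hy hz hw))
    have h6 := (convex_segment (𝕜 := ℝ) y z).norm_image_sub_le_of_norm_hasFDerivWithin_le'
      (f := f) (f' := fderiv ℝ f) (φ := fderiv ℝ f y) (C := C * ‖z - y‖)
      (fun w hw => (hseg w hw).2.hasFDerivAt.hasFDerivWithinAt) (fun w hw => ?_)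
      (left_mem_segment ℝ y z) (right_mem_segment ℝ y z)
    · refine h6.trans ?_
      rw [mul_assoc, ← sq]
      gcongr
      linarith [norm_nonneg (fderiv ℝ f x)]
    · have h7 := hC.dist_le_mul w (hseg w hw).1 y (hseg y (left_mem_segment ℝ y z)).1
      rw [dist_eq_norm, dist_eq_norm] at h7
      refine h7.trans ?_
      gcongr
      simpa using norm_sub_le_of_mem_segment hw

variable {n k : ℕ} {K : Set (EuclideanSpace ℝ (Fin n))}

/-- `V` is the normal space of `K` at `y`, with quadratic estimates on the scale `ρ`: the points of
`K` deviate quadratically from the affine tangent space `y + Vᗮ`, and every tangent vector is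
approximated quadratically by points of `K`. -/
structure IsNormalSpaceWith (K : Set (EuclideanSpace ℝ (Fin n))) (k : ℕ) (A ρ : ℝ)
    (y : EuclideanSpace ℝ (Fin n)) (V : Submodule ℝ (EuclideanSpace ℝ (Fin n))) : Prop where
  finrank_eq : Module.finrank ℝ V = k
  norm_proj_le : ∀ z ∈ K, ‖z - y‖ < ρ → ‖V.starProjection (z - y)‖ ≤ A * ‖z - y‖ ^ 2
  exists_approx : ∀ T ∈ Vᗮ, ‖T‖ < ρ → ∃ z ∈ K, ‖z - y - T‖ ≤ A * ‖T‖ ^ 2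

lemma IsNormalSpaceWith.mono {A A' ρ ρ' : ℝ} {y : EuclideanSpace ℝ (Fin n)}
    {V : Submodule ℝ (EuclideanSpace ℝ (Fin n))} (h : IsNormalSpaceWith K k A ρ y V)
    (hA : A ≤ A') (hρ : ρ' ≤ ρ) : IsNormalSpaceWith K k A' ρ' y V where
  finrank_eq := h.finrank_eq
  norm_proj_le z hz hzy := (h.norm_proj_le z hz (hzy.trans_le hρ)).trans (by gcongr)
  exists_approx T hT hTρ :=
    let ⟨z, hz, hzT⟩ := h.exists_approx T hT (hTρ.trans_le hρ)
    ⟨z, hz, hzT.trans (by gcongr)⟩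

lemma IsC2Submanifold.exists_isNormalSpaceWith_nhds (hK : IsC2Submanifold k K) (hkn : k < n)
    {x : EuclideanSpace ℝ (Fin n)} (hx : x ∈ K) :
    ∃ A ρ : ℝ, 0 < A ∧ 0 < ρ ∧
      ∀ y ∈ K ∩ Metric.ball x ρ, ∃ V, IsNormalSpaceWith K k A ρ y V := by
  obtain ⟨e, hxe, he, hes, heK⟩ := hK x hx
  obtain ⟨A₁, r₁, hA₁, hr₁, hd₁, hb₁, hq₁⟩ :=
    exists_quadratic_taylor_remainder (he.contDiffAt (e.open_source.mem_nhds hxe))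
  obtain ⟨A₂, r₂, hA₂, hr₂, hd₂, hb₂, hq₂⟩ :=
    exists_quadratic_taylor_remainder
      (hes.contDiffAt (e.open_target.mem_nhds (e.map_source hxe)))
  obtain ⟨r₃, hr₃, hs₃⟩ := Metric.isOpen_iff.1 e.open_source x hxe
  obtain ⟨r₄, hr₄, hs₄⟩ := Metric.isOpen_iff.1 e.open_target (e x) (e.map_source hxe)
  obtain ⟨r₅, hr₅, hs₅⟩ := Metric.continuousAt_iff.1 (e.continuousAt hxe) (min r₂ r₄ / 2)
    (by positivity)
  set A : ℝ := max (A₂ * A₁) (A₂ * A₁ ^ 2) with hA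
  have hApos : 0 < A := lt_max_of_lt_left (by positivity)
  set ρ : ℝ := min (min r₁ (min r₃ r₅) / 2) (min r₂ r₄ / 2 / A₁) with hρ
  have hρpos : 0 < ρ := by positivity
  have hρ1 : ρ ≤ r₁ / 2 := (min_le_left _ _).trans (by gcongr; exact min_le_left _ _)
  have hρ3 : ρ ≤ r₃ / 2 := (min_le_left _ _).trans
    (by gcongr; exact (min_le_right _ _).trans (min_le_left _ _))
  have hρ5 : ρ ≤ r₅ / 2 := (min_le_left _ _).trans
    (by gcongr; exact (min_le_right _ _).trans (min_le_right _ _))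
  have hρA : A₁ * ρ ≤ min r₂ r₄ / 2 := by
    have : ρ ≤ min r₂ r₄ / 2 / A₁ := min_le_right _ _
    rw [le_div_iff₀ hA₁] at this
    linarith
  refine ⟨A, ρ, hApos, hρpos, fun y hy => ?_⟩
  have hyx : dist y x < ρ := hy.2
  have hy1 : y ∈ Metric.ball x r₁ := Metric.mem_ball.2 (by linarith)
  have hye : y ∈ e.source := hs₃ (Metric.mem_ball.2 (by linarith))
  have hey : dist (e y) (e x) < min r₂ r₄ / 2 := hs₅ (by linarith)
  have hey2 : e y ∈ Metric.ball (e x) r₂ :=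
    Metric.mem_ball.2 (by linarith [min_le_left r₂ r₄, lt_min hr₂ hr₄])
  have hy0 : (e y).1 = 0 := (heK y hye).1 hy.1
  set L := fderiv ℝ e y with hL
  set M := fderiv ℝ e.symm (e y) with hM
  have hLd : HasFDerivAt e L y := (hd₁ y hy1).hasFDerivAt
  have hMd : HasFDerivAt e.symm M (e y) := (hd₂ _ hey2).hasFDerivAt
  have hML : ∀ v, M (L v) = v := by
    intro v
    have h1 := (hMd.comp y hLd).congr_of_eventuallyEq (f₁ := id)
      (((e.eventually_left_inverse hye)).mono fun z hz => hz.symm)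
    have := h1.unique (hasFDerivAt_id y)
    exact DFunLike.congr_fun this v
  have hLM : ∀ v, L (M v) = v := by
    intro v
    have hLd' : HasFDerivAt e L (e.symm (e y)) := by rwa [e.left_inv hye]
    have h1 := (hLd'.comp (e y) hMd).congr_of_eventuallyEq (f₁ := id)
      ((e.eventually_right_inverse (e.map_source hye)).mono fun z hz => hz.symm)
    have := h1.unique (hasFDerivAt_id (e y))
    exact DFunLike.congr_fun this v
  set R : EuclideanSpace ℝ (Fin (n - k)) →ₗ[ℝ] EuclideanSpace ℝ (Fin n) :=
    M.toLinearMap ∘ₗ LinearMap.inr ℝ _ _ with hR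
  have hRapp : ∀ s, R s = M (0, s) := fun s => rfl
  have hRinj : Function.Injective R := by
    intro s t hst
    rw [hRapp, hRapp] at hst
    have := congrArg L hst
    rw [hLM, hLM] at this
    exact (Prod.ext_iff.1 this).2
  set W := LinearMap.range R with hW
  have hWfin : Module.finrank ℝ W = n - k := by
    rw [hW, LinearMap.finrank_range_of_inj hRinj, finrank_euclideanSpace_fin]
  refine ⟨Wᗮ, ?_, ?_, ?_⟩
  · have := Submodule.finrank_add_finrank_orthogonal W
    rw [hWfin, finrank_euclideanSpace_fin] at this
    omega
  · intro z hz hzy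
    have hzx : dist z x < 2 * ρ := by
      have := dist_triangle z y x
      rw [dist_eq_norm z y] at this
      linarith
    have hz1 : z ∈ Metric.ball x r₁ := Metric.mem_ball.2 (by linarith)
    have hze : z ∈ e.source := hs₃ (Metric.mem_ball.2 (by linarith))
    have hz0 : (e z).1 = 0 := (heK z hze).1 hz
    have h1 := hq₁ y hy1 z hz1
    set err := e z - e y - L (z - y) with herr
    have h2 : z - y = R (e z - e y).2 - M err := by
      have h3 : (0, (e z - e y).2) = e z - e y := by
        ext1 <;> simp [hz0, hy0]
      rw [hRapp, h3, ← map_sub, herr, sub_sub_cancel, hML]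
    have h4 : Wᗮ.starProjection (R (e z - e y).2) = 0 := by
      rw [Submodule.starProjection_apply_eq_zero_iff, Submodule.orthogonal_orthogonal]
      exact LinearMap.mem_range_self _ _
    have h5 : ‖Wᗮ.starProjection (z - y)‖ ≤ ‖M err‖ := by
      rw [h2, map_sub, h4, zero_sub, norm_neg]
      exact Submodule.norm_starProjection_apply_le _ _
    calc ‖Wᗮ.starProjection (z - y)‖ ≤ ‖M err‖ := h5
      _ ≤ ‖M‖ * ‖err‖ := M.le_opNorm _
      _ ≤ A₂ * (A₁ * ‖z - y‖ ^ 2) := by gcongr; exact hb₂ _ hey2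
      _ ≤ A * ‖z - y‖ ^ 2 := by rw [← mul_assoc]; gcongr; exact le_max_left _ _
  · intro T hT hTρ
    rw [Submodule.orthogonal_orthogonal] at hT
    obtain ⟨s, rfl⟩ := hT
    have hs : ‖((0, s) : EuclideanSpace ℝ (Fin k) × EuclideanSpace ℝ (Fin (n - k)))‖ ≤
        A₁ * ‖R s‖ := by
      rw [← hLM (0, s), ← hRapp]
      exact (L.le_opNorm _).trans (by gcongr; exact hb₁ y hy1)
    set w := e y + ((0, s) : EuclideanSpace ℝ (Fin k) × EuclideanSpace ℝ (Fin (n - k))) with hw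
    have hwy : w - e y = (0, s) := by rw [hw, add_sub_cancel_left]
    have hwx : dist w (e x) < min r₂ r₄ := by
      have h1 := dist_triangle w (e y) (e x)
      rw [dist_eq_norm w (e y), hwy] at h1
      have h2 : A₁ * ‖R s‖ ≤ A₁ * ρ := by gcongr
      linarith
    have hwt : w ∈ e.target := hs₄ (Metric.mem_ball.2 (hwx.trans_le (min_le_right _ _)))
    have hw2 : w ∈ Metric.ball (e x) r₂ := Metric.mem_ball.2 (hwx.trans_le (min_le_left _ _))
    refine ⟨e.symm w, ?_, ?_⟩
    · rw [heK _ (e.map_target hwt), e.right_inv hwt, hw]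
      simp [hy0]
    · have h1 := hq₂ (e y) hey2 w hw2
      rw [e.left_inv hye, hwy, ← hM, ← hRapp] at h1
      calc _ ≤ A₂ * ‖((0, s) : EuclideanSpace ℝ (Fin k) × EuclideanSpace ℝ (Fin (n - k)))‖ ^ 2 := h1
        _ ≤ A₂ * (A₁ * ‖R s‖) ^ 2 := by gcongr
        _ = A₂ * A₁ ^ 2 * ‖R s‖ ^ 2 := by ring
        _ ≤ A * ‖R s‖ ^ 2 := by gcongr; exact le_max_right _ _

/-- The quadratic estimates are uniform along a compact `C²` submanifold. -/
lemma IsC2Submanifold.exists_isNormalSpaceWith (hK : IsC2Submanifold k K) (hkn : k < n)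
    (hc : IsCompact K) :
    ∃ A ρ : ℝ, 0 < A ∧ 0 < ρ ∧ ∀ y ∈ K, ∃ V, IsNormalSpaceWith K k A ρ y V := by
  refine hc.induction_on (p := fun S => ∃ A ρ : ℝ, 0 < A ∧ 0 < ρ ∧
    ∀ y ∈ S, ∃ V, IsNormalSpaceWith K k A ρ y V) ?_ ?_ ?_ ?_
  · exact ⟨1, 1, one_pos, one_pos, by simp⟩
  · rintro S T hST ⟨A, ρ, hA, hρ, h⟩
    exact ⟨A, ρ, hA, hρ, fun y hy => h y (hST hy)⟩
  · rintro S T ⟨A, ρ, hA, hρ, h⟩ ⟨A', ρ', hA', hρ', h'⟩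
    refine ⟨max A A', min ρ ρ', lt_max_of_lt_left hA, lt_min hρ hρ', ?_⟩
    rintro y (hy | hy)
    · obtain ⟨V, hV⟩ := h y hy
      exact ⟨V, hV.mono (le_max_left _ _) (min_le_left _ _)⟩
    · obtain ⟨V, hV⟩ := h' y hy
      exact ⟨V, hV.mono (le_max_right _ _) (min_le_right _ _)⟩
  · intro x hx
    obtain ⟨A, ρ, hA, hρ, h⟩ := hK.exists_isNormalSpaceWith_nhds hkn hx
    exact ⟨K ∩ Metric.ball x ρ, inter_mem_nhdsWithin _ (Metric.ball_mem_nhds x hρ), A, ρ, hA, hρ, h⟩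

end Geometry

/-! ### Second differences of the squared distance -/

section Sandwich

variable {n k : ℕ} {K : Set (EuclideanSpace ℝ (Fin n))}

/-- The vector from a nearest point `y ∈ K` to `x` is normal to `K` at `y`. -/
lemma IsNormalSpaceWith.sub_mem {A ρ : ℝ} (hA : 0 < A) (hρ : 0 < ρ)
    {x y : EuclideanSpace ℝ (Fin n)} {V : Submodule ℝ (EuclideanSpace ℝ (Fin n))}
    (hV : IsNormalSpaceWith K k A ρ y V) (hxy : Metric.infDist x K = dist x y) :
    x - y ∈ V := by
  have key : ∀ T ∈ Vᗮ, inner ℝ (x - y) T ≤ 0 := by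
    intro T hT
    set a := ‖x - y‖ with ha
    set B := ‖T‖ ^ 2 / 2 + a * A * ‖T‖ ^ 2 with hB
    have hB0 : 0 ≤ B := by positivity
    have step : ∀ t : ℝ, 0 < t → t * ‖T‖ < ρ → inner ℝ (x - y) T ≤ t * B := by
      intro t ht htρ
      have hn : ‖t • T‖ = t * ‖T‖ := by rw [norm_smul, Real.norm_of_nonneg ht.le]
      obtain ⟨z, hz, hzT⟩ := hV.exists_approx (t • T) (Vᗮ.smul_mem t hT) (by rwa [hn])
      rw [hn] at hzT
      have h1 : a ≤ ‖x - z‖ := by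
        rw [ha, ← dist_eq_norm, ← dist_eq_norm, ← hxy]
        exact Metric.infDist_le_dist_of_mem hz
      have h2 : ‖x - z‖ ≤ ‖x - y - t • T‖ + ‖z - y - t • T‖ := by
        have := norm_sub_le (x - y - t • T) (z - y - t • T)
        rwa [show x - y - t • T - (z - y - t • T) = x - z by abel] at this
      have h3 : ‖x - y - t • T‖ ^ 2 = a ^ 2 - 2 * (t * inner ℝ (x - y) T) + t ^ 2 * ‖T‖ ^ 2 := by
        rw [norm_sub_sq_real, inner_smul_right, hn, mul_pow]
      set e := A * (t * ‖T‖) ^ 2 with he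
      have he0 : 0 ≤ e := by positivity
      have h4 : a ^ 2 - 2 * a * e ≤ ‖x - y - t • T‖ ^ 2 := by
        have h5 : a - e ≤ ‖x - y - t • T‖ := by linarith
        rcases le_or_gt e a with h | h
        · nlinarith [norm_nonneg (x - y - t • T)]
        · nlinarith [norm_nonneg (x - y - t • T), norm_nonneg (x - y)]
      have h6 : t * inner ℝ (x - y) T ≤ t * (t * B) := by
        rw [h3] at h4
        rw [hB, he] at *
        nlinarith
      exact le_of_mul_le_mul_left h6 ht
    by_contra! hpos
    set c := inner ℝ (x - y) T with hc
    set t := min (ρ / (2 * (‖T‖ + 1))) (c / (2 * (B + 1))) with ht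
    have ht0 : 0 < t := by positivity
    have h1 : t * ‖T‖ < ρ := by
      have : t ≤ ρ / (2 * (‖T‖ + 1)) := min_le_left _ _
      rw [le_div_iff₀ (by positivity)] at this
      nlinarith [norm_nonneg T]
    have h2 := step t ht0 h1
    have h3 : t ≤ c / (2 * (B + 1)) := min_le_right _ _
    rw [le_div_iff₀ (by positivity)] at h3
    nlinarith
  rw [← Submodule.orthogonal_orthogonal V, Submodule.mem_orthogonal']
  intro T hT
  refine le_antisymm (key T hT) ?_
  have := key (-T) (Vᗮ.neg_mem hT)
  rw [inner_neg_right] at this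
  linarith

/-- Near a point `x₀` close to `K`, the distance to `K` agrees with the distance to a tangent
plane of `K` up to an error that is quadratic in the tangential displacement. The upper bound comes
from points of `K` near the tangent plane; the lower bound says that `K` has positive reach. -/
lemma IsC2Submanifold.exists_abs_infDist_sub_le (hK : IsC2Submanifold k K) (hkn : k < n)
    (hc : IsCompact K) (hne : K.Nonempty) :
    ∃ δ C : ℝ, 0 < δ ∧ 0 < C ∧ ∀ x₀, Metric.infDist x₀ K < δ →
      ∃ (y : EuclideanSpace ℝ (Fin n)) (V : Submodule ℝ (EuclideanSpace ℝ (Fin n))),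
        Module.finrank ℝ V = k ∧ x₀ - y ∈ V ∧ ‖x₀ - y‖ = Metric.infDist x₀ K ∧
        ∀ x, ‖x - x₀‖ < δ → |Metric.infDist x K - ‖V.starProjection (x - y)‖| ≤
          C * ‖Vᗮ.starProjection (x - y)‖ ^ 2 := by
  obtain ⟨A, ρ, hA, hρ, hN⟩ := hK.exists_isNormalSpaceWith hkn hc
  set δ := min (ρ / 8) (1 / (32 * A)) with hδ
  have hδ0 : 0 < δ := by positivity
  have hδρ : δ ≤ ρ / 8 := min_le_left _ _
  have hδA : A * δ ≤ 1 / 32 := by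
    have : δ ≤ 1 / (32 * A) := min_le_right _ _
    rw [le_div_iff₀ (by positivity)] at this
    linarith
  refine ⟨δ, 8 * A, hδ0, by positivity, fun x₀ hx₀ => ?_⟩
  obtain ⟨y, hy, hxy⟩ := hc.exists_infDist_eq_dist hne x₀
  obtain ⟨V, hV⟩ := hN y hy
  refine ⟨y, V, hV.finrank_eq, hV.sub_mem hA hρ hxy, by rw [hxy, dist_eq_norm], fun x hx => ?_⟩
  have hx0y : ‖x₀ - y‖ < δ := by rwa [← dist_eq_norm, ← hxy]
  have hxyn : ‖x - y‖ < 2 * δ := by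
    have := norm_add_le (x - x₀) (x₀ - y)
    rw [sub_add_sub_cancel] at this
    linarith
  have hdec : ∀ v, V.starProjection v + Vᗮ.starProjection v = v :=
    fun v => V.starProjection_add_starProjection_orthogonal v
  set N := V.starProjection (x - y) with hNdef
  set T := Vᗮ.starProjection (x - y) with hTdef
  have hTle : ‖T‖ ≤ ‖x - y‖ := Submodule.norm_starProjection_apply_le _ _
  have hNle : ‖N‖ ≤ ‖x - y‖ := Submodule.norm_starProjection_apply_le _ _
  rw [abs_sub_le_iff]
  constructor
  · obtain ⟨z, hz, hzT⟩ := hV.exists_approx T (Submodule.starProjection_apply_mem _ _)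
      (by linarith)
    have h1 := Metric.infDist_le_dist_of_mem (x := x) hz
    have h2 : dist x z ≤ ‖N‖ + ‖z - y - T‖ := by
      have h3 := norm_sub_le (x - y - T) (z - y - T)
      rw [show x - y - T - (z - y - T) = x - z by abel, ← dist_eq_norm] at h3
      rwa [show x - y - T = N from sub_eq_of_eq_add (hdec (x - y)).symm] at h3
    have h4 : A * ‖T‖ ^ 2 ≤ 8 * A * ‖T‖ ^ 2 := by
      have : 0 ≤ A * ‖T‖ ^ 2 := by positivity
      linarith
    linarith
  · obtain ⟨z, hz, hxz⟩ := hc.exists_infDist_eq_dist hne x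
    have hxz' : ‖x - z‖ ≤ ‖x - y‖ := by
      rw [← dist_eq_norm, ← dist_eq_norm, ← hxz]
      exact Metric.infDist_le_dist_of_mem hy
    have hzy : ‖z - y‖ < 4 * δ := by
      have := norm_sub_le (x - y) (x - z)
      rw [sub_sub_sub_cancel_left] at this
      linarith
    set τ := Vᗮ.starProjection (z - y) with hτ
    set ν := V.starProjection (z - y) with hν
    have hνle : ‖ν‖ ≤ ‖z - y‖ := Submodule.norm_starProjection_apply_le _ _
    have hν1 : ‖ν‖ ≤ A * ‖z - y‖ ^ 2 := hV.norm_proj_le z hz (by linarith)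
    rw [Submodule.norm_sq_eq_add_norm_sq_starProjection (z - y) V] at hν1
    have hν2 : ‖ν‖ ≤ 2 * A * ‖τ‖ ^ 2 := by
      have h1 : A * ‖ν‖ ^ 2 ≤ ‖ν‖ / 2 := by
        have h2 : A * ‖ν‖ ≤ A * (4 * δ) := by gcongr; linarith
        nlinarith [norm_nonneg ν]
      linarith
    have hsq : ‖x - z‖ ^ 2 = ‖N - ν‖ ^ 2 + ‖T - τ‖ ^ 2 := by
      rw [Submodule.norm_sq_eq_add_norm_sq_starProjection (x - z) V,
        ← sub_sub_sub_cancel_right x z y, map_sub V.starProjection (x - y) (z - y),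
        map_sub Vᗮ.starProjection (x - y) (z - y)]
    rw [hxz, dist_eq_norm]
    have hNν : ‖N‖ - ‖ν‖ ≤ ‖N - ν‖ := norm_sub_norm_le _ _
    rcases le_or_gt ‖τ‖ (2 * ‖T‖) with h | h
    · have h1 : ‖N - ν‖ ≤ ‖x - z‖ := by
        refine le_of_sq_le_sq ?_ (norm_nonneg _)
        nlinarith [sq_nonneg ‖T - τ‖]
      have h2 : ‖τ‖ ^ 2 ≤ 4 * ‖T‖ ^ 2 := by nlinarith [norm_nonneg τ, norm_nonneg T]
      have h3 : 2 * A * ‖τ‖ ^ 2 ≤ 2 * A * (4 * ‖T‖ ^ 2) := by gcongr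
      linarith
    · have h0 : 0 ≤ 8 * A * ‖T‖ ^ 2 := by positivity
      suffices ‖N‖ ≤ ‖x - z‖ by linarith
      refine le_of_sq_le_sq ?_ (norm_nonneg _)
      have h1 : ‖τ‖ / 2 ≤ ‖T - τ‖ := by
        have := norm_sub_norm_le τ T
        rw [norm_sub_rev] at this
        linarith
      have h2 : (‖τ‖ / 2) ^ 2 ≤ ‖T - τ‖ ^ 2 := pow_le_pow_left₀ (by positivity) h1 2
      have h3 : ‖N‖ ^ 2 - 2 * ‖N‖ * ‖ν‖ ≤ ‖N - ν‖ ^ 2 := by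
        rw [norm_sub_sq_real N ν]
        linarith [real_inner_le_norm N ν, sq_nonneg ‖ν‖]
      have h4 : ‖N‖ * ‖ν‖ ≤ ‖N‖ * (2 * A * ‖τ‖ ^ 2) := by gcongr
      have h5 : A * ‖N‖ ≤ 1 / 16 := by
        have : A * ‖N‖ ≤ A * (2 * δ) := by gcongr; linarith
        linarith
      have h6 : A * ‖N‖ * ‖τ‖ ^ 2 ≤ 1 / 16 * ‖τ‖ ^ 2 :=
        mul_le_mul_of_nonneg_right h5 (sq_nonneg _)
      rw [hsq]
      linarith

/-- The trace of an orthogonal projection, in an orthonormal basis. -/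
lemma sum_norm_sq_starProjection (V : Submodule ℝ (EuclideanSpace ℝ (Fin n))) :
    ∑ i, ‖V.starProjection (EuclideanSpace.basisFun (Fin n) ℝ i)‖ ^ 2 = Module.finrank ℝ V := by
  have hp : LinearMap.IsProj V (V.starProjection).toLinearMap :=
    ⟨fun x => V.starProjection_apply_mem x, fun x hx => V.starProjection_eq_self_iff.2 hx⟩
  rw [← hp.trace, LinearMap.trace_eq_sum_inner _ (EuclideanSpace.basisFun (Fin n) ℝ)]
  refine Finset.sum_congr rfl fun i _ => ?_
  set v := EuclideanSpace.basisFun (Fin n) ℝ i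
  change _ = inner ℝ v (V.starProjection v)
  rw [← real_inner_self_eq_norm_sq, Submodule.inner_starProjection_left_eq_right,
    Submodule.starProjection_eq_self_iff.2 (V.starProjection_apply_mem v)]

/-- The discrete Laplacian of the squared distance to `K` equals twice the codimension of `K`, up
to an error controlled by the distance. -/
lemma IsC2Submanifold.exists_abs_second_difference_le (hK : IsC2Submanifold k K) (hkn : k < n)
    (hc : IsCompact K) (hne : K.Nonempty) :
    ∃ δ C : ℝ, 0 < δ ∧ 0 < C ∧ ∀ x, Metric.infDist x K < δ → ∀ h, 0 < h → h < δ →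
      |∑ i, (Metric.infDist (x + h • EuclideanSpace.basisFun (Fin n) ℝ i) K ^ 2 +
        Metric.infDist (x - h • EuclideanSpace.basisFun (Fin n) ℝ i) K ^ 2 -
        2 * Metric.infDist x K ^ 2) - 2 * k * h ^ 2| ≤ C * (Metric.infDist x K + h) * h ^ 2 := by
  obtain ⟨δ, C, hδ, hC, H⟩ := hK.exists_abs_infDist_sub_le hkn hc hne
  refine ⟨δ, 4 * n * C + 1, hδ, by positivity, fun x hx h hh hhδ => ?_⟩
  obtain ⟨y, V, hVk, hxV, hxy, hS⟩ := H x hx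
  set b := EuclideanSpace.basisFun (Fin n) ℝ with hb
  have hb1 : ∀ i, ‖b i‖ = 1 := fun i => b.orthonormal.1 i
  set r := Metric.infDist x K with hr
  have hr0 : 0 ≤ r := Metric.infDist_nonneg
  set N := x - y with hN
  have hPN : V.starProjection N = N := Submodule.starProjection_eq_self_iff.2 hxV
  have hQN : Vᗮ.starProjection N = 0 := by
    have := V.starProjection_add_starProjection_orthogonal N
    rw [hPN] at this
    simpa using this
  have one : ∀ i (s : ℝ), |s| = h →
      |Metric.infDist (x + s • b i) K ^ 2 - ‖N + s • V.starProjection (b i)‖ ^ 2| ≤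
        2 * C * (r + h) * h ^ 2 := by
    intro i s hs
    have hns : ‖s • b i‖ = h := by rw [norm_smul, hb1, mul_one, Real.norm_eq_abs, hs]
    have h1 := hS (x + s • b i) (by rw [add_sub_cancel_left, hns]; exact hhδ)
    have e1 : x + s • b i - y = N + s • b i := by rw [hN]; abel
    rw [e1, map_add, map_add, hPN, hQN, zero_add, map_smul, map_smul] at h1
    have h2 : ‖s • Vᗮ.starProjection (b i)‖ ≤ h := by
      rw [norm_smul, Real.norm_eq_abs, hs]
      have := Vᗮ.norm_starProjection_apply_le (b i)
      rw [hb1] at this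
      nlinarith
    have h3 : ‖N + s • V.starProjection (b i)‖ ≤ r + h := by
      refine (norm_add_le _ _).trans ?_
      rw [hxy, norm_smul, Real.norm_eq_abs, hs]
      have := V.norm_starProjection_apply_le (b i)
      rw [hb1] at this
      nlinarith
    have h4 : Metric.infDist (x + s • b i) K ≤ r + h := by
      have := Metric.infDist_le_infDist_add_dist (s := K) (x := x + s • b i) (y := x)
      rwa [dist_eq_norm, add_sub_cancel_left, hns] at this
    have h5 : |Metric.infDist (x + s • b i) K - ‖N + s • V.starProjection (b i)‖| ≤ C * h ^ 2 :=
      h1.trans (by gcongr)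
    have h6 : (0:ℝ) ≤ Metric.infDist (x + s • b i) K := Metric.infDist_nonneg
    rw [sq_sub_sq, abs_mul, abs_of_nonneg (by positivity)]
    calc _ ≤ (r + h + (r + h)) * (C * h ^ 2) := by gcongr
      _ = _ := by ring
  have each : ∀ i, |Metric.infDist (x + h • b i) K ^ 2 + Metric.infDist (x - h • b i) K ^ 2 -
      2 * r ^ 2 - 2 * h ^ 2 * ‖V.starProjection (b i)‖ ^ 2| ≤ 4 * C * (r + h) * h ^ 2 := by
    intro i
    have h1 := one i h (abs_of_pos hh)
    have h2 := one i (-h) (by rw [abs_neg, abs_of_pos hh])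
    rw [neg_smul, neg_smul, ← sub_eq_add_neg, ← sub_eq_add_neg] at h2
    have e : ‖N + h • V.starProjection (b i)‖ ^ 2 + ‖N - h • V.starProjection (b i)‖ ^ 2 =
        2 * r ^ 2 + 2 * h ^ 2 * ‖V.starProjection (b i)‖ ^ 2 := by
      rw [norm_add_sq_real N, norm_sub_sq_real N, hxy, norm_smul, Real.norm_of_nonneg hh.le]
      ring
    rw [abs_le] at h1 h2 ⊢
    constructor <;> linarith [h1.1, h1.2, h2.1, h2.2]
  have hsum := sum_norm_sq_starProjection V
  rw [hVk] at hsum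
  have e : ∑ i, (Metric.infDist (x + h • b i) K ^ 2 + Metric.infDist (x - h • b i) K ^ 2 -
      2 * r ^ 2) - 2 * k * h ^ 2 = ∑ i, (Metric.infDist (x + h • b i) K ^ 2 +
      Metric.infDist (x - h • b i) K ^ 2 - 2 * r ^ 2 -
      2 * h ^ 2 * ‖V.starProjection (b i)‖ ^ 2) := by
    rw [Finset.sum_sub_distrib (g := fun i => 2 * h ^ 2 * ‖V.starProjection (b i)‖ ^ 2),
      ← Finset.mul_sum, hsum]
    ring
  rw [e]
  refine (Finset.abs_sum_le_sum_abs _ _).trans ?_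
  refine (Finset.sum_le_sum fun i _ => each i).trans ?_
  rw [Finset.sum_const, Finset.card_univ, Fintype.card_fin, nsmul_eq_mul]
  have : 0 ≤ (r + h) * h ^ 2 := by positivity
  nlinarith

end Sandwich

/-! ### The weak Laplacian of the squared distance -/

section WeakLaplacian

open Filter Topology

variable {n k : ℕ} {K : Set (EuclideanSpace ℝ (Fin n))} {ψ : EuclideanSpace ℝ (Fin n) → ℝ}

lemma tendsto_slope_of_hasGradientAt {f : EuclideanSpace ℝ (Fin n) → ℝ}
    {x v e : EuclideanSpace ℝ (Fin n)} (hf : HasGradientAt f v x) {h : ℕ → ℝ}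
    (h0 : ∀ m, 0 < h m) (hlim : Tendsto h atTop (𝓝 0)) :
    Tendsto (fun m => (f (x + h m • e) - f x) / h m) atTop (𝓝 (inner ℝ v e)) := by
  have h1 := (hf.hasFDerivAt.hasLineDerivAt e).tendsto_slope_zero
  have h2 : Tendsto h atTop (𝓝[≠] 0) :=
    tendsto_nhdsWithin_iff.2 ⟨hlim, Eventually.of_forall fun m => (h0 m).ne'⟩
  refine (h1.comp h2).congr fun m => ?_
  simp [div_eq_inv_mul]

/-- Discrete integration by parts. -/
lemma integral_mul_second_difference (hψ : Continuous ψ) (hs : HasCompactSupport ψ)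
    {g : EuclideanSpace ℝ (Fin n) → ℝ} (hg : Continuous g) (v : EuclideanSpace ℝ (Fin n)) :
    ∫ x, ψ x * (g (x + v) + g (x - v) - 2 * g x) =
      -∫ x, (ψ (x + v) - ψ x) * (g (x + v) - g x) := by
  have hψv : Continuous fun x => ψ (x + v) := hψ.comp (continuous_add_const v)
  have hsv : HasCompactSupport fun x => ψ (x + v) :=
    hs.comp_homeomorph (Homeomorph.addRight v)
  have hgv : Continuous fun x => g (x + v) := hg.comp (continuous_add_const v)
  have hgv' : Continuous fun x => g (x - v) := hg.comp (continuous_sub_right v)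
  have i1 : Integrable fun x => ψ x * (g (x + v) - g x) :=
    (hψ.mul (hgv.sub hg)).integrable_of_hasCompactSupport hs.mul_right
  have i2 : Integrable fun x => ψ x * (g x - g (x - v)) :=
    (hψ.mul (hg.sub hgv')).integrable_of_hasCompactSupport hs.mul_right
  have i3 : Integrable fun x => ψ (x + v) * (g (x + v) - g x) :=
    (hψv.mul (hgv.sub hg)).integrable_of_hasCompactSupport hsv.mul_right
  have e1 : ∫ x, ψ x * (g x - g (x - v)) = ∫ x, ψ (x + v) * (g (x + v) - g x) := by
    rw [← integral_add_right_eq_self (fun x => ψ x * (g x - g (x - v))) v]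
    simp only [add_sub_cancel_right]
  have e2 : ∫ x, ψ x * (g (x + v) + g (x - v) - 2 * g x) =
      (∫ x, ψ x * (g (x + v) - g x)) - ∫ x, ψ x * (g x - g (x - v)) := by
    rw [← integral_sub i1 i2]; congr 1; ext x; ring
  have e3 : ∫ x, (ψ (x + v) - ψ x) * (g (x + v) - g x) =
      (∫ x, ψ (x + v) * (g (x + v) - g x)) - ∫ x, ψ x * (g (x + v) - g x) := by
    rw [← integral_sub i3 i1]; congr 1; ext x; ring
  rw [e2, e3, e1]; ring

lemma tendsto_integral_mul_second_difference_infDist (hψ : IsLipschitzTest Kᶜ ψ)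
    {e : EuclideanSpace ℝ (Fin n)} (he : ‖e‖ = 1) {h : ℕ → ℝ} (h0 : ∀ m, 0 < h m)
    (h1 : ∀ m, h m ≤ 1) (hlim : Tendsto h atTop (𝓝 0)) :
    Tendsto (fun m => ∫ x, ψ x * (Metric.infDist (x + h m • e) K ^ 2 +
      Metric.infDist (x - h m • e) K ^ 2 - 2 * Metric.infDist x K ^ 2) / h m ^ 2) atTop
      (𝓝 (-∫ x, 2 * Metric.infDist x K *
        (inner ℝ (∇ ψ x) e * inner ℝ (∇ (fun x => Metric.infDist x K) x) e))) := by
  obtain ⟨C, hC⟩ := hψ.lipschitz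
  have hdc : Continuous fun x => Metric.infDist x K := Metric.continuous_infDist_pt K
  have hS : IsCompact (Metric.cthickening 1 (tsupport ψ)) :=
    hψ.compact_support.isCompact.cthickening
  obtain ⟨R, hR⟩ := hS.exists_bound_of_continuousOn hdc.continuousOn
  have hne : ∀ m, ‖h m • e‖ = h m := fun m => by
    rw [norm_smul, he, mul_one, Real.norm_of_nonneg (h0 m).le]
  have e1 : ∀ m, ∫ x, ψ x * (Metric.infDist (x + h m • e) K ^ 2 +
      Metric.infDist (x - h m • e) K ^ 2 - 2 * Metric.infDist x K ^ 2) / h m ^ 2 =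
      -∫ x, ((ψ (x + h m • e) - ψ x) / h m) *
        ((Metric.infDist (x + h m • e) K ^ 2 - Metric.infDist x K ^ 2) / h m) := by
    intro m
    rw [integral_div, integral_mul_second_difference hψ.continuous hψ.compact_support
      (g := fun x => Metric.infDist x K ^ 2) (hdc.pow 2) (h m • e), neg_div, ← integral_div]
    congr 2
    ext x
    have := (h0 m).ne'
    field_simp
  simp only [e1]
  refine Tendsto.neg ?_
  refine tendsto_integral_of_dominated_convergence
    ((Metric.cthickening 1 (tsupport ψ)).indicator fun _ => C * (2 * R + 1))
    (fun m => ?_) ((integrableOn_const hS.measure_lt_top.ne).integrable_indicator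
      hS.isClosed.measurableSet) (fun m => ae_of_all _ fun x => ?_) ?_
  · refine Continuous.aestronglyMeasurable ?_
    have c1 := hψ.continuous
    have c2 := hdc.comp (continuous_add_const (h m • e))
    simp only [Function.comp_def] at c2
    fun_prop
  · have b1 : |(ψ (x + h m • e) - ψ x) / h m| ≤ C := by
      rw [abs_div, abs_of_pos (h0 m), div_le_iff₀ (h0 m)]
      have := hC.dist_le_mul (x + h m • e) x
      rwa [Real.dist_eq, dist_eq_norm, add_sub_cancel_left, hne] at this
    by_cases hx : x ∈ Metric.cthickening 1 (tsupport ψ)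
    · rw [indicator_of_mem hx, norm_mul]
      refine mul_le_mul b1 ?_ (norm_nonneg _) C.coe_nonneg
      have d1 := (Metric.lipschitz_infDist_pt K).dist_le_mul (x + h m • e) x
      rw [Real.dist_eq, dist_eq_norm, add_sub_cancel_left, hne, NNReal.coe_one, one_mul] at d1
      have d2 : (0:ℝ) ≤ Metric.infDist x K := Metric.infDist_nonneg
      have d3 : (0:ℝ) ≤ Metric.infDist (x + h m • e) K := Metric.infDist_nonneg
      have d4 : Metric.infDist x K ≤ R := (le_abs_self _).trans (hR x hx)
      have d5 := (abs_le.1 d1).2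
      rw [Real.norm_eq_abs, abs_div, abs_of_pos (h0 m), div_le_iff₀ (h0 m), sq_sub_sq, abs_mul,
        abs_of_nonneg (by positivity)]
      have := h1 m
      exact mul_le_mul (by linarith) d1 (abs_nonneg _) (by linarith)
    · rw [indicator_of_notMem hx]
      have z1 : ψ x = 0 := image_eq_zero_of_notMem_tsupport fun h =>
        hx (Metric.self_subset_cthickening _ h)
      have z2 : ψ (x + h m • e) = 0 := image_eq_zero_of_notMem_tsupport fun h' =>
        hx (Metric.mem_cthickening_of_dist_le x _ _ _ h' (by
          rw [dist_eq_norm, sub_add_cancel_left, norm_neg, hne]; exact h1 m))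
      rw [z1, z2]; simp
  · filter_upwards [hψ.ae_differentiableAt, ae_differentiableAt_infDist K] with x hx hdx
    have t1 := tendsto_slope_of_hasGradientAt (e := e) hx.hasGradientAt h0 hlim
    have t2 := tendsto_slope_of_hasGradientAt (e := e)
      (hasGradientAt_comp hdx (hasDerivAt_pow 2 (Metric.infDist x K))) h0 hlim
    have := t1.mul t2
    rw [inner_smul_left] at this
    simp only [Nat.cast_ofNat, Nat.add_one_sub_one, pow_one, conj_trivial] at this
    convert this using 2
    ring

/-- The Laplacian of `d²/2`, where `d` is the distance to a compact `C²` submanifold `K` of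
codimension `k`, is `k + O(d)` near `K`, in the weak sense. Passing to the limit in discrete
Laplacians gives this without any regularity of `d` beyond its Lipschitz continuity. -/
lemma IsC2Submanifold.exists_weak_laplacian_bound (hK : IsC2Submanifold k K) (hkn : k < n)
    (hc : IsCompact K) (hne : K.Nonempty) :
    ∃ δ C : ℝ, 0 < δ ∧ 0 < C ∧ ∀ ψ, IsLipschitzTest Kᶜ ψ → (∀ x, 0 ≤ ψ x) →
      (∀ x, ψ x ≠ 0 → Metric.infDist x K < δ) →
      |(∫ x, Metric.infDist x K * inner ℝ (∇ (fun x => Metric.infDist x K) x) (∇ ψ x)) +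
        k * ∫ x, ψ x| ≤ C * ∫ x, Metric.infDist x K * ψ x := by
  obtain ⟨δ, C, hδ, hC, H⟩ := hK.exists_abs_second_difference_le hkn hc hne
  refine ⟨δ, C, hδ, hC, fun ψ hψ hψ0 hψδ => ?_⟩
  set d : EuclideanSpace ℝ (Fin n) → ℝ := fun x => Metric.infDist x K with hd
  have hdc : Continuous d := Metric.continuous_infDist_pt K
  set b := EuclideanSpace.basisFun (Fin n) ℝ with hb
  set h : ℕ → ℝ := fun m => min 1 (δ / 2) / (m + 1) with hh
  have hpos : ∀ m, 0 < h m := fun m => by positivity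
  have hle : ∀ m, h m ≤ min 1 (δ / 2) := fun m =>
    div_le_self (by positivity) (by linarith [Nat.cast_nonneg (α := ℝ) m])
  have hlim : Tendsto h atTop (𝓝 0) := by
    have := (tendsto_one_div_add_atTop_nhds_zero_nat (𝕜 := ℝ)).const_mul (min 1 (δ / 2))
    simpa only [mul_zero, mul_one_div] using this
  set F : ℕ → Fin n → EuclideanSpace ℝ (Fin n) → ℝ := fun m i x =>
    ψ x * (d (x + h m • b i) ^ 2 + d (x - h m • b i) ^ 2 - 2 * d x ^ 2) / h m ^ 2 with hF
  have hFint : ∀ m i, Integrable (F m i) := by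
    intro m i
    have c1 := hdc.comp (continuous_add_const (h m • b i))
    have c2 := hdc.comp (continuous_sub_right (h m • b i))
    simp only [Function.comp_def] at c1 c2
    refine ((hψ.continuous.mul ((((c1.pow 2).add (c2.pow 2)).sub
      (continuous_const.mul (hdc.pow 2))))).integrable_of_hasCompactSupport
      hψ.compact_support.mul_right).div_const _
  have hlimF : Tendsto (fun m => ∑ i, ∫ x, F m i x) atTop
      (𝓝 (∑ i, -∫ x, 2 * d x * (inner ℝ (∇ ψ x) (b i) * inner ℝ (∇ d x) (b i)))) :=
    tendsto_finsetSum _ fun i _ => tendsto_integral_mul_second_difference_infDist hψ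
      (b.orthonormal.1 i) hpos (fun m => (hle m).trans (min_le_left _ _)) hlim
  have hval : ∑ i, -∫ x, 2 * d x * (inner ℝ (∇ ψ x) (b i) * inner ℝ (∇ d x) (b i)) =
      -2 * ∫ x, d x * inner ℝ (∇ d x) (∇ ψ x) := by
    rw [Finset.sum_neg_distrib, ← integral_finsetSum, neg_mul, ← integral_const_mul]
    · congr 2
      ext x
      rw [← Finset.mul_sum, ← b.sum_inner_mul_inner (∇ d x) (∇ ψ x), mul_assoc]
      congr 2
      refine Finset.sum_congr rfl fun i _ => ?_
      rw [real_inner_comm (b i) (∇ ψ x), mul_comm]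
    · intro i _
      obtain ⟨L, hL⟩ := hψ.lipschitz
      refine hψ.integrable_infDist_mul (h := fun t => 2 * t) hc.isClosed hne (by fun_prop)
        (by fun_prop) ?_ ⟨L * 1, fun x => ?_⟩ fun x hx => ?_
      · exact ((measurable_gradient ψ).inner measurable_const).mul
          ((measurable_gradient d).inner measurable_const)
      · rw [abs_mul]
        have n1 : ‖b i‖ = 1 := b.orthonormal.1 i
        have i1 := abs_real_inner_le_norm (∇ ψ x) (b i)
        have i2 := abs_real_inner_le_norm (∇ d x) (b i)
        rw [n1, mul_one] at i1 i2
        have i3 := norm_gradient_le_of_lipschitzWith (Metric.lipschitz_infDist_pt K) x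
        rw [NNReal.coe_one] at i3
        exact mul_le_mul (i1.trans (norm_gradient_le_of_lipschitzWith hL x)) (i2.trans i3)
          (abs_nonneg _) L.coe_nonneg
      · rw [gradient_eq_zero_of_notMem_tsupport hx, inner_zero_left, zero_mul]
  have hdψ : Integrable fun x => d x * ψ x :=
    (hdc.mul hψ.continuous).integrable_of_hasCompactSupport hψ.compact_support.mul_left
  have hbound : ∀ m, |(∑ i, ∫ x, F m i x) - 2 * k * ∫ x, ψ x| ≤
      C * ((∫ x, d x * ψ x) + h m * ∫ x, ψ x) := by
    intro m
    rw [← integral_finsetSum _ fun i _ => hFint m i, ← integral_const_mul,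
      ← integral_sub (integrable_finsetSum _ fun i _ => hFint m i) (hψ.integrable.const_mul _),
      ← integral_const_mul, ← integral_add hdψ (hψ.integrable.const_mul _), ← integral_const_mul]
    rw [← Real.norm_eq_abs]
    refine norm_integral_le_of_norm_le ((hdψ.add (hψ.integrable.const_mul _)).const_mul _)
      (ae_of_all _ fun x => ?_)
    have hp2 : 0 < h m ^ 2 := pow_pos (hpos m) 2
    have e1 : (∑ i, F m i x) - 2 * k * ψ x = ψ x * ((∑ i, (d (x + h m • b i) ^ 2 +
        d (x - h m • b i) ^ 2 - 2 * d x ^ 2)) - 2 * k * h m ^ 2) / h m ^ 2 := by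
      rw [hF, ← Finset.sum_div, ← Finset.mul_sum]
      generalize (∑ i, (d (x + h m • b i) ^ 2 + d (x - h m • b i) ^ 2 - 2 * d x ^ 2)) = S
      rw [eq_div_iff hp2.ne', sub_mul, div_mul_cancel₀ _ hp2.ne']
      ring
    rw [e1, Real.norm_eq_abs, abs_div, abs_mul, abs_of_pos hp2, abs_of_nonneg (hψ0 x),
      div_le_iff₀ hp2]
    by_cases hx : ψ x = 0
    · simp [hx]
    · have := H x (hψδ x hx) (h m) (hpos m) (by linarith [(hle m).trans (min_le_right _ _)])
      calc _ ≤ ψ x * (C * (d x + h m) * h m ^ 2) := by gcongr; exact hψ0 x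
        _ = _ := by ring
  have l1 := (hlimF.sub_const (2 * k * ∫ x, ψ x)).abs
  have l2 : Tendsto (fun m => C * ((∫ x, d x * ψ x) + h m * ∫ x, ψ x)) atTop
      (𝓝 (C * ((∫ x, d x * ψ x) + 0 * ∫ x, ψ x))) :=
    ((hlim.mul_const _).const_add _).const_mul _
  have l3 := le_of_tendsto_of_tendsto' l1 l2 hbound
  rw [hval, zero_mul, add_zero] at l3
  have e : -2 * (∫ x, d x * inner ℝ (∇ d x) (∇ ψ x)) - 2 * k * ∫ x, ψ x =
      -2 * ((∫ x, d x * inner ℝ (∇ d x) (∇ ψ x)) + k * ∫ x, ψ x) := by ring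
  rw [e, abs_mul, abs_neg, abs_two] at l3
  have h0 := abs_nonneg ((∫ x, d x * inner ℝ (∇ d x) (∇ ψ x)) + k * ∫ x, ψ x)
  linarith

end WeakLaplacian

/-! ### Weighted integral inequalities near the submanifold -/

section WeightedHardy

variable {n k : ℕ} {U K : Set (EuclideanSpace ℝ (Fin n))} {w z : EuclideanSpace ℝ (Fin n) → ℝ}

lemma ae_norm_gradient_infDist (hc : IsCompact K) (hne : K.Nonempty) :
    ∀ᵐ x, x ∉ K → ‖∇ (fun x => Metric.infDist x K) x‖ = 1 := by
  filter_upwards [ae_differentiableAt_infDist K] with x hx hxK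
  exact norm_gradient_infDist hc hne hxK hx

lemma norm_gradient_infDist_le (x : EuclideanSpace ℝ (Fin n)) :
    ‖∇ (fun x => Metric.infDist x K) x‖ ≤ 1 := by
  simpa using norm_gradient_le_of_lipschitzWith (Metric.lipschitz_infDist_pt K) x

lemma IsLipschitzTest.infDist_pos (hw : IsLipschitzTest Kᶜ w) (hc : IsClosed K) (hne : K.Nonempty)
    {x : EuclideanSpace ℝ (Fin n)} (hx : w x ≠ 0) : 0 < Metric.infDist x K :=
  (hc.notMem_iff_infDist_pos hne).1 (hw.support_subset (subset_tsupport _ hx))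

lemma IsLipschitzTest.ae_gradient_infDist_mul (hc : IsClosed K) (hne : K.Nonempty)
    (hw : IsLipschitzTest Kᶜ w) {h h' : ℝ → ℝ} (hh : ∀ t, 0 < t → HasDerivAt h (h' t) t) :
    ∀ᵐ x, ∇ (fun x => h (Metric.infDist x K) * w x) x = h (Metric.infDist x K) • ∇ w x +
      (h' (Metric.infDist x K) * w x) • ∇ (fun x => Metric.infDist x K) x := by
  filter_upwards [ae_differentiableAt_infDist K, hw.ae_differentiableAt] with x hd hwx
  by_cases hx : x ∈ tsupport w
  · have hpos := (hc.notMem_iff_infDist_pos hne).1 (hw.support_subset hx)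
    exact (hasGradientAt_infDist_mul hd hwx (hh _ hpos)).gradient
  · have hx' : x ∉ tsupport (fun x => h (Metric.infDist x K) * w x) :=
      fun h' => hx (closure_mono (Function.support_mul_subset_right _ _) h')
    rw [gradient_eq_zero_of_notMem_tsupport hx', gradient_eq_zero_of_notMem_tsupport hx,
      image_eq_zero_of_notMem_tsupport hx]
    simp

lemma IsLipschitzTest.ae_inner_gradient_infDist_mul (hc : IsCompact K) (hne : K.Nonempty)
    (hw : IsLipschitzTest Kᶜ w) {h h' : ℝ → ℝ} (hh : ∀ t, 0 < t → HasDerivAt h (h' t) t) :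
    ∀ᵐ x, inner ℝ (∇ (fun x => Metric.infDist x K) x)
        (∇ (fun x => h (Metric.infDist x K) * w x) x) =
      h (Metric.infDist x K) * inner ℝ (∇ (fun x => Metric.infDist x K) x) (∇ w x) +
        h' (Metric.infDist x K) * w x := by
  filter_upwards [hw.ae_gradient_infDist_mul hc.isClosed hne hh, ae_norm_gradient_infDist hc hne]
    with x hx h1
  rw [hx, inner_add_right, inner_smul_right, inner_smul_right, real_inner_self_eq_norm_sq]
  by_cases hwx : w x = 0
  · simp [hwx]
  · rw [h1 (hw.support_subset (subset_tsupport _ hwx))]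
    ring

lemma contDiffOn_rpow_const_Ioi (a : ℝ) : ContDiffOn ℝ 1 (fun t : ℝ => t ^ a) (Ioi 0) :=
  contDiffOn_id.rpow_const_of_ne fun _ ht => (mem_Ioi.1 ht).ne'

lemma continuousOn_rpow_const_Ioi (a : ℝ) : ContinuousOn (fun t : ℝ => t ^ a) (Ioi 0) :=
  (contDiffOn_rpow_const_Ioi a).continuousOn

lemma hasDerivAt_rpow_const_of_pos (a : ℝ) {t : ℝ} (ht : 0 < t) :
    HasDerivAt (fun t : ℝ => t ^ a) (a * t ^ (a - 1)) t :=
  Real.hasDerivAt_rpow_const (Or.inl ht.ne')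

lemma IsLipschitzTest.infDist_rpow_mul (hc : IsClosed K) (hne : K.Nonempty) (hU : U ⊆ Kᶜ)
    (hw : IsLipschitzTest U w) (a : ℝ) :
    IsLipschitzTest U (fun x => Metric.infDist x K ^ a * w x) :=
  hw.infDist_mul hc hne hU (contDiffOn_rpow_const_Ioi a)

lemma IsLipschitzTest.integrable_rpow_mul_norm_gradient (hc : IsClosed K) (hne : K.Nonempty)
    (hw : IsLipschitzTest Kᶜ w) (a : ℝ) :
    Integrable (fun x => Metric.infDist x K ^ a * ‖∇ w x‖) := by
  have := hw.integrable_gradient_rpow hc hne (measurable_id.pow_const a)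
    (continuousOn_rpow_const_Ioi a) one_pos
  simpa only [Real.rpow_one, id] using this

/-- The weak form of `|Δ(d²/2) - k| ≤ C d` on `{d < δ}`, where `d` is the distance to `K`. -/
def WeakLaplacianBound (K : Set (EuclideanSpace ℝ (Fin n))) (k : ℕ) (δ C : ℝ) : Prop :=
  ∀ ψ, IsLipschitzTest Kᶜ ψ → (∀ x, 0 ≤ ψ x) → (∀ x, ψ x ≠ 0 → Metric.infDist x K < δ) →
    |(∫ x, Metric.infDist x K * inner ℝ (∇ (fun x => Metric.infDist x K) x) (∇ ψ x)) +
      k * ∫ x, ψ x| ≤ C * ∫ x, Metric.infDist x K * ψ x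

lemma WeakLaplacianBound.mono {δ δ' C : ℝ} (h : WeakLaplacianBound K k δ C) (hδ : δ' ≤ δ) :
    WeakLaplacianBound K k δ' C :=
  fun ψ hψ h0 hs => h ψ hψ h0 fun x hx => (hs x hx).trans_le hδ

/-- The weak form of `|div (d ^ a ∇ d) - (k + a - 1) d ^ (a - 1)| ≤ C d ^ a`, obtained by testing
with `d ^ (a - 1) z`. -/
lemma WeakLaplacianBound.rpow_mul {δ C : ℝ} (h : WeakLaplacianBound K k δ C)
    (hc : IsCompact K) (hne : K.Nonempty) (hz : IsLipschitzTest Kᶜ z) (hz0 : ∀ x, 0 ≤ z x)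
    (hzδ : ∀ x, z x ≠ 0 → Metric.infDist x K < δ) (a : ℝ) :
    |(∫ x, Metric.infDist x K ^ a * inner ℝ (∇ (fun x => Metric.infDist x K) x) (∇ z x)) +
      (k + a - 1) * ∫ x, Metric.infDist x K ^ (a - 1) * z x| ≤
      C * ∫ x, Metric.infDist x K ^ a * z x := by
  have hψ := hz.infDist_rpow_mul hc.isClosed hne subset_rfl (a - 1)
  have hd0 : ∀ x, 0 ≤ Metric.infDist x K := fun x => Metric.infDist_nonneg
  have key := h _ hψ (fun x => mul_nonneg (Real.rpow_nonneg (hd0 x) _) (hz0 x))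
    (fun x hx => hzδ x (right_ne_zero_of_mul hx))
  have i1 : Integrable fun x => Metric.infDist x K ^ a *
      inner ℝ (∇ (fun x => Metric.infDist x K) x) (∇ z x) :=
    hz.integrable_inner_gradient hc.isClosed hne (measurable_id.pow_const a)
      (continuousOn_rpow_const_Ioi a)
  have hpow : ∀ x ∈ tsupport z, ∀ b : ℝ,
      Metric.infDist x K * Metric.infDist x K ^ (b - 1) = Metric.infDist x K ^ b := by
    intro x hx b
    have hpos := (hc.isClosed.notMem_iff_infDist_pos hne).1 (hz.support_subset hx)
    rw [Real.rpow_sub_one hpos.ne']; field_simp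
  have e1 : ∫ x, Metric.infDist x K * inner ℝ (∇ (fun x => Metric.infDist x K) x)
      (∇ (fun x => Metric.infDist x K ^ (a - 1) * z x) x) =
      (∫ x, Metric.infDist x K ^ a * inner ℝ (∇ (fun x => Metric.infDist x K) x) (∇ z x)) +
      (a - 1) * ∫ x, Metric.infDist x K ^ (a - 1) * z x := by
    rw [← integral_const_mul, ← integral_add i1 (hψ.integrable.const_mul _)]
    refine integral_congr_ae ?_
    filter_upwards [hz.ae_inner_gradient_infDist_mul hc hne
      (fun t ht => hasDerivAt_rpow_const_of_pos (a - 1) ht)] with x hx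
    simp only [hx]
    by_cases hxs : x ∈ tsupport z
    · rw [← hpow x hxs a]
      linear_combination (a - 1) * z x * hpow x hxs (a - 1)
    · rw [gradient_eq_zero_of_notMem_tsupport hxs, image_eq_zero_of_notMem_tsupport hxs]
      simp
  have e2 : ∫ x, Metric.infDist x K * (Metric.infDist x K ^ (a - 1) * z x) =
      ∫ x, Metric.infDist x K ^ a * z x := by
    congr 1
    ext x
    by_cases hxs : x ∈ tsupport z
    · rw [← mul_assoc, hpow x hxs]
    · rw [image_eq_zero_of_notMem_tsupport hxs]; simp
  rw [e1, e2] at key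
  refine le_trans (le_of_eq ?_) key
  congr 1; ring

/-- One power of the distance is worth a factor `δ` on `{d < δ}`. -/
lemma IsLipschitzTest.integral_rpow_mul_le {δ : ℝ} (hc : IsCompact K) (hne : K.Nonempty)
    (hz : IsLipschitzTest Kᶜ z) (hz0 : ∀ x, 0 ≤ z x)
    (hzδ : ∀ x, z x ≠ 0 → Metric.infDist x K < δ) (a : ℝ) :
    ∫ x, Metric.infDist x K ^ a * z x ≤ δ * ∫ x, Metric.infDist x K ^ (a - 1) * z x := by
  rw [← integral_const_mul]
  refine integral_mono (hz.infDist_rpow_mul hc.isClosed hne subset_rfl a).integrable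
    ((hz.infDist_rpow_mul hc.isClosed hne subset_rfl (a - 1)).integrable.const_mul _) fun x => ?_
  by_cases hx : z x = 0
  · simp [hx]
  · have hpos := hz.infDist_pos hc.isClosed hne hx
    have e : Metric.infDist x K ^ a = Metric.infDist x K * Metric.infDist x K ^ (a - 1) := by
      rw [Real.rpow_sub_one hpos.ne']; field_simp
    simp only [e, mul_assoc]
    exact mul_le_mul_of_nonneg_right (hzδ x hx).le
      (mul_nonneg (Real.rpow_nonneg hpos.le _) (hz0 x))

/-- The weighted `L¹` Hardy inequality near `K`. -/
lemma WeakLaplacianBound.hardy {δ C : ℝ} (h : WeakLaplacianBound K k δ C) (hC : 0 ≤ C)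
    (hc : IsCompact K) (hne : K.Nonempty) (hz : IsLipschitzTest Kᶜ z) (hz0 : ∀ x, 0 ≤ z x)
    (hzδ : ∀ x, z x ≠ 0 → Metric.infDist x K < δ) {a : ℝ} (ha : C * δ ≤ (k + a - 1) / 2) :
    (k + a - 1) / 2 * ∫ x, Metric.infDist x K ^ (a - 1) * z x ≤
      ∫ x, Metric.infDist x K ^ a * ‖∇ z x‖ := by
  have h1 := (abs_le.1 (h.rpow_mul hc hne hz hz0 hzδ a)).2
  have h0 := mul_le_mul_of_nonneg_left (hz.integral_rpow_mul_le hc hne hz0 hzδ a) hC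
  have hd0 : ∀ x, 0 ≤ Metric.infDist x K := fun x => Metric.infDist_nonneg
  have i0 : 0 ≤ ∫ x, Metric.infDist x K ^ (a - 1) * z x :=
    integral_nonneg fun x => mul_nonneg (Real.rpow_nonneg (hd0 x) _) (hz0 x)
  have h2 : -∫ x, Metric.infDist x K ^ a *
      inner ℝ (∇ (fun x => Metric.infDist x K) x) (∇ z x) ≤
      ∫ x, Metric.infDist x K ^ a * ‖∇ z x‖ := by
    rw [← integral_neg]
    refine integral_mono (hz.integrable_inner_gradient hc.isClosed hne
      (measurable_id.pow_const a) (continuousOn_rpow_const_Ioi a)).neg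
      (hz.integrable_rpow_mul_norm_gradient hc.isClosed hne a) fun x => ?_
    have h3 := (abs_le.1 (abs_real_inner_le_norm (∇ (fun x => Metric.infDist x K) x) (∇ z x))).1
    have h4 : ‖∇ (fun x => Metric.infDist x K) x‖ * ‖∇ z x‖ ≤ 1 * ‖∇ z x‖ := by
      gcongr; exact norm_gradient_infDist_le x
    simp only [← mul_neg]
    exact mul_le_mul_of_nonneg_left (by linarith) (Real.rpow_nonneg (hd0 x) _)
  have h5 := mul_le_mul_of_nonneg_right ha i0
  linarith

end WeightedHardy

section Holder

variable {α : Type*} [MeasurableSpace α] {μ : Measure α} {F G : α → ℝ}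

/-- Hölder's inequality in the form of a weighted geometric mean. -/
lemma integral_rpow_mul_rpow_le (hF : Integrable F μ) (hG : Integrable G μ) (hF0 : ∀ x, 0 ≤ F x)
    (hG0 : ∀ x, 0 ≤ G x) {t : ℝ} (ht0 : 0 < t) (ht1 : t ≤ 1) :
    ∫ x, F x ^ (1 - t) * G x ^ t ∂μ ≤ (∫ x, F x ∂μ) ^ (1 - t) * (∫ x, G x ∂μ) ^ t := by
  set A := ∫ x, F x ∂μ with hA
  set B := ∫ x, G x ∂μ with hB
  have hA0 : 0 ≤ A := integral_nonneg hF0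
  have hB0 : 0 ≤ B := integral_nonneg hG0
  rcases ht1.eq_or_lt with rfl | ht1
  · simp [hB]
  have ht' : 0 < 1 - t := by linarith
  rcases hA0.eq_or_lt with h | hApos
  · have : F =ᵐ[μ] 0 := (integral_eq_zero_iff_of_nonneg hF0 hF).1 h.symm
    rw [integral_eq_zero_of_ae]
    · positivity
    · filter_upwards [this] with x hx
      rw [hx, Pi.zero_apply, Real.zero_rpow ht'.ne', zero_mul]
  rcases hB0.eq_or_lt with h | hBpos
  · have : G =ᵐ[μ] 0 := (integral_eq_zero_iff_of_nonneg hG0 hG).1 h.symm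
    rw [integral_eq_zero_of_ae]
    · positivity
    · filter_upwards [this] with x hx
      simp only [hx, Pi.zero_apply, Real.zero_rpow ht0.ne', mul_zero]
  set c := A ^ (1 - t) * B ^ t with hc
  have hc0 : 0 ≤ c := by positivity
  have pt : ∀ x, F x ^ (1 - t) * G x ^ t ≤ c * ((1 - t) * (F x / A) + t * (G x / B)) := by
    intro x
    have h1 := Real.geom_mean_le_arith_mean2_weighted ht'.le ht0.le
      (div_nonneg (hF0 x) hA0) (div_nonneg (hG0 x) hB0) (by ring)
    rw [Real.div_rpow (hF0 x) hA0, Real.div_rpow (hG0 x) hB0] at h1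
    refine le_trans (le_of_eq ?_) (mul_le_mul_of_nonneg_left h1 hc0)
    rw [hc]
    have := (Real.rpow_pos_of_pos hApos (1 - t)).ne'
    have := (Real.rpow_pos_of_pos hBpos t).ne'
    field_simp
  have i1 : Integrable (fun x => (1 - t) * (F x / A)) μ := (hF.div_const A).const_mul _
  have i2 : Integrable (fun x => t * (G x / B)) μ := (hG.div_const B).const_mul _
  calc ∫ x, F x ^ (1 - t) * G x ^ t ∂μ
      ≤ ∫ x, c * ((1 - t) * (F x / A) + t * (G x / B)) ∂μ :=
        integral_mono_of_nonneg (ae_of_all _ fun x => mul_nonneg (Real.rpow_nonneg (hF0 x) _)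
          (Real.rpow_nonneg (hG0 x) _)) ((i1.add i2).const_mul c) (ae_of_all _ pt)
    _ = c := by
        rw [integral_const_mul, integral_add i1 i2, integral_const_mul, integral_const_mul,
          integral_div, integral_div, ← hA, ← hB, div_self hApos.ne', div_self hBpos.ne']
        ring

end Holder

/-! ### The weighted Sobolev inequality near the submanifold -/

section NearInequality

variable {n k : ℕ} {K : Set (EuclideanSpace ℝ (Fin n))}

lemma norm_gradient_abs_rpow {w : EuclideanSpace ℝ (Fin n) → ℝ} {x : EuclideanSpace ℝ (Fin n)}
    (hw : DifferentiableAt ℝ w x) {s : ℝ} (hs : 1 < s) :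
    ‖∇ (fun x => |w x| ^ s) x‖ = s * |w x| ^ (s - 1) * ‖∇ w x‖ := by
  rw [(hasGradientAt_abs_rpow hw hs).gradient, norm_smul, Real.norm_eq_abs, abs_mul, abs_mul,
    abs_of_pos (by linarith : 0 < s), abs_of_nonneg (by positivity : 0 ≤ |w x| ^ (s - 2))]
  rcases eq_or_ne (w x) 0 with h | h
  · simp [h, Real.zero_rpow (by linarith : s - 1 ≠ 0)]
  · rw [mul_assoc s, ← Real.rpow_add_one (abs_pos.2 h).ne']
    ring_nf

/-- The weighted `L¹` Sobolev inequality near `K`, interpolated with the weighted `L¹` Hardy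
inequality. -/
lemma exists_weighted_sobolev_const (hn : 1 < n) (k : ℕ) {a t : ℝ} (ha : 0 < k + a - 1)
    (ht0 : 0 < t) (ht1 : t ≤ 1) :
    ∃ c : ℝ, 0 < c ∧ ∀ (K : Set (EuclideanSpace ℝ (Fin n))) (δ C : ℝ), IsCompact K → K.Nonempty →
      0 ≤ C → WeakLaplacianBound K k δ C → C * δ ≤ (k + a - 1) / 2 → ∀ z, IsLipschitzTest Kᶜ z →
      (∀ x, 0 ≤ z x) → (∀ x, z x ≠ 0 → Metric.infDist x K < δ) →
      ∫ x, (Metric.infDist x K ^ (a - 1) * z x) ^ (1 - t) *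
        ((Metric.infDist x K ^ a * z x) ^ ((n : ℝ) / (n - 1))) ^ t ≤
        (c * ∫ x, Metric.infDist x K ^ a * ‖∇ z x‖) ^ (1 - t + n / (n - 1) * t) := by
  have hn1 : (1:ℝ) < n := by exact_mod_cast hn
  obtain ⟨S, hS, hSob⟩ := exists_sobolev_const (n := n) 1 le_rfl hn1
  set κ := ((k:ℝ) + a - 1) / 2 with hκ
  have hκ0 : 0 < κ := by positivity
  refine ⟨max (1 / κ) (S * (1 + |a| / κ)), by positivity,
    fun K δ C hc hne hC hW hδ z hz hz0 hzδ => ?_⟩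
  set c := max (1 / κ) (S * (1 + |a| / κ)) with hcdef
  set d : EuclideanSpace ℝ (Fin n) → ℝ := fun x => Metric.infDist x K with hd
  have hd0 : ∀ x, 0 ≤ d x := fun x => Metric.infDist_nonneg
  set H := ∫ x, d x ^ (a - 1) * z x with hH
  set J := ∫ x, d x ^ a * ‖∇ z x‖ with hJ
  have hJ0 : 0 ≤ J := integral_nonneg fun x => by have := hd0 x; positivity
  have hH0 : 0 ≤ H := integral_nonneg fun x => mul_nonneg (Real.rpow_nonneg (hd0 x) _) (hz0 x)
  have hHJ : κ * H ≤ J := hW.hardy hC hc hne hz hz0 hzδ hδ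
  have hH1 : H ≤ J / κ := by rw [le_div_iff₀ hκ0]; linarith
  have hH2 : H ≤ c * J := by
    refine hH1.trans ?_
    rw [div_eq_mul_one_div, mul_comm]
    exact mul_le_mul_of_nonneg_right (le_max_left _ _) hJ0
  have hf := hz.infDist_rpow_mul hc.isClosed hne subset_rfl a
  have hg := hz.infDist_rpow_mul hc.isClosed hne subset_rfl (a - 1)
  have hf0 : ∀ x, 0 ≤ d x ^ a * z x := fun x => mul_nonneg (Real.rpow_nonneg (hd0 x) _) (hz0 x)
  have habs : ∀ x, |Metric.infDist x K ^ a * z x| = d x ^ a * z x := fun x =>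
    abs_of_nonneg (hf0 x)
  have hgradf : ∫ x, ‖∇ (fun x => d x ^ a * z x) x‖ ≤ J + |a| * H := by
    rw [hJ, hH, ← integral_const_mul, ← integral_add
      (hz.integrable_rpow_mul_norm_gradient hc.isClosed hne a) (hg.integrable.const_mul _)]
    refine integral_mono_of_nonneg (ae_of_all _ fun x => norm_nonneg _)
      ((hz.integrable_rpow_mul_norm_gradient hc.isClosed hne a).add (hg.integrable.const_mul _)) ?_
    filter_upwards [hz.ae_gradient_infDist_mul hc.isClosed hne
      (fun t ht => hasDerivAt_rpow_const_of_pos a ht)] with x hx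
    rw [hx]
    refine (norm_add_le _ _).trans ?_
    rw [norm_smul, norm_smul, Real.norm_of_nonneg (Real.rpow_nonneg (hd0 x) _), Real.norm_eq_abs,
      abs_mul, abs_mul, abs_of_nonneg (hz0 x), abs_of_nonneg (Real.rpow_nonneg (hd0 x) _)]
    have h1 := norm_gradient_infDist_le (K := K) x
    have h2 : 0 ≤ |a| * d x ^ (a - 1) * z x := by
      have := hd0 x; have := hz0 x; positivity
    nlinarith
  have hY := hSob _ _ hf
  simp only [Real.rpow_one, mul_one, habs] at hY
  set r : ℝ := n / (n - 1) with hr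
  have hn0 : (0:ℝ) < n - 1 := by linarith
  have hr0 : 0 < r := by positivity
  set Y := ∫ x, (d x ^ a * z x) ^ r with hYdef
  have hY0 : 0 ≤ Y := integral_nonneg fun x => Real.rpow_nonneg (hf0 x) _
  have hY1 : Y ^ (((n:ℝ) - 1) / n) ≤ c * J := by
    refine hY.trans ?_
    calc S * ∫ x, ‖∇ (fun x => d x ^ a * z x) x‖ ≤ S * (J + |a| * (J / κ)) := by
          gcongr
          exact hgradf.trans (by gcongr)
      _ = S * (1 + |a| / κ) * J := by ring
      _ ≤ c * J := mul_le_mul_of_nonneg_right (le_max_right _ _) hJ0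
  have hY2 : Y ≤ (c * J) ^ r := by
    have := Real.rpow_le_rpow (Real.rpow_nonneg hY0 _) hY1 hr0.le
    rwa [← Real.rpow_mul hY0, show ((n:ℝ) - 1) / n * r = 1 by rw [hr]; field_simp,
      Real.rpow_one] at this
  have hcJ : 0 ≤ c * J := by positivity
  have hfr : Integrable fun x => (d x ^ a * z x) ^ r := by
    have hr1 : 1 < r := by rw [hr, lt_div_iff₀ hn0]; linarith
    have := (hf.abs_rpow hr1).integrable
    simpa only [habs] using this
  calc _ ≤ H ^ (1 - t) * Y ^ t := integral_rpow_mul_rpow_le hg.integrable hfr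
        (fun x => mul_nonneg (Real.rpow_nonneg (hd0 x) _) (hz0 x))
        (fun x => Real.rpow_nonneg (hf0 x) _) ht0 ht1
    _ ≤ (c * J) ^ (1 - t) * ((c * J) ^ r) ^ t := by
        gcongr
    _ = (c * J) ^ (1 - t + r * t) := by
        rw [← Real.rpow_mul hcJ, ← Real.rpow_add_of_nonneg hcJ (by linarith) (by positivity)]

/-- The weighted critical Sobolev inequality for functions supported near `K`. It follows from the
interpolated `L¹` inequality for `|w| ^ s` with a suitable `s`, and Hölder's inequality. -/
lemma exists_near_const {p q : ℝ} (hkn : k < n) (hp : 1 < p) (hpn : p < n) (hpq : p < q)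
    (hq : q ≤ n * p / (n - p)) :
    ∃ κ c : ℝ, 0 < κ ∧ 0 < c ∧ ∀ (K : Set (EuclideanSpace ℝ (Fin n))) (δ C : ℝ), IsCompact K →
      K.Nonempty → 0 ≤ C → WeakLaplacianBound K k δ C → C * δ ≤ κ → ∀ w, IsLipschitzTest Kᶜ w →
      (∀ x, w x ≠ 0 → Metric.infDist x K < δ) →
      (∫ x, Metric.infDist x K ^ (-n + q * (n - k) / p) * |w x| ^ q) ^ (p / q) ≤
        c * ∫ x, Metric.infDist x K ^ (p - k) * ‖∇ w x‖ ^ p := by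
  have hp0 : 0 < p := by linarith
  have hq0 : 0 < q := by linarith
  have hnp : 0 < (n:ℝ) - p := by linarith
  have hn1 : 0 < (n:ℝ) - 1 := by linarith
  have hnk : 0 < (n:ℝ) - k := by
    have : (k:ℝ) < n := by exact_mod_cast hkn
    linarith
  -- `s` makes the powers of `|w|` agree in the final Hölder step, and `a` those of `d`;
  -- `t` is the share of the Sobolev inequality in the interpolation
  set B : ℝ := -n + q * (n - k) / p with hB
  set τ : ℝ := (p - 1) / p with hτ
  have hp1 : 0 < p - 1 := by linarith
  have hτ0 : 0 < τ := by positivity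
  have hτ1 : 1 - τ = 1 / p := by rw [hτ]; field_simp; ring
  set a : ℝ := (p - k) * (1 - τ) + B * τ with ha
  set s : ℝ := 1 + q * τ with hs
  have hs1 : 1 < s := by rw [hs]; linarith [mul_pos hq0 hτ0]
  have hs0 : 0 < s := by linarith
  set Q : ℝ := q / s with hQ
  have hQs : s * Q = q := by rw [hQ]; field_simp
  set t : ℝ := (n - 1) * (Q - 1) with ht
  have hqp : 1 < q / p := by rwa [one_lt_div hp0]
  have hsq : s < q := by
    have : s = 1 + q - q / p := by rw [hs, hτ]; field_simp; ring
    linarith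
  have hQ1 : 1 < Q := by rwa [hQ, one_lt_div hs0]
  have hQ0 : 0 < Q := by linarith
  have ht0 : 0 < t := mul_pos hn1 (by linarith)
  have ht1 : t ≤ 1 := by
    rw [le_div_iff₀ hnp] at hq
    have h1 : q * (n - 1) ≤ n * s := by
      have h2 : s * p = p + q * (p - 1) := by rw [hs, hτ]; field_simp
      have h3 : q * (n - 1) * p ≤ n * s * p := by
        rw [mul_assoc (n:ℝ), h2]; linarith
      exact le_of_mul_le_mul_right h3 hp0
    have h2 : Q * (n - 1) ≤ n := by
      rw [hQ, div_mul_eq_mul_div, div_le_iff₀ hs0]; exact h1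
    rw [ht]; linarith
  have hκ : (k:ℝ) + a - 1 = (n - k) * τ * (q / p - 1) := by
    rw [ha, hτ1, hB, hτ]; field_simp; ring
  have hκ0 : 0 < (k:ℝ) + a - 1 := by
    rw [hκ]; exact mul_pos (mul_pos hnk hτ0) (by linarith)
  have hexpQ : 1 - t + n / (n - 1) * t = Q := by rw [ht]; field_simp; ring
  have han : a + n - 1 = s * ((n - k) / p) := by
    rw [ha, hτ1, hB, hs, hτ]; field_simp; ring
  have hexpB : (a - 1) * (1 - t) + a * (n / (n - 1)) * t = B := by
    have e : (a - 1) * (1 - t) + a * (n / (n - 1)) * t = (a + n - 1) * Q - n := by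
      rw [ht]; field_simp; ring
    rw [e, han, hB, mul_right_comm, hQs]; ring
  obtain ⟨c, hc0, hmain⟩ := exists_weighted_sobolev_const (n := n)
    (by exact_mod_cast (by linarith : (1:ℝ) < n)) k hκ0 ht0 ht1
  refine ⟨((k:ℝ) + a - 1) / 2, (c * s) ^ p, half_pos hκ0, by positivity,
    fun K δ C hc hne hC hW hδ w hw hwδ => ?_⟩
  have hz := hw.abs_rpow hs1
  set d : EuclideanSpace ℝ (Fin n) → ℝ := fun x => Metric.infDist x K with hd
  have hd0 : ∀ x, 0 ≤ d x := fun x => Metric.infDist_nonneg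
  have hdpos : ∀ x, w x ≠ 0 → 0 < d x := fun x hx => hw.infDist_pos hc.isClosed hne hx
  have key := hmain K δ C hc hne hC hW hδ _ hz (fun x => by positivity)
    (fun x hx => hwδ x fun h => hx (by simp [h, hs0.ne']))
  rw [hexpQ] at key
  set Z := ∫ x, d x ^ B * |w x| ^ q with hZ
  have hZ0 : 0 ≤ Z := integral_nonneg fun x => by have := hd0 x; positivity
  set G := ∫ x, d x ^ (p - k) * ‖∇ w x‖ ^ p with hG
  have hG0 : 0 ≤ G := integral_nonneg fun x => by have := hd0 x; positivity
  have e1 : ∀ x, (d x ^ (a - 1) * |w x| ^ s) ^ (1 - t) *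
      ((d x ^ a * |w x| ^ s) ^ ((n:ℝ) / (n - 1))) ^ t = d x ^ B * |w x| ^ q := by
    intro x
    by_cases hx : w x = 0
    · have : 0 < (n:ℝ) / (n - 1) := div_pos (by linarith) hn1
      simp [hx, hs0.ne', hq0.ne', Real.zero_rpow this.ne', Real.zero_rpow ht0.ne']
    have hpos := hdpos x hx
    have hy : 0 < |w x| := abs_pos.2 hx
    generalize d x = r at hpos
    generalize |w x| = y at hy
    rw [Real.mul_rpow (by positivity) (by positivity), Real.mul_rpow (by positivity) (by positivity),
      Real.mul_rpow (by positivity) (by positivity)]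
    simp only [← Real.rpow_mul hpos.le, ← Real.rpow_mul hy.le]
    rw [mul_mul_mul_comm, ← Real.rpow_add hpos, ← Real.rpow_add hy, hexpB]
    congr 2
    rw [mul_assoc, ← mul_add, hexpQ, hQs]
  have hJ : ∫ x, d x ^ a * ‖∇ (fun x => |w x| ^ s) x‖ ≤ s * (G ^ (1 - τ) * Z ^ τ) := by
    have iG : Integrable fun x => d x ^ (p - k) * ‖∇ w x‖ ^ p :=
      hw.integrable_gradient_rpow hc.isClosed hne (measurable_id.pow_const _)
        (continuousOn_rpow_const_Ioi _) hp0
    have iZ : Integrable fun x => d x ^ B * |w x| ^ q :=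
      ((hw.abs_rpow (hp.trans hpq)).infDist_rpow_mul hc.isClosed hne subset_rfl B).integrable
    have h1 := integral_rpow_mul_rpow_le iG iZ (fun x => by have := hd0 x; positivity)
      (fun x => by have := hd0 x; positivity) hτ0 (by rw [hτ, div_le_one hp0]; linarith)
    refine le_trans (le_of_eq ?_) (mul_le_mul_of_nonneg_left h1 hs0.le)
    rw [← integral_const_mul]
    refine integral_congr_ae ?_
    filter_upwards [hw.ae_differentiableAt] with x hx
    simp only [norm_gradient_abs_rpow hx hs1]
    by_cases hwx : w x = 0
    · simp [hwx, hq0.ne', Real.zero_rpow hτ0.ne', Real.zero_rpow (by linarith : s - 1 ≠ 0)]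
    have hpos := hdpos x hwx
    have hy : 0 < |w x| := abs_pos.2 hwx
    have hg : 0 ≤ ‖∇ w x‖ := norm_nonneg _
    generalize d x = r at hpos
    generalize |w x| = y at hy
    generalize ‖∇ w x‖ = g at hg
    rw [Real.mul_rpow (by positivity) (by positivity), Real.mul_rpow (by positivity) (by positivity)]
    simp only [← Real.rpow_mul hpos.le, ← Real.rpow_mul hy.le, ← Real.rpow_mul hg]
    rw [show p * (1 - τ) = 1 by rw [hτ1]; field_simp, Real.rpow_one, ha, Real.rpow_add hpos,
      show s - 1 = q * τ by rw [hs]; ring]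
    ring
  have hZle : Z ≤ (c * (s * (G ^ (1 - τ) * Z ^ τ))) ^ Q := by
    have h1 : Z = ∫ x, (d x ^ (a - 1) * |w x| ^ s) ^ (1 - t) *
        ((d x ^ a * |w x| ^ s) ^ ((n:ℝ) / (n - 1))) ^ t := by
      rw [hZ]; congr 1; ext x; exact (e1 x).symm
    rw [h1]
    refine key.trans (Real.rpow_le_rpow ?_ (mul_le_mul_of_nonneg_left ?_ hc0.le) hQ0.le)
    · exact mul_nonneg hc0.le (integral_nonneg fun x => by have := hd0 x; positivity)
    · rw [← h1]; exact hJ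
  rcases hZ0.eq_or_lt with h | hZpos
  · rw [← h, Real.zero_rpow (by positivity)]
    positivity
  have h1 : Z ^ (1 / Q) ≤ c * s * G ^ (1 - τ) * Z ^ τ := by
    have := Real.rpow_le_rpow hZ0 hZle (by positivity : 0 ≤ 1 / Q)
    rw [← Real.rpow_mul (by positivity), mul_one_div_cancel hQ0.ne', Real.rpow_one] at this
    linarith
  have h2 : Z ^ (1 / q) ≤ c * s * G ^ (1 - τ) := by
    have h3 : Z ^ (1 / Q) = Z ^ (1 / q) * Z ^ τ := by
      rw [← Real.rpow_add hZpos]; congr 1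
      rw [hQ, hs]; field_simp
    rw [h3] at h1
    exact le_of_mul_le_mul_right h1 (Real.rpow_pos_of_pos hZpos _)
  have h3 := Real.rpow_le_rpow (by positivity) h2 hp0.le
  rw [Real.mul_rpow (by positivity) (by positivity), ← Real.rpow_mul hZ0, ← Real.rpow_mul hG0,
    hτ1, one_div_mul_cancel hp0.ne', Real.rpow_one, one_div_mul_eq_div] at h3
  exact h3

end NearInequality

/-! ### Ground state substitution near the submanifold -/

section GroundState

variable {n k : ℕ} {K : Set (EuclideanSpace ℝ (Fin n))} {v : EuclideanSpace ℝ (Fin n) → ℝ}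

/-- `η` is a `C¹` cutoff function with derivative `η'`, bounded by `L`: it equals `1` on `(-∞, δ]`
and `0` on `[2δ, ∞)`. -/
structure IsCutoff (δ L : ℝ) (η η' : ℝ → ℝ) : Prop where
  contDiff : ContDiff ℝ 1 η
  hasDerivAt : ∀ t, HasDerivAt η (η' t) t
  nonneg : ∀ t, 0 ≤ η t
  le_one : ∀ t, η t ≤ 1
  eq_zero : ∀ t, 2 * δ ≤ t → η t = 0
  abs_deriv_le : ∀ t, |η' t| ≤ L
  deriv_eq_zero : ∀ t, t ≤ δ → η' t = 0
  eq_one : ∀ t, t ≤ δ → η t = 1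

lemma exists_isCutoff {δ : ℝ} (hδ : 0 < δ) : ∃ L η η', IsCutoff δ L η η' := by
  set η : ℝ → ℝ := fun t => Real.smoothTransition (2 - t / δ) with hη
  have hs : ContDiff ℝ 1 η := Real.smoothTransition.contDiff.comp (by fun_prop)
  have h1 : ∀ t, t ≤ δ → η t = 1 := fun t ht => Real.smoothTransition.one_of_one_le (by
    have : t / δ ≤ 1 := (div_le_one hδ).2 ht
    linarith)
  have h0 : ∀ t, 2 * δ ≤ t → η t = 0 := fun t ht => Real.smoothTransition.zero_of_nonpos (by
    have : 2 ≤ t / δ := (le_div_iff₀ hδ).2 ht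
    linarith)
  have hn : ∀ t, 0 ≤ η t := fun t => Real.smoothTransition.nonneg _
  have hl : ∀ t, η t ≤ 1 := fun t => Real.smoothTransition.le_one _
  have hd1 : ∀ t, t ≤ δ → deriv η t = 0 := fun t ht =>
    IsLocalMax.deriv_eq_zero (Filter.Eventually.of_forall fun y => by
      rw [h1 t ht]; exact hl y)
  have hd0 : ∀ t, 2 * δ ≤ t → deriv η t = 0 := fun t ht =>
    IsLocalMin.deriv_eq_zero (Filter.Eventually.of_forall fun y => by
      rw [h0 t ht]; exact hn y)
  obtain ⟨L, hL⟩ := isCompact_Icc.exists_bound_of_continuousOn (s := Icc δ (2 * δ))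
    (hs.continuous_deriv le_rfl).continuousOn
  have hL0 : 0 ≤ L := (norm_nonneg _).trans (hL δ ⟨le_rfl, by linarith⟩)
  refine ⟨L, η, deriv η, hs, fun t => ((hs.differentiable (by simp)) t).hasDerivAt, hn, hl, h0,
    fun t => ?_, hd1, h1⟩
  by_cases h : t ∈ Icc δ (2 * δ)
  · exact hL t h
  · rw [mem_Icc, not_and_or, not_le, not_le] at h
    rcases h with h | h
    · rw [hd1 t h.le, abs_zero]; exact hL0
    · rw [hd0 t h.le, abs_zero]; exact hL0

lemma IsCutoff.nonneg_bound {δ L : ℝ} {η η' : ℝ → ℝ} (h : IsCutoff δ L η η') : 0 ≤ L :=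
  (abs_nonneg _).trans (h.abs_deriv_le 0)

lemma IsCutoff.rpow {δ L : ℝ} {η η' : ℝ → ℝ} (h : IsCutoff δ L η η') {p : ℝ} (hp : 2 ≤ p) :
    IsCutoff δ (p * L) (fun t => η t ^ p) (fun t => η' t * p * η t ^ (p - 1)) where
  contDiff := h.contDiff.rpow_const_of_le (by norm_num; linarith)
  hasDerivAt t := (h.hasDerivAt t).rpow_const (Or.inr (by linarith))
  nonneg t := Real.rpow_nonneg (h.nonneg t) _
  le_one t := Real.rpow_le_one (h.nonneg t) (h.le_one t) (by linarith)
  eq_zero t ht := by simp only [h.eq_zero t ht]; exact Real.zero_rpow (by linarith)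
  abs_deriv_le t := by
    have h0 : 0 ≤ η t ^ (p - 1) := Real.rpow_nonneg (h.nonneg t) _
    have h1 : η t ^ (p - 1) ≤ 1 := Real.rpow_le_one (h.nonneg t) (h.le_one t) (by linarith)
    rw [abs_mul, abs_mul, abs_of_nonneg h0, abs_of_pos (by linarith : 0 < p)]
    have h2 := h.abs_deriv_le t
    have h3 : |η' t| * p ≤ p * L := by rw [mul_comm]; gcongr
    calc |η' t| * p * η t ^ (p - 1) ≤ |η' t| * p * 1 := by gcongr
      _ ≤ p * L := by linarith
  deriv_eq_zero t ht := by simp only [h.deriv_eq_zero t ht, zero_mul]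
  eq_one t ht := by simp only [h.eq_one t ht, Real.one_rpow]

/-- The ground state substitution `u = d ^ α v` with `α = (p - k) / p`, pointwise. -/
lemma ae_ground_state_le {p : ℝ} (hp : 2 ≤ p) (hc : IsCompact K) (hne : K.Nonempty)
    (hv : IsLipschitzTest Kᶜ v) {α : ℝ} (hα : α = (p - k) / p) :
    ∀ᵐ x, |α| ^ p * (|Metric.infDist x K ^ α * v x| ^ p / Metric.infDist x K ^ p) +
      |α| ^ (p - 2) * α * (Metric.infDist x K ^ (1 - (k:ℝ)) *
        inner ℝ (∇ (fun x => Metric.infDist x K) x) (∇ (fun x => |v x| ^ p) x)) +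
      2 ^ (1 - p) * (Metric.infDist x K ^ (p - k) * ‖∇ v x‖ ^ p) ≤
      ‖∇ (fun x => Metric.infDist x K ^ α * v x) x‖ ^ p := by
  have hp0 : 0 < p := by linarith
  filter_upwards [hv.ae_gradient_infDist_mul hc.isClosed hne
    (fun t ht => hasDerivAt_rpow_const_of_pos α ht), ae_norm_gradient_infDist hc hne,
    hv.ae_differentiableAt] with x hx hD hdv
  by_cases hxs : x ∈ tsupport v
  swap
  · rw [(hasGradientAt_abs_rpow hdv (by linarith : 1 < p)).gradient,
      gradient_eq_zero_of_notMem_tsupport hxs, image_eq_zero_of_notMem_tsupport hxs]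
    simp [hp0.ne']
    positivity
  have hpos := (hc.isClosed.notMem_iff_infDist_pos hne).1 (hv.support_subset hxs)
  have hD1 := hD (hv.support_subset hxs)
  rw [hx, add_comm (Metric.infDist x K ^ α • ∇ v x)]
  refine le_trans (le_of_eq ?_) (norm_rpow_add_inner_add_le _ _ hp)
  rw [(hasGradientAt_abs_rpow hdv (by linarith : 1 < p)).gradient]
  simp only [norm_smul, hD1, mul_one, Real.norm_eq_abs, inner_smul_left, inner_smul_right,
    conj_trivial]
  generalize inner ℝ (∇ (fun x => Metric.infDist x K) x) (∇ v x) = g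
  generalize hN : ‖∇ v x‖ = N
  have hN0 : 0 ≤ N := hN ▸ norm_nonneg _
  generalize Metric.infDist x K = r at hpos
  generalize v x = y
  have e1 : |r ^ α * y| ^ p / r ^ p = (r ^ (α - 1) * |y|) ^ p := by
    rw [abs_mul, abs_of_pos (Real.rpow_pos_of_pos hpos _), ← Real.div_rpow (by positivity) hpos.le,
      Real.rpow_sub_one hpos.ne']
    congr 1
    ring
  have e2 : |α * r ^ (α - 1) * y| = |α| * (r ^ (α - 1) * |y|) := by
    rw [abs_mul, abs_mul, abs_of_pos (Real.rpow_pos_of_pos hpos _)]; ring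
  have e3 : (|r ^ α| * N) ^ p = r ^ (p - k) * N ^ p := by
    rw [abs_of_pos (Real.rpow_pos_of_pos hpos _), Real.mul_rpow (by positivity) hN0,
      ← Real.rpow_mul hpos.le]
    congr 2
    rw [hα]; field_simp
  have e4 : (r ^ (α - 1)) ^ (p - 2) * r ^ (α - 1) * r ^ α = r ^ (1 - (k:ℝ)) := by
    rw [← Real.rpow_mul hpos.le, ← Real.rpow_add hpos, ← Real.rpow_add hpos]
    congr 1
    rw [hα]; field_simp; ring
  rw [e1, e2, e3, Real.mul_rpow (abs_nonneg _) (by positivity),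
    Real.mul_rpow (abs_nonneg _) (by positivity), Real.mul_rpow (y := |y|) (z := p - 2)
    (by positivity) (abs_nonneg _), ← e4]
  ring

/-- The Hardy inequality with remainder near `K`. The terms that come from the curvature of `K` are
of lower order, and are absorbed by the remainder by means of the weak Laplacian bound. -/
lemma exists_near_remainder {p : ℝ} (hp : 2 ≤ p) (hc : IsCompact K) (hne : K.Nonempty)
    {δ C : ℝ} (hδ : 0 < δ) (hC : 0 ≤ C) (hW : WeakLaplacianBound K k (2 * δ) C)
    (hCδ : C * (2 * δ) ≤ 1 / 4) {α : ℝ} (hα : α = (p - k) / p) (hα0 : α ≠ 0)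
    (hαδ : |α| ^ (p - 1) * (C * ((4 * p) ^ p * (4 * δ))) ≤ 2 ^ (-p))
    {L : ℝ} {θ θ' : ℝ → ℝ} (hθ : IsCutoff δ L θ θ') :
    ∃ M : ℝ, 0 ≤ M ∧ ∀ v, IsLipschitzTest Kᶜ v →
      2 ^ (-p) * (∫ x, θ (Metric.infDist x K) * (Metric.infDist x K ^ (p - k) * ‖∇ v x‖ ^ p)) +
        |α| ^ p * (∫ x, θ (Metric.infDist x K) *
          (|Metric.infDist x K ^ α * v x| ^ p / Metric.infDist x K ^ p)) ≤
      (∫ x, θ (Metric.infDist x K) * ‖∇ (fun x => Metric.infDist x K ^ α * v x) x‖ ^ p) +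
        M * ∫ x, |Metric.infDist x K ^ α * v x| ^ p := by
  have hp0 : 0 < p := by linarith
  have hp1 : 1 < p := by linarith
  have hL := hθ.nonneg_bound
  set M₁ := L * δ ^ (1 - p) with hM₁
  set M₂ := L * δ ^ (2 - p) with hM₂
  refine ⟨|α| ^ (p - 1) * (C * (2 * M₂) + M₁), by positivity, fun v hv => ?_⟩
  set d : EuclideanSpace ℝ (Fin n) → ℝ := fun x => Metric.infDist x K with hd
  have hd0 : ∀ x, 0 ≤ d x := fun x => Metric.infDist_nonneg
  have hθm : Measurable θ := hθ.contDiff.continuous.measurable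
  have hθc : ContinuousOn θ (Ioi 0) := hθ.contDiff.continuous.continuousOn
  have hθ'e : θ' = deriv θ := funext fun t => (hθ.hasDerivAt t).deriv.symm
  have hθ'm : Continuous θ' := hθ'e ▸ hθ.contDiff.continuous_deriv le_rfl
  have hvp := hv.abs_rpow hp1
  have hz := hvp.infDist_mul (h := θ) hc.isClosed hne subset_rfl hθ.contDiff.contDiffOn
  set z : EuclideanSpace ℝ (Fin n) → ℝ := fun x => θ (d x) * |v x| ^ p with hzdef
  have hz0 : ∀ x, 0 ≤ z x := fun x => mul_nonneg (hθ.nonneg _) (by positivity)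
  have hzδ : ∀ x, z x ≠ 0 → d x < 2 * δ := fun x hx => by
    by_contra! h
    exact hx (by simp only [hzdef, hθ.eq_zero _ h, zero_mul])
  have hu := hv.infDist_rpow_mul hc.isClosed hne subset_rfl α
  have hup := hu.abs_rpow hp1
  set N := ∫ x, |d x ^ α * v x| ^ p with hN
  set I : ℝ → ℝ := fun b => ∫ x, θ (d x) * d x ^ b * inner ℝ (∇ d x) (∇ (fun x => |v x| ^ p) x)
    with hI
  set R : ℝ → ℝ := fun b => ∫ x, θ' (d x) * d x ^ b * |v x| ^ p with hR
  have hIint : ∀ b : ℝ, Integrable fun x =>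
      θ (d x) * d x ^ b * inner ℝ (∇ d x) (∇ (fun x => |v x| ^ p) x) := fun b =>
    hvp.integrable_inner_gradient (h := fun t => θ t * t ^ b) hc.isClosed hne
      (hθm.mul (measurable_id.pow_const b)) (hθc.mul (continuousOn_rpow_const_Ioi b))
  have hRint : ∀ b : ℝ, Integrable fun x => θ' (d x) * d x ^ b * |v x| ^ p := fun b =>
    hvp.integrable_infDist_mul (h := fun t => θ' t * t ^ b) (g := fun x => |v x| ^ p)
      hc.isClosed hne (hθ'm.measurable.mul (measurable_id.pow_const b))
      (hθ'm.continuousOn.mul (continuousOn_rpow_const_Ioi b)) hvp.continuous.measurable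
      (let ⟨B, _, hB⟩ := hvp.exists_bound; ⟨B, hB⟩)
      fun x hx => image_eq_zero_of_notMem_tsupport (f := fun x => |v x| ^ p) hx
  have hsplit : ∀ b : ℝ, ∫ x, d x ^ b * inner ℝ (∇ d x) (∇ z x) = I b + R b := by
    intro b
    rw [hI, hR, ← integral_add (hIint b) (hRint b)]
    refine integral_congr_ae ?_
    filter_upwards [hvp.ae_inner_gradient_infDist_mul hc hne
      (h := θ) (h' := θ') fun t _ => hθ.hasDerivAt t] with x hx
    rw [hzdef, hx]
    ring
  -- the derivative of the cutoff is only felt where the distance is at least `δ`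
  have hRb : ∀ b : ℝ, 0 ≤ p - k - b → |R b| ≤ L * δ ^ (b - (p - k)) * N := by
    intro b hb
    rw [hR, hN, ← integral_const_mul, ← Real.norm_eq_abs]
    refine norm_integral_le_of_norm_le (hup.integrable.const_mul _) (ae_of_all _ fun x => ?_)
    rw [norm_mul, norm_mul, Real.norm_eq_abs, Real.norm_of_nonneg (Real.rpow_nonneg (hd0 x) _),
      Real.norm_of_nonneg (by positivity : 0 ≤ |v x| ^ p)]
    rcases le_or_gt (d x) δ with h | h
    · rw [hθ.deriv_eq_zero _ h, abs_zero, zero_mul, zero_mul]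
      positivity
    · have hpos : 0 < d x := hδ.trans h
      have e1 : |d x ^ α * v x| ^ p = d x ^ (p - k) * |v x| ^ p := by
        rw [abs_mul, abs_of_pos (Real.rpow_pos_of_pos hpos _), Real.mul_rpow (by positivity)
          (abs_nonneg _), ← Real.rpow_mul hpos.le, hα]
        congr 2; field_simp
      have e2 : d x ^ b ≤ δ ^ (b - (p - k)) * d x ^ (p - k) := by
        have : d x ^ b = d x ^ (b - (p - k)) * d x ^ (p - k) := by
          rw [← Real.rpow_add hpos]; ring_nf
        rw [this]
        exact mul_le_mul_of_nonneg_right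
          (Real.rpow_le_rpow_of_nonpos hδ h.le (by linarith)) (by positivity)
      rw [e1]
      calc |θ' (d x)| * d x ^ b * |v x| ^ p
          ≤ L * (δ ^ (b - (p - k)) * d x ^ (p - k)) * |v x| ^ p := by
            gcongr
            exact hθ.abs_deriv_le _
        _ = _ := by ring
  have hR1 : |R (1 - k)| ≤ M₁ * N := by
    have := hRb (1 - k) (by linarith)
    rwa [show 1 - (k:ℝ) - (p - k) = 1 - p by ring] at this
  have hR2 : |R (2 - k)| ≤ M₂ * N := by
    have := hRb (2 - k) (by linarith)
    rwa [show 2 - (k:ℝ) - (p - k) = 2 - p by ring] at this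
  set Y := ∫ x, d x ^ (1 - (k:ℝ)) * z x with hY
  have hY0 : 0 ≤ Y := integral_nonneg fun x => mul_nonneg (Real.rpow_nonneg (hd0 x) _) (hz0 x)
  have hYint := (hz.infDist_rpow_mul hc.isClosed hne subset_rfl (1 - (k:ℝ))).integrable
  have hGint : Integrable fun x => θ (d x) * (d x ^ (p - k) * ‖∇ v x‖ ^ p) := by
    have := hv.integrable_gradient_rpow (h := fun t => θ t * t ^ (p - k)) hc.isClosed hne
      (hθm.mul (measurable_id.pow_const _)) (hθc.mul (continuousOn_rpow_const_Ioi _)) hp0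
    simpa only [mul_assoc] using this
  set G := ∫ x, θ (d x) * (d x ^ (p - k) * ‖∇ v x‖ ^ p) with hG
  have hI1 : |I (1 - k)| ≤ C * Y + M₁ * N := by
    have h1 := hW.rpow_mul hc hne hz hz0 hzδ (1 - (k:ℝ))
    rw [hsplit, show (k:ℝ) + (1 - k) - 1 = 0 by ring, zero_mul, add_zero] at h1
    have h3 : |I (1 - k)| ≤ |I (1 - k) + R (1 - k)| + |R (1 - k)| := by
      have := abs_sub (I (1 - k) + R (1 - k)) (R (1 - k))
      rwa [add_sub_cancel_right] at this
    linarith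
  have hI2 : |I (2 - k)| ≤ Y / 4 + (4 * p) ^ p * (2 * δ) * G := by
    have e : Y / 4 + (4 * p) ^ p * (2 * δ) * G = ∫ x, (d x ^ (1 - (k:ℝ)) * z x) / 4 +
        (4 * p) ^ p * (2 * δ) * (θ (d x) * (d x ^ (p - k) * ‖∇ v x‖ ^ p)) := by
      rw [integral_add (hYint.div_const 4) (hGint.const_mul _), integral_div, integral_const_mul]
    rw [e, hI, ← Real.norm_eq_abs]
    refine norm_integral_le_of_norm_le ((hYint.div_const 4).add (hGint.const_mul _)) ?_
    filter_upwards [hv.ae_differentiableAt] with x hdv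
    have hGp : 0 ≤ d x ^ (p - k) * ‖∇ v x‖ ^ p :=
      mul_nonneg (Real.rpow_nonneg (hd0 x) _) (by positivity)
    have hθ0 := hθ.nonneg (d x)
    rw [norm_mul, norm_mul, Real.norm_of_nonneg hθ0,
      Real.norm_of_nonneg (Real.rpow_nonneg (hd0 x) _)]
    by_cases hxs : x ∈ tsupport v
    swap
    · rw [(hasGradientAt_abs_rpow hdv hp1).gradient, gradient_eq_zero_of_notMem_tsupport hxs,
        smul_zero, inner_zero_right, norm_zero, mul_zero]
      have h1 : 0 ≤ d x ^ (1 - (k:ℝ)) * z x :=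
        mul_nonneg (Real.rpow_nonneg (hd0 x) _) (hz0 x)
      have h2 : 0 ≤ d x ^ (p - k) * ‖(0 : EuclideanSpace ℝ (Fin n))‖ ^ p :=
        mul_nonneg (Real.rpow_nonneg (hd0 x) _) (by positivity)
      positivity
    have hpos : 0 < d x := (hc.isClosed.notMem_iff_infDist_pos hne).1 (hv.support_subset hxs)
    rcases le_or_gt (2 * δ) (d x) with h | h
    · simp only [hzdef, hθ.eq_zero _ h, zero_mul, mul_zero, zero_div, add_zero, le_refl]
    have h1 : ‖inner ℝ (∇ d x) (∇ (fun x => |v x| ^ p) x)‖ ≤ p * (‖∇ v x‖ * |v x| ^ (p - 1)) := by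
      refine (norm_inner_le_norm _ _).trans ?_
      rw [norm_gradient_abs_rpow hdv hp1]
      have := norm_gradient_infDist_le (K := K) x
      have h2 : 0 ≤ p * |v x| ^ (p - 1) * ‖∇ v x‖ := by positivity
      calc _ ≤ 1 * (p * |v x| ^ (p - 1) * ‖∇ v x‖) := by gcongr
        _ = _ := by ring
    have h2 := mul_rpow_sub_one_le_quarter hp1 (mul_nonneg hpos.le (norm_nonneg (∇ v x)))
      (abs_nonneg (v x))
    rw [Real.mul_rpow hpos.le (norm_nonneg _)] at h2
    have e1 : d x ^ (2 - (k:ℝ)) = d x ^ (1 - (k:ℝ)) * d x := by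
      rw [← Real.rpow_add_one hpos.ne']; ring_nf
    have e2 : d x ^ (1 - (k:ℝ)) * d x ^ p = d x * d x ^ (p - k) := by
      rw [← Real.rpow_add hpos, mul_comm (d x), ← Real.rpow_add_one hpos.ne']; ring_nf
    have hA : 0 ≤ d x ^ (1 - (k:ℝ)) := Real.rpow_nonneg (hd0 x) _
    calc θ (d x) * d x ^ (2 - (k:ℝ)) * ‖inner ℝ (∇ d x) (∇ (fun x => |v x| ^ p) x)‖
        ≤ θ (d x) * (d x ^ (1 - (k:ℝ)) * d x) * (p * (‖∇ v x‖ * |v x| ^ (p - 1))) := by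
          rw [e1]; gcongr
      _ = θ (d x) * d x ^ (1 - (k:ℝ)) * (p * (d x * ‖∇ v x‖ * |v x| ^ (p - 1))) := by ring
      _ ≤ θ (d x) * d x ^ (1 - (k:ℝ)) *
          (|v x| ^ p / 4 + (4 * p) ^ p * (d x ^ p * ‖∇ v x‖ ^ p)) := by gcongr
      _ = d x ^ (1 - (k:ℝ)) * (θ (d x) * |v x| ^ p) / 4 + (4 * p) ^ p * (θ (d x) *
          (d x ^ (1 - (k:ℝ)) * d x ^ p * ‖∇ v x‖ ^ p)) := by ring
      _ = d x ^ (1 - (k:ℝ)) * (θ (d x) * |v x| ^ p) / 4 + (4 * p) ^ p * (d x * (θ (d x) *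
          (d x ^ (p - k) * ‖∇ v x‖ ^ p))) := by rw [e2]; ring
      _ ≤ d x ^ (1 - (k:ℝ)) * (θ (d x) * |v x| ^ p) / 4 + (4 * p) ^ p * (2 * δ * (θ (d x) *
          (d x ^ (p - k) * ‖∇ v x‖ ^ p))) := by gcongr
      _ = _ := by rw [hzdef]; ring
  -- the term `Y / 4` on the right and the error `C * (2 * δ) * Y` are absorbed on the left
  have hYle : Y ≤ (4 * p) ^ p * (4 * δ) * G + 2 * M₂ * N := by
    have h1 := hW.rpow_mul hc hne hz hz0 hzδ (2 - (k:ℝ))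
    have h2 := hz.integral_rpow_mul_le hc hne hz0 hzδ (2 - (k:ℝ))
    rw [show (2:ℝ) - k - 1 = 1 - k by ring] at h1 h2
    rw [hsplit, show (k:ℝ) + (2 - k) - 1 = 1 by ring, one_mul] at h1
    have h3 := (abs_le.1 h1).2
    have h4 := mul_le_mul_of_nonneg_left h2 hC
    have h5 := mul_le_mul_of_nonneg_right hCδ hY0
    have h6 := (abs_le.1 hI2).1
    have h7 := (abs_le.1 hR2).1
    linarith
  have hG0 : 0 ≤ G := integral_nonneg fun x => mul_nonneg (hθ.nonneg _)
    (mul_nonneg (Real.rpow_nonneg (hd0 x) _) (by positivity))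
  have hPint : Integrable fun x => θ (d x) * (|d x ^ α * v x| ^ p / d x ^ p) := by
    have := (hup.infDist_mul (h := fun t => θ t * t ^ (-p)) hc.isClosed hne subset_rfl
      (hθ.contDiff.contDiffOn.mul (contDiffOn_rpow_const_Ioi _))).integrable
    refine this.congr (ae_of_all _ fun x => ?_)
    simp only [hd]
    rw [Real.rpow_neg (hd0 x)]
    ring
  have hAint : Integrable fun x => θ (d x) * ‖∇ (fun x => d x ^ α * v x) x‖ ^ p :=
    hu.integrable_gradient_rpow hc.isClosed hne hθm hθc hp0
  have hmain : |α| ^ p * (∫ x, θ (d x) * (|d x ^ α * v x| ^ p / d x ^ p)) +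
      |α| ^ (p - 2) * α * I (1 - k) + 2 ^ (1 - p) * G ≤
      ∫ x, θ (d x) * ‖∇ (fun x => d x ^ α * v x) x‖ ^ p := by
    have i1 := hPint.const_mul (|α| ^ p)
    have i2 := (hIint (1 - k)).const_mul (|α| ^ (p - 2) * α)
    have i3 := hGint.const_mul (2 ^ (1 - p))
    have i12 : Integrable fun x => |α| ^ p * (θ (d x) * (|d x ^ α * v x| ^ p / d x ^ p)) +
        |α| ^ (p - 2) * α * (θ (d x) * d x ^ (1 - (k:ℝ)) *
          inner ℝ (∇ d x) (∇ (fun x => |v x| ^ p) x)) := i1.add i2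
    rw [hI, hG, ← integral_const_mul, ← integral_const_mul, ← integral_const_mul,
      ← integral_add i1 i2, ← integral_add i12 i3]
    refine integral_mono_ae (i12.add i3) hAint ?_
    filter_upwards [ae_ground_state_le hp hc hne hv hα] with x hx
    refine le_trans (le_of_eq ?_) (mul_le_mul_of_nonneg_left hx (hθ.nonneg (d x)))
    ring
  have hαabs : abs (|α| ^ (p - 2) * α) = |α| ^ (p - 1) := by
    rw [abs_mul, abs_of_nonneg (by positivity : 0 ≤ |α| ^ (p - 2)),
      ← Real.rpow_add_one (abs_pos.2 hα0).ne']
    ring_nf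
  have hfin : -(|α| ^ (p - 1) * (C * Y + M₁ * N)) ≤ |α| ^ (p - 2) * α * I (1 - k) := by
    refine (neg_le_neg ?_).trans (neg_abs_le _)
    rw [abs_mul, hαabs]
    gcongr
  have h8 : |α| ^ (p - 1) * (C * Y) ≤
      |α| ^ (p - 1) * (C * ((4 * p) ^ p * (4 * δ) * G + 2 * M₂ * N)) := by gcongr
  have h9 := mul_le_mul_of_nonneg_right hαδ hG0
  have h10 : (2:ℝ) ^ (1 - p) = 2 * 2 ^ (-p) := by
    rw [sub_eq_add_neg, Real.rpow_add (by norm_num), Real.rpow_one]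
  rw [h10] at hmain
  linarith

end GroundState

/-! ### The inequality up to a multiple of the `L^p` norm -/

section Combination

variable {n k : ℕ} {K : Set (EuclideanSpace ℝ (Fin n))}

lemma integrable_rpow_div_infDist {p : ℝ} (hp : 1 < p) (hc : IsClosed K) (hne : K.Nonempty)
    {f : EuclideanSpace ℝ (Fin n) → ℝ} (hf : IsLipschitzTest Kᶜ f) :
    Integrable fun x => |f x| ^ p / Metric.infDist x K ^ p := by
  refine (((hf.abs_rpow hp).infDist_rpow_mul hc hne subset_rfl (-p)).integrable).congr
    (ae_of_all _ fun x => ?_)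
  simp only
  rw [Real.rpow_neg Metric.infDist_nonneg]
  ring

/-- The critical term is controlled by the Hardy term and the Sobolev term, between which it
interpolates. -/
lemma exists_far_const {p q : ℝ} (hp : 1 < p) (hpn : p < n) (hpq : p < q)
    (hq : q ≤ n * p / (n - p)) :
    ∃ S : ℝ, 0 < S ∧ ∀ K : Set (EuclideanSpace ℝ (Fin n)), IsClosed K → K.Nonempty → ∀ f,
      IsLipschitzTest Kᶜ f →
      (∫ x, Metric.infDist x K ^ (-q + (q - p) / p * n) * |f x| ^ q) ^ (p / q) ≤
        (∫ x, |f x| ^ p / Metric.infDist x K ^ p) + S * ∫ x, ‖∇ f x‖ ^ p := by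
  have hp0 : 0 < p := by linarith
  have hq0 : 0 < q := by linarith
  have hn0 : (0:ℝ) < n := by linarith
  have hnp : 0 < (n:ℝ) - p := by linarith
  obtain ⟨S, hS, hSob⟩ := exists_sobolev_const (n := n) p hp.le hpn
  refine ⟨S, hS, fun K hc hne f hf => ?_⟩
  set r : ℝ := n * p / (n - p) with hr
  have hr1 : 1 < r := by rw [hr, lt_div_iff₀ hnp]; nlinarith
  -- the share of the Sobolev term: `p (1 - t) + r t = q`
  set t : ℝ := (q - p) * (n - p) / p ^ 2 with ht
  have ht0 : 0 < t := by
    have : 0 < q - p := by linarith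
    positivity
  have ht1 : t ≤ 1 := by
    rw [ht, div_le_one (by positivity)]
    rw [le_div_iff₀ hnp] at hq
    linarith
  have hexp : p * (1 - t) + r * t = q := by rw [hr, ht]; field_simp; ring
  have hexp2 : -p * (1 - t) = -q + (q - p) / p * n := by rw [ht]; field_simp; ring
  have hd0 : ∀ x, 0 ≤ Metric.infDist x K := fun x => Metric.infDist_nonneg
  have iX := integrable_rpow_div_infDist hp hc hne hf
  have h1 := integral_rpow_mul_rpow_le iX (hf.abs_rpow hr1).integrable
    (fun x => by have := hd0 x; positivity) (fun x => by positivity) ht0 ht1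
  have e1 : ∀ x, (|f x| ^ p / Metric.infDist x K ^ p) ^ (1 - t) * (|f x| ^ r) ^ t =
      Metric.infDist x K ^ (-q + (q - p) / p * n) * |f x| ^ q := by
    intro x
    by_cases hx : f x = 0
    · simp [hx, hq0.ne', Real.zero_rpow (by linarith : r ≠ 0), Real.zero_rpow ht0.ne']
    have hpos := hf.infDist_pos hc hne hx
    have hy : 0 < |f x| := abs_pos.2 hx
    generalize Metric.infDist x K = d at hpos
    generalize |f x| = y at hy
    rw [div_eq_mul_inv, ← Real.rpow_neg hpos.le, Real.mul_rpow (by positivity) (by positivity)]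
    simp only [← Real.rpow_mul hpos.le, ← Real.rpow_mul hy.le]
    rw [mul_right_comm, ← Real.rpow_add hy, hexp, hexp2, mul_comm]
  simp only [e1] at h1
  set X := ∫ x, |f x| ^ p / Metric.infDist x K ^ p with hX
  set Y := ∫ x, |f x| ^ r with hY
  have hX0 : 0 ≤ X := integral_nonneg fun x => by have := hd0 x; positivity
  have hY0 : 0 ≤ Y := integral_nonneg fun x => by positivity
  have hSY : Y ^ (((n:ℝ) - p) / n) ≤ S * ∫ x, ‖∇ f x‖ ^ p := hSob _ f hf
  have h2 := Real.rpow_le_rpow (integral_nonneg fun x => by have := hd0 x; positivity) h1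
    (by positivity : 0 ≤ p / q)
  refine h2.trans (le_trans ?_ (add_le_add_right hSY X))
  have h1t : 0 ≤ 1 - t := by linarith
  rw [Real.mul_rpow (by positivity) (by positivity), ← Real.rpow_mul hX0, ← Real.rpow_mul hY0]
  set w₁ : ℝ := (1 - t) * (p / q) with hw₁
  set w₂ : ℝ := r * t / q with hw₂
  have hw : w₁ + w₂ = 1 := by
    have : w₁ + w₂ = (p * (1 - t) + r * t) / q := by rw [hw₁, hw₂]; ring
    rw [this, hexp, div_self hq0.ne']
  have hw₁0 : 0 ≤ w₁ := by positivity
  have hw₂0 : 0 ≤ w₂ := by positivity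
  have e2 : Y ^ (t * (p / q)) = (Y ^ (((n:ℝ) - p) / n)) ^ w₂ := by
    rw [← Real.rpow_mul hY0]
    congr 1
    rw [hw₂, hr]; field_simp
  rw [e2]
  have hy0 : 0 ≤ Y ^ (((n:ℝ) - p) / n) := by positivity
  refine (Real.geom_mean_le_arith_mean2_weighted hw₁0 hw₂0 hX0 hy0 hw).trans ?_
  have : w₁ ≤ 1 := by linarith
  have : w₂ ≤ 1 := by linarith
  nlinarith

/-- The critical Hardy–Sobolev inequality off a compact `C²` submanifold, up to a multiple of the
`L^p` norm, and with a constant that does not depend on the submanifold. The cutoff `η(d)` splits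
`u` into a part near `K`, of the form `d ^ α (η(d) v)`, and a part away from `K`. -/
lemma exists_hardy_sobolev_const {p q : ℝ} (hkn : k < n) (hp : 2 ≤ p) (hpn : p < n)
    (hpk : p ≠ k) (hpq : p < q) (hq : q ≤ n * p / (n - p)) :
    ∃ c : ℝ, 0 < c ∧ ∀ K : Set (EuclideanSpace ℝ (Fin n)), IsC2Submanifold k K → IsCompact K →
      K.Nonempty → ∃ M : ℝ, 0 < M ∧ ∀ u, IsLipschitzTest Kᶜ u →
        c * (∫ x, Metric.infDist x K ^ (-q + (q - p) / p * n) * |u x| ^ q) ^ (p / q) ≤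
          (∫ x, ‖∇ u x‖ ^ p) - |(p - k) / p| ^ p * (∫ x, |u x| ^ p / Metric.infDist x K ^ p) +
            M * ∫ x, |u x| ^ p := by
  have hp0 : 0 < p := by linarith
  have hp1 : 1 < p := by linarith
  have hq0 : 0 < q := by linarith
  have hq1 : 1 < q := by linarith
  obtain ⟨κ, c₀, hκ, hc₀, hnear⟩ := exists_near_const hkn hp1 hpn hpq hq
  obtain ⟨S, hS, hfar⟩ := exists_far_const hp1 hpn hpq hq
  set α : ℝ := (p - k) / p with hα
  have hα0 : α ≠ 0 := div_ne_zero (sub_ne_zero.2 hpk) hp0.ne'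
  set T : ℝ := (2 ^ (q - 1)) ^ (p / q) with hT
  have hTpos : 0 < T := by positivity
  set m := max c₀ S with hm
  have hm0 : 0 < m := lt_max_of_lt_left hc₀
  set D : ℝ := T * (m * (2 ^ (p - 1) * 2 ^ p)) with hD
  have hD0 : 0 < D := by positivity
  refine ⟨1 / D, by positivity, fun K hK hc hne => ?_⟩
  obtain ⟨δ₀, C, hδ₀, hC, hW₀⟩ := hK.exists_weak_laplacian_bound hkn hc hne
  have hαp : 0 < |α| := abs_pos.2 hα0
  obtain ⟨δ, hδ, hδδ₀, hδ1, hδκ, hδα⟩ : ∃ δ : ℝ, 0 < δ ∧ 2 * δ ≤ δ₀ ∧ C * (2 * δ) ≤ 1 / 4 ∧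
      C * (2 * δ) ≤ κ ∧ |α| ^ (p - 1) * (C * ((4 * p) ^ p * (4 * δ))) ≤ 2 ^ (-p) := by
    set E := |α| ^ (p - 1) * (C * ((4 * p) ^ p * 4)) with hE
    have hE0 : 0 < E := by positivity
    refine ⟨min (min (δ₀ / 2) (1 / 4 / (C * 2))) (min (κ / (C * 2)) (2 ^ (-p) / E)), by positivity,
      ?_, ?_, ?_, ?_⟩
    · have := (min_le_left (min (δ₀ / 2) (1 / 4 / (C * 2)))
        (min (κ / (C * 2)) (2 ^ (-p) / E))).trans (min_le_left _ _)
      linarith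
    · have := (min_le_left (min (δ₀ / 2) (1 / 4 / (C * 2)))
        (min (κ / (C * 2)) (2 ^ (-p) / E))).trans (min_le_right _ _)
      rw [le_div_iff₀ (by positivity)] at this
      linarith
    · have := (min_le_right (min (δ₀ / 2) (1 / 4 / (C * 2)))
        (min (κ / (C * 2)) (2 ^ (-p) / E))).trans (min_le_left _ _)
      rw [le_div_iff₀ (by positivity)] at this
      linarith
    · have := (min_le_right (min (δ₀ / 2) (1 / 4 / (C * 2)))
        (min (κ / (C * 2)) (2 ^ (-p) / E))).trans (min_le_right _ _)
      rw [le_div_iff₀ hE0] at this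
      refine le_trans (le_of_eq ?_) this
      rw [hE]; ring
  have hW : WeakLaplacianBound K k (2 * δ) C := WeakLaplacianBound.mono hW₀ hδδ₀
  obtain ⟨L, η, η', hη⟩ := exists_isCutoff hδ
  have hL := hη.nonneg_bound
  obtain ⟨M₀, hM₀, hrem⟩ := exists_near_remainder hp hc hne hδ hC.le hW hδ1 hα hα0 hδα (hη.rpow hp)
  set M := M₀ + |α| ^ p * δ ^ (-p) + T * (m * (2 ^ (p - 1) * (2 * L ^ p)) + δ ^ (-p)) / D + 1
    with hM
  have hMpos : 0 < M := by positivity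
  refine ⟨M, hMpos, fun u hu => ?_⟩
  set d : EuclideanSpace ℝ (Fin n) → ℝ := fun x => Metric.infDist x K with hd
  have hd0 : ∀ x, 0 ≤ d x := fun x => Metric.infDist_nonneg
  have hθc : Continuous fun t => η t ^ p := (hη.rpow hp).contDiff.continuous
  have hcl := hc.isClosed
  have hv := hu.infDist_rpow_mul hcl hne subset_rfl (-α)
  have huz : ∀ x, u x ≠ 0 → 0 < d x := fun x hx => hu.infDist_pos hcl hne hx
  have hvu : (fun x => d x ^ α * (d x ^ (-α) * u x)) = u := by
    ext x
    by_cases hx : u x = 0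
    · simp [hx]
    · have := huz x hx
      rw [← mul_assoc, ← Real.rpow_add this, add_neg_cancel, Real.rpow_zero, one_mul]
  have hrem' := hrem _ hv
  simp only [hd] at hvu
  rw [hvu] at hrem'
  have hvu' : ∀ x, d x ^ α * (d x ^ (-α) * u x) = u x := fun x => congrFun hvu x
  simp only [hd] at hvu'
  simp only [hvu'] at hrem'
  set v : EuclideanSpace ℝ (Fin n) → ℝ := fun x => d x ^ (-α) * u x with hvdef
  set N := ∫ x, |u x| ^ p with hN
  have hN0 : 0 ≤ N := integral_nonneg fun x => by positivity
  set G := ∫ x, η (d x) ^ p * (d x ^ (p - k) * ‖∇ v x‖ ^ p) with hG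
  set P := ∫ x, |u x| ^ p / d x ^ p with hP
  set P₁ := ∫ x, η (d x) ^ p * (|u x| ^ p / d x ^ p) with hP₁
  set A := ∫ x, ‖∇ u x‖ ^ p with hA
  set A₁ := ∫ x, η (d x) ^ p * ‖∇ u x‖ ^ p with hA₁
  set A₂ := ∫ x, (1 - η (d x) ^ p) * ‖∇ u x‖ ^ p with hA₂
  have h1 : 2 ^ (-p) * G + |α| ^ p * P₁ ≤ A₁ + M₀ * N := hrem'
  have iN : Integrable fun x => |u x| ^ p := (hu.abs_rpow hp1).integrable
  have iP := integrable_rpow_div_infDist hp1 hcl hne hu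
  have iA₁ : Integrable fun x => η (d x) ^ p * ‖∇ u x‖ ^ p :=
    hu.integrable_gradient_rpow hcl hne hθc.measurable hθc.continuousOn hp0
  have iA₂ : Integrable fun x => (1 - η (d x) ^ p) * ‖∇ u x‖ ^ p :=
    hu.integrable_gradient_rpow (h := fun t => 1 - η t ^ p) hcl hne
      (measurable_const.sub hθc.measurable) (continuous_const.sub hθc).continuousOn hp0
  have hAsum : A = A₁ + A₂ := by
    rw [hA, hA₁, hA₂, ← integral_add iA₁ iA₂]
    congr 1; ext x; ring
  have hA₂0 : 0 ≤ A₂ := integral_nonneg fun x =>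
    mul_nonneg (sub_nonneg.2 ((hη.rpow hp).le_one (d x))) (by positivity)
  have hG0 : 0 ≤ G := integral_nonneg fun x => mul_nonneg ((hη.rpow hp).nonneg (d x))
    (mul_nonneg (Real.rpow_nonneg (hd0 x) _) (by positivity))
  -- away from `K` the Hardy weight is bounded
  have hweight : ∀ x, η (d x) ≠ 1 → |u x| ^ p / d x ^ p ≤ δ ^ (-p) * |u x| ^ p := by
    intro x hx
    have hδx : δ ≤ d x := by
      by_contra! h
      exact hx (hη.eq_one _ h.le)
    rw [Real.rpow_neg hδ.le, ← div_eq_inv_mul]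
    gcongr
  have iP₁ : Integrable fun x => η (d x) ^ p * (|u x| ^ p / d x ^ p) := by
    have := ((hu.abs_rpow hp1).infDist_mul (h := fun t => η t ^ p * t ^ (-p)) hcl hne subset_rfl
      ((hη.rpow hp).contDiff.contDiffOn.mul (contDiffOn_rpow_const_Ioi _))).integrable
    refine this.congr (ae_of_all _ fun x => ?_)
    simp only [hd]
    rw [Real.rpow_neg (hd0 x)]
    ring
  have hP2 : P ≤ P₁ + δ ^ (-p) * N := by
    rw [hP, hP₁, hN, ← integral_const_mul, ← integral_add iP₁ (iN.const_mul _)]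
    refine integral_mono iP (iP₁.add (iN.const_mul _)) fun x => ?_
    have h0 : 0 ≤ |u x| ^ p / d x ^ p := div_nonneg (by positivity) (Real.rpow_nonneg (hd0 x) _)
    by_cases hx : η (d x) = 1
    · have : 0 ≤ δ ^ (-p) * |u x| ^ p := by positivity
      simp only [hx, Real.one_rpow, one_mul]
      linarith
    · have := hweight x hx
      have h2 : 0 ≤ η (d x) ^ p * (|u x| ^ p / d x ^ p) :=
        mul_nonneg ((hη.rpow hp).nonneg (d x)) h0
      exact this.trans (le_add_of_nonneg_left h2)
  have hw := hv.infDist_mul (h := η) hcl hne subset_rfl hη.contDiff.contDiffOn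
  have hf := hu.infDist_mul (h := fun t => 1 - η t) hcl hne subset_rfl
    (contDiff_const.sub hη.contDiff).contDiffOn
  set Wn := ∫ x, d x ^ (p - k) * ‖∇ (fun x => η (d x) * v x) x‖ ^ p with hWn
  set Wf := ∫ x, ‖∇ (fun x => (1 - η (d x)) * u x) x‖ ^ p with hWf
  have hDle : ∀ x, ‖∇ d x‖ ≤ 1 := norm_gradient_infDist_le
  have hWnle : Wn ≤ 2 ^ (p - 1) * (G + L ^ p * N) := by
    have iG : Integrable fun x => η (d x) ^ p * (d x ^ (p - k) * ‖∇ v x‖ ^ p) := by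
      have := hv.integrable_gradient_rpow (h := fun t => η t ^ p * t ^ (p - k)) hcl hne
        (hθc.measurable.mul (measurable_id.pow_const _))
        (hθc.continuousOn.mul (continuousOn_rpow_const_Ioi _)) hp0
      simpa only [mul_assoc] using this
    have i1 := (iG.add (iN.const_mul (L ^ p))).const_mul (2 ^ (p - 1))
    rw [hWn, hG, hN, ← integral_const_mul (L ^ p), ← integral_add iG (iN.const_mul _),
      ← integral_const_mul]
    refine integral_mono_of_nonneg (ae_of_all _ fun x => mul_nonneg (Real.rpow_nonneg (hd0 x) _)
      (by positivity)) i1 ?_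
    filter_upwards [hv.ae_gradient_infDist_mul hcl hne (h := η) (h' := η')
      fun t _ => hη.hasDerivAt t] with x hx
    have hup : d x ^ (p - k) * |v x| ^ p = |u x| ^ p := by
      by_cases hxu : u x = 0
      · simp [hvdef, hxu, hp0.ne']
      · have hpos := huz x hxu
        rw [hvdef]
        simp only
        rw [abs_mul, abs_of_pos (Real.rpow_pos_of_pos hpos _), Real.mul_rpow (by positivity)
          (abs_nonneg _), ← Real.rpow_mul hpos.le, ← mul_assoc, ← Real.rpow_add hpos,
          show p - k + -α * p = 0 by rw [hα]; field_simp; ring, Real.rpow_zero, one_mul]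
    rw [hx]
    have h2 := norm_add_rpow_le (η (d x) • ∇ v x) ((η' (d x) * v x) • ∇ d x) hp1.le
    have h3 : ‖(η' (d x) * v x) • ∇ d x‖ ^ p ≤ L ^ p * |v x| ^ p := by
      rw [norm_smul, norm_mul, ← Real.mul_rpow hL (abs_nonneg _)]
      refine Real.rpow_le_rpow (by positivity) ?_ hp0.le
      have := hη.abs_deriv_le (d x)
      calc _ ≤ L * |v x| * 1 := by
            gcongr
            · exact this
            · exact le_rfl
            · exact hDle x
        _ = _ := mul_one _
    have h4 : ‖η (d x) • ∇ v x‖ ^ p = η (d x) ^ p * ‖∇ v x‖ ^ p := by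
      rw [norm_smul, Real.norm_of_nonneg (hη.nonneg _), Real.mul_rpow (hη.nonneg _) (norm_nonneg _)]
    rw [h4] at h2
    have hdp : 0 ≤ d x ^ (p - k) := Real.rpow_nonneg (hd0 x) _
    calc d x ^ (p - k) * ‖η (d x) • ∇ v x + (η' (d x) * v x) • ∇ d x‖ ^ p
        ≤ d x ^ (p - k) * (2 ^ (p - 1) * (η (d x) ^ p * ‖∇ v x‖ ^ p + L ^ p * |v x| ^ p)) := by
          refine mul_le_mul_of_nonneg_left (h2.trans ?_) hdp
          gcongr
      _ = 2 ^ (p - 1) * (η (d x) ^ p * (d x ^ (p - k) * ‖∇ v x‖ ^ p) +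
          L ^ p * (d x ^ (p - k) * |v x| ^ p)) := by ring
      _ = _ := by rw [hup]
  have hWfle : Wf ≤ 2 ^ (p - 1) * (A₂ + L ^ p * N) := by
    have i1 := (iA₂.add (iN.const_mul (L ^ p))).const_mul (2 ^ (p - 1))
    rw [hWf, hA₂, hN, ← integral_const_mul (L ^ p), ← integral_add iA₂ (iN.const_mul _),
      ← integral_const_mul]
    refine integral_mono_of_nonneg (ae_of_all _ fun x => by positivity) i1 ?_
    filter_upwards [hu.ae_gradient_infDist_mul hcl hne (h := fun t => 1 - η t)
      (h' := fun t => -η' t) fun t _ => (hη.hasDerivAt t).const_sub 1] with x hx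
    rw [hx]
    have hη1 : 0 ≤ 1 - η (d x) := sub_nonneg.2 (hη.le_one _)
    have h2 := norm_add_rpow_le ((1 - η (d x)) • ∇ u x) ((-η' (d x) * u x) • ∇ d x) hp1.le
    have h3 : ‖(-η' (d x) * u x) • ∇ d x‖ ^ p ≤ L ^ p * |u x| ^ p := by
      rw [norm_smul, norm_mul, norm_neg, ← Real.mul_rpow hL (abs_nonneg _)]
      refine Real.rpow_le_rpow (by positivity) ?_ hp0.le
      have := hη.abs_deriv_le (d x)
      calc _ ≤ L * |u x| * 1 := by
            gcongr
            · exact this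
            · exact le_rfl
            · exact hDle x
        _ = _ := mul_one _
    have h4 : ‖(1 - η (d x)) • ∇ u x‖ ^ p ≤ (1 - η (d x) ^ p) * ‖∇ u x‖ ^ p := by
      rw [norm_smul, Real.norm_of_nonneg hη1, Real.mul_rpow hη1 (norm_nonneg _)]
      refine mul_le_mul_of_nonneg_right ?_ (by positivity)
      have := Real.add_rpow_le_rpow_add hη1 (hη.nonneg (d x)) hp1.le
      rw [sub_add_cancel, Real.one_rpow] at this
      linarith
    refine h2.trans ?_
    gcongr
  have hZn := hnear K (2 * δ) C hc hne hC.le hW hδκ _ hw (fun x hx => by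
    by_contra! h
    exact hx (by simp only [hη.eq_zero _ h, zero_mul]))
  have hZf := hfar K hcl hne _ hf
  set e : ℝ := -q + (q - p) / p * n with he
  have hZn' : ∀ x, d x ^ (-n + q * (n - k) / p) * |η (d x) * v x| ^ q =
      d x ^ e * |η (d x) * u x| ^ q := by
    intro x
    by_cases hxu : u x = 0
    · simp [hvdef, hxu, hq0.ne']
    · have hpos := huz x hxu
      have e1 : |η (d x) * v x| = d x ^ (-α) * |η (d x) * u x| := by
        simp only [hvdef]
        rw [mul_left_comm, abs_mul, abs_of_pos (Real.rpow_pos_of_pos hpos _)]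
      rw [e1, Real.mul_rpow (by positivity) (abs_nonneg _), ← Real.rpow_mul hpos.le, ← mul_assoc,
        ← Real.rpow_add hpos]
      congr 2
      rw [he, hα]; field_simp; ring
  simp only [hd] at hZn'
  simp only [hd, hvdef] at hZn
  simp only [hvdef, hd] at hZn'
  simp only [hZn'] at hZn
  have hXf : ∫ x, |(1 - η (d x)) * u x| ^ p / d x ^ p ≤ δ ^ (-p) * N := by
    rw [hN, ← integral_const_mul]
    refine integral_mono (integrable_rpow_div_infDist hp1 hcl hne hf) (iN.const_mul _) fun x => ?_
    have hη1 : 0 ≤ 1 - η (d x) := sub_nonneg.2 (hη.le_one _)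
    by_cases hx : η (d x) = 1
    · simp only [hx, sub_self, zero_mul, abs_zero, Real.zero_rpow hp0.ne', zero_div]
      positivity
    · refine le_trans ?_ (hweight x hx)
      have h2 : |(1 - η (d x)) * u x| ≤ |u x| := by
        rw [abs_mul, abs_of_nonneg hη1]
        have := hη.nonneg (d x)
        exact mul_le_of_le_one_left (abs_nonneg _) (by linarith)
      have h3 := hd0 x
      gcongr
  set Z := ∫ x, d x ^ e * |u x| ^ q with hZ
  set Zn := ∫ x, d x ^ e * |η (d x) * u x| ^ q with hZndef
  set Zf := ∫ x, d x ^ e * |(1 - η (d x)) * u x| ^ q with hZfdef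
  have hZn2 : Zn ^ (p / q) ≤ c₀ * Wn := hZn
  have hZf2 : Zf ^ (p / q) ≤ δ ^ (-p) * N + S * Wf := hZf.trans (add_le_add_left hXf _)
  have hηu := hu.infDist_mul (h := η) hcl hne subset_rfl hη.contDiff.contDiffOn
  have hnn : ∀ f : EuclideanSpace ℝ (Fin n) → ℝ, ∀ x, 0 ≤ d x ^ e * |f x| ^ q := fun f x =>
    mul_nonneg (Real.rpow_nonneg (hd0 x) _) (by positivity)
  have hZn0 : 0 ≤ Zn := integral_nonneg (hnn _)
  have hZf0 : 0 ≤ Zf := integral_nonneg (hnn _)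
  have hZle : Z ≤ 2 ^ (q - 1) * (Zn + Zf) := by
    have i1 := ((hηu.abs_rpow hq1).infDist_rpow_mul hcl hne subset_rfl e).integrable
    have i2 := ((hf.abs_rpow hq1).infDist_rpow_mul hcl hne subset_rfl e).integrable
    rw [hZ, hZndef, hZfdef, ← integral_add i1 i2, ← integral_const_mul]
    refine integral_mono_of_nonneg (ae_of_all _ (hnn _)) ((i1.add i2).const_mul _)
      (ae_of_all _ fun x => ?_)
    have h2 := norm_add_rpow_le (η (d x) * u x) ((1 - η (d x)) * u x) hq1.le
    rw [show η (d x) * u x + (1 - η (d x)) * u x = u x by ring] at h2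
    simp only [Real.norm_eq_abs] at h2
    calc d x ^ e * |u x| ^ q ≤ d x ^ e * (2 ^ (q - 1) *
          (|η (d x) * u x| ^ q + |(1 - η (d x)) * u x| ^ q)) :=
          mul_le_mul_of_nonneg_left h2 (Real.rpow_nonneg (hd0 x) _)
      _ = _ := by ring
  have hZpow : Z ^ (p / q) ≤ T * (Zn ^ (p / q) + Zf ^ (p / q)) := by
    have h2 := Real.rpow_le_rpow (integral_nonneg (hnn _)) hZle (by positivity : 0 ≤ p / q)
    rw [Real.mul_rpow (by positivity) (by positivity)] at h2
    refine h2.trans (mul_le_mul_of_nonneg_left ?_ hTpos.le)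
    exact Real.rpow_add_le_add_rpow hZn0 hZf0 (by positivity) ((div_le_one hq0).2 hpq.le)
  have h2p : (1:ℝ) ≤ 2 ^ p := Real.one_le_rpow (by norm_num) hp0.le
  have h2p' : (2:ℝ) ^ p * 2 ^ (-p) = 1 := by rw [← Real.rpow_add (by norm_num)]; simp
  have hGA : G + A₂ ≤ 2 ^ p * (A - |α| ^ p * P + (M₀ + |α| ^ p * δ ^ (-p)) * N) := by
    have h3 : 2 ^ (-p) * G + A₂ ≤ A - |α| ^ p * P + (M₀ + |α| ^ p * δ ^ (-p)) * N := by
      have h4 := mul_le_mul_of_nonneg_left hP2 (by positivity : 0 ≤ |α| ^ p)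
      rw [hAsum]
      linarith
    have h5 := mul_le_mul_of_nonneg_left h3 (by positivity : (0:ℝ) ≤ 2 ^ p)
    rw [mul_add, ← mul_assoc, h2p', one_mul] at h5
    have h6 := mul_le_mul_of_nonneg_right h2p hA₂0
    linarith
  have hWn0 : 0 ≤ Wn := integral_nonneg fun x =>
    mul_nonneg (Real.rpow_nonneg (hd0 x) _) (by positivity)
  have hWf0 : 0 ≤ Wf := integral_nonneg fun x => by positivity
  have hfinal : Z ^ (p / q) ≤ D * (A - |α| ^ p * P + M * N) := by
    calc Z ^ (p / q) ≤ T * (m * Wn + (δ ^ (-p) * N + m * Wf)) := by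
          refine hZpow.trans (mul_le_mul_of_nonneg_left (add_le_add (hZn2.trans ?_)
            (hZf2.trans ?_)) hTpos.le)
          · exact mul_le_mul_of_nonneg_right (le_max_left _ _) hWn0
          · exact add_le_add_right (mul_le_mul_of_nonneg_right (le_max_right _ _) hWf0) _
      _ ≤ T * (m * (2 ^ (p - 1) * (G + L ^ p * N)) +
          (δ ^ (-p) * N + m * (2 ^ (p - 1) * (A₂ + L ^ p * N)))) := by gcongr
      _ = T * (m * (2 ^ (p - 1) * (G + A₂))) +
          T * (m * (2 ^ (p - 1) * (2 * L ^ p)) + δ ^ (-p)) * N := by ring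
      _ ≤ T * (m * (2 ^ (p - 1) *
            (2 ^ p * (A - |α| ^ p * P + (M₀ + |α| ^ p * δ ^ (-p)) * N)))) +
          T * (m * (2 ^ (p - 1) * (2 * L ^ p)) + δ ^ (-p)) * N := by gcongr
      _ = D * (A - |α| ^ p * P + (M - 1) * N) := by
          have e1 : M - 1 = M₀ + |α| ^ p * δ ^ (-p) +
            T * (m * (2 ^ (p - 1) * (2 * L ^ p)) + δ ^ (-p)) / D := by rw [hM]; ring
          have e2 : D * (T * (m * (2 ^ (p - 1) * (2 * L ^ p)) + δ ^ (-p)) / D * N) =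
              T * (m * (2 ^ (p - 1) * (2 * L ^ p)) + δ ^ (-p)) * N := by
            field_simp
          rw [e1, show ∀ a b c e : ℝ, D * (a - b + (c + e) * N) = D * (a - b + c * N) + D * (e * N)
            from fun a b c e => by ring, e2, hD]
          ring
      _ ≤ D * (A - |α| ^ p * P + M * N) := by
          refine mul_le_mul_of_nonneg_left ?_ hD0.le
          linarith
  rw [one_div, inv_mul_le_iff₀ hD0]
  exact hfinal

end Combination

/-! ### Condition (C) and the improved Hardy inequality -/

section ConditionC

open Filter Topology

variable {n k : ℕ} {Ω K : Set (EuclideanSpace ℝ (Fin n))}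
  {u φ : EuclideanSpace ℝ (Fin n) → ℝ} {p : ℝ}

/-- Off `K` the `p`-Laplacian flux of `d ^ ((p - k) / (p - 1))` is a multiple of `d ^ (1 - k) ∇ d`,
since `∇ d` is a unit vector; so condition (C) is a sign condition on the divergence of
`d ^ (1 - k) ∇ d`. -/
lemma ConditionC.integral_nonneg_of_isTestFunction (hC : ConditionC k p Ω K) (hc : IsCompact K)
    (hne : K.Nonempty) (hp : 1 < p) (hpk : p ≠ k) (hφ : IsTestFunction (Ω \ K) φ)
    (hφ0 : ∀ x, 0 ≤ φ x) :
    0 ≤ (p - k) * ∫ x, Metric.infDist x K ^ (1 - k : ℝ) *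
      inner ℝ (∇ (fun x => Metric.infDist x K) x) (∇ φ x) := by
  have hp1 : 0 < p - 1 := by linarith
  set β : ℝ := (p - k) / (p - 1) with hβ
  have hβ0 : 0 < |β| := abs_pos.2 (div_ne_zero (sub_ne_zero.2 hpk) hp1.ne')
  have h := hC φ hφ hφ0
  rw [setIntegral_eq_integral_of_forall_compl_eq_zero fun x hx => by
    rw [gradient_eq_zero_of_notMem_tsupport fun h => hx (hφ.support_subset h), inner_zero_right,
      mul_zero]] at h
  have e : ∀ᵐ x, ‖∇ (fun x => Metric.infDist x K ^ β) x‖ ^ (p - 2) *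
      inner ℝ (∇ (fun x => Metric.infDist x K ^ β) x) (∇ φ x) =
      |β| ^ (p - 2) * β * (Metric.infDist x K ^ (1 - k : ℝ) *
        inner ℝ (∇ (fun x => Metric.infDist x K) x) (∇ φ x)) := by
    filter_upwards [ae_differentiableAt_infDist K, ae_norm_gradient_infDist hc hne] with x hx hx1
    by_cases hxs : x ∈ tsupport φ
    · have hxK : x ∉ K := (hφ.support_subset hxs).2
      have hpos := (hc.isClosed.notMem_iff_infDist_pos hne).1 hxK
      rw [(hasGradientAt_comp hx (hasDerivAt_rpow_const_of_pos β hpos)).gradient, norm_smul,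
        hx1 hxK, mul_one, inner_smul_left, Real.norm_eq_abs, abs_mul,
        abs_of_pos (Real.rpow_pos_of_pos hpos _), Real.mul_rpow hβ0.le (by positivity),
        ← Real.rpow_mul hpos.le]
      have e1 : Metric.infDist x K ^ (1 - k : ℝ) =
          Metric.infDist x K ^ ((β - 1) * (p - 2)) * Metric.infDist x K ^ (β - 1) := by
        rw [← Real.rpow_add hpos]
        congr 1
        rw [hβ]; field_simp; ring
      rw [e1]
      simp only [conj_trivial]
      ring
    · simp [gradient_eq_zero_of_notMem_tsupport hxs]
  rw [integral_congr_ae e, integral_const_mul] at h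
  have h2 : (0:ℝ) < |β| ^ (p - 2) / (p - 1) := by positivity
  refine nonneg_of_mul_nonneg_right (a := |β| ^ (p - 2) / (p - 1)) ?_ h2
  refine h.trans_eq ?_
  rw [hβ]; ring

/-- Condition (C) extends to nonnegative Lipschitz test functions, by mollification. -/
lemma ConditionC.integral_nonneg (hC : ConditionC k p Ω K) (hΩ : IsOpen Ω) (hc : IsCompact K)
    (hne : K.Nonempty) (hp : 1 < p) (hpk : p ≠ k) (hφ : IsLipschitzTest (Ω \ K) φ)
    (hφ0 : ∀ x, 0 ≤ φ x) :
    0 ≤ (p - k) * ∫ x, Metric.infDist x K ^ (1 - k : ℝ) *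
      inner ℝ (∇ (fun x => Metric.infDist x K) x) (∇ φ x) := by
  obtain ⟨B, S, ψ, hS, hSU, hψ, hψ0, -, hψ'B, hψS, -, hlim⟩ :=
    hφ.exists_approx (hΩ.sdiff hc.isClosed)
  have hcont : ContinuousOn (fun x => Metric.infDist x K ^ (1 - k : ℝ)) S :=
    (Metric.continuous_infDist_pt K).continuousOn.rpow_const fun x hx =>
      Or.inl ((hc.isClosed.notMem_iff_infDist_pos hne).1 (hSU hx).2).ne'
  obtain ⟨A, hA⟩ := hS.exists_bound_of_continuousOn hcont
  have key : Tendsto (fun m => ∫ x, Metric.infDist x K ^ (1 - k : ℝ) *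
      inner ℝ (∇ (fun x => Metric.infDist x K) x) (∇ (ψ m) x)) atTop
      (𝓝 (∫ x, Metric.infDist x K ^ (1 - k : ℝ) *
        inner ℝ (∇ (fun x => Metric.infDist x K) x) (∇ φ x))) := by
    refine tendsto_integral_of_dominated_convergence (S.indicator fun _ => A * B) (fun m => ?_) ?_
      (fun m => ae_of_all _ fun x => ?_) ?_
    · exact ((((Metric.continuous_infDist_pt K).measurable.pow_const _).mul
        ((measurable_gradient _).inner (measurable_gradient _)))).aestronglyMeasurable
    · exact (integrable_indicator_iff hS.measurableSet).2
        (integrableOn_const hS.measure_lt_top.ne)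
    · by_cases hx : x ∈ S
      · rw [indicator_of_mem hx, norm_mul]
        have hA0 : 0 ≤ A := (norm_nonneg _).trans (hA x hx)
        refine mul_le_mul (hA x hx) ?_ (norm_nonneg _) hA0
        refine (norm_inner_le_norm _ _).trans ?_
        calc _ ≤ 1 * B := by
              gcongr
              · exact norm_gradient_infDist_le x
              · exact hψ'B m x
          _ = B := one_mul B
      · rw [indicator_of_notMem hx,
          gradient_eq_zero_of_notMem_tsupport fun h => hx (hψS m h)]
        simp
    · filter_upwards [hlim] with x hx
      exact (tendsto_const_nhds.inner hx).const_mul _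
  exact ge_of_tendsto' (key.const_mul _) fun m =>
    hC.integral_nonneg_of_isTestFunction hc hne hp hpk (hψ m) (hψ0 hφ0 m)

/-- Replacing the constant `A` in the Picone-type argument for Hardy's inequality by `A e^{∓ s}`
costs a term quadratic in `s`, by Bernoulli's inequality, and gains a term linear in `s`. -/
lemma rpow_add_le_of_exp {A s σ : ℝ} (hp : 2 ≤ p) (hA : 0 < A) (hσ : |σ| = 1) (hs : 0 ≤ s)
    (hs1 : p * s ≤ 1) (hs2 : 24 * A * s ≤ 1) :
    A ^ p + p * (p - 1) * A ^ (p - 1) / 6 * s ≤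
      p * A * (A * Real.exp (-σ * s)) ^ (p - 1) - (p - 1) * (A * Real.exp (-σ * s)) ^ p +
        p * (p - 1) * s * (A * Real.exp (-σ * s)) ^ (p - 1) := by
  set E := Real.exp (-σ * s) with hE
  have hE0 : 0 < E := Real.exp_pos _
  have habs : |(-σ * s)| = s := by rw [abs_mul, abs_neg, hσ, one_mul, abs_of_nonneg hs]
  have hF : E ^ (p - 1) = Real.exp ((p - 1) * (-σ * s)) := by
    rw [hE, ← Real.exp_mul, mul_comm]
  have habs' : |(p - 1) * (-σ * s)| = (p - 1) * s := by
    rw [abs_mul, habs, abs_of_nonneg (by linarith)]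
  have hbern : 1 + p * (E - 1) ≤ E ^ p := by
    have := one_add_mul_self_le_rpow_one_add (s := E - 1) (by linarith) (by linarith : 1 ≤ p)
    rwa [add_sub_cancel] at this
  have h1 : |E - 1| ≤ 2 * s := by
    have := Real.abs_exp_sub_one_le (x := -σ * s) (by rw [habs]; nlinarith)
    rwa [habs] at this
  have h2 : |E ^ (p - 1) - 1| ≤ 2 * ((p - 1) * s) := by
    have := Real.abs_exp_sub_one_le (x := (p - 1) * (-σ * s)) (by rw [habs']; nlinarith)
    rwa [habs', ← hF] at this
  have h3 : 1 / 3 ≤ E ^ (p - 1) := by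
    have e1 : Real.exp (-1) ≤ E ^ (p - 1) := by
      rw [hF]
      refine Real.exp_le_exp.2 ?_
      have := (abs_le.1 habs'.le).1
      nlinarith
    have e2 : 1 / 3 ≤ Real.exp (-1) := by
      rw [Real.exp_neg, one_div]
      exact inv_anti₀ (Real.exp_pos 1) (by linarith [Real.exp_one_lt_d9])
    linarith
  have hEp : E ^ p = E * E ^ (p - 1) := by
    rw [Real.rpow_sub_one hE0.ne']; field_simp
  have hAp : A ^ p = A * A ^ (p - 1) := by
    rw [Real.rpow_sub_one hA.ne']; field_simp
  rw [Real.mul_rpow hA.le hE0.le, Real.mul_rpow hA.le hE0.le, hAp]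
  have hA' : 0 < A ^ (p - 1) := by positivity
  generalize A ^ (p - 1) = a at hA' ⊢
  rw [hEp] at hbern ⊢
  generalize E ^ (p - 1) = F at *
  have h4 : (E - 1) * (F - 1) ≤ 2 * s * (2 * ((p - 1) * s)) := by
    refine (le_abs_self _).trans ?_
    rw [abs_mul]
    exact mul_le_mul h1 h2 (abs_nonneg _) (by positivity)
  have hq : 0 ≤ p * (p - 1) * s := by
    have : 0 ≤ p - 1 := by linarith
    positivity
  have h5 : p * (p - 1) * s * (1 / 3) ≤ p * (p - 1) * s * F := mul_le_mul_of_nonneg_left h3 hq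
  have h6 : A * (1 - (p * F - (p - 1) * (E * F))) ≤ A * (p * ((E - 1) * (F - 1))) :=
    mul_le_mul_of_nonneg_left (by linarith) hA.le
  have h7 : A * (p * ((E - 1) * (F - 1))) ≤ A * (p * (2 * s * (2 * ((p - 1) * s)))) := by
    gcongr
  have h8 : p * (p - 1) * s * (24 * A * s) ≤ p * (p - 1) * s * 1 :=
    mul_le_mul_of_nonneg_left hs2 hq
  have h9 : A + p * (p - 1) / 6 * s ≤
      p * A * F - (p - 1) * (A * (E * F)) + p * (p - 1) * s * F := by
    linarith
  have h10 := mul_le_mul_of_nonneg_right h9 hA'.le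
  linarith

/-- Under condition (C) the Hardy functional controls the `L^p` norm. The vector field in the proof
of Hardy's inequality is perturbed to `(|α| exp (∓ κ d ^ p)) ^ (p - 1) d ^ (1 - p) ∇ d`. -/
lemma ConditionC.exists_mul_integral_le (hC : ConditionC k p Ω K) (hΩ : IsOpen Ω)
    (hb : Bornology.IsBounded Ω) (hc : IsCompact K) (hne : K.Nonempty) (hp : 2 ≤ p) (hpk : p ≠ k) :
    ∃ c : ℝ, 0 < c ∧ ∀ u, IsLipschitzTest (Ω \ K) u →
      c * (∫ x, |u x| ^ p) ≤ (∫ x, ‖∇ u x‖ ^ p) -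
        |(p - k) / p| ^ p * ∫ x, |u x| ^ p / Metric.infDist x K ^ p := by
  have hp0 : 0 < p := by linarith
  have hp1 : 1 < p := by linarith
  obtain ⟨σ, hσ, hσp⟩ : ∃ σ : ℝ, |σ| = 1 ∧ σ * (p - k) = |p - k| := by
    rcases lt_or_gt_of_ne (sub_ne_zero.2 hpk) with h | h
    · exact ⟨-1, by simp, by rw [abs_of_neg h]; ring⟩
    · exact ⟨1, by simp, by rw [abs_of_pos h]; ring⟩
  have hpk0 : 0 < |p - k| := abs_pos.2 (sub_ne_zero.2 hpk)
  have hσσ : σ * σ = 1 := by rw [← abs_mul_abs_self, hσ, one_mul]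
  set A : ℝ := |(p - k) / p| with hA
  have hA' : p * A = |p - k| := by rw [hA, abs_div, abs_of_pos hp0]; field_simp
  have hA0 : 0 < A := by by_contra! h; nlinarith
  obtain ⟨D, hD0, hD⟩ : ∃ D : ℝ, 0 < D ∧ ∀ x ∈ Ω, Metric.infDist x K ≤ D := by
    obtain ⟨y, hy⟩ := hne
    obtain ⟨R, hR⟩ := hb.subset_closedBall y
    refine ⟨max R 1, by positivity, fun x hx => ?_⟩
    exact (Metric.infDist_le_dist_of_mem hy).trans ((hR hx).trans (le_max_left _ _))
  -- both smallness conditions of `rpow_add_le_of_exp` hold for `s = κ d ^ p` on `Ω`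
  set κ : ℝ := 1 / ((p + 24 * A) * D ^ p) with hκ
  have hκ0 : 0 < κ := by positivity
  refine ⟨p * (p - 1) * A ^ (p - 1) / 6 * κ, by
    have : 0 < p - 1 := by linarith
    positivity, fun u hu => ?_⟩
  set d : EuclideanSpace ℝ (Fin n) → ℝ := fun x => Metric.infDist x K with hd
  have hcl := hc.isClosed
  have huK : IsLipschitzTest Kᶜ u := hu.mono fun x hx => hx.2
  have hv := hu.abs_rpow hp1
  have hvK := huK.abs_rpow hp1
  set v : EuclideanSpace ℝ (Fin n) → ℝ := fun x => |u x| ^ p with hvdef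
  set G : ℝ → ℝ := fun t => Real.exp (-σ * (κ * t ^ p)) ^ (p - 1) with hG
  have hGexp : ∀ t, G t = Real.exp ((-σ * (κ * t ^ p)) * (p - 1)) := fun t => by
    rw [hG]; exact (Real.exp_mul _ _).symm
  set h : ℝ → ℝ := fun t => t ^ (k - p) * G t with hh
  have hGd : ∀ t, 0 < t → HasDerivAt G (G t * ((-σ * (κ * (p * t ^ (p - 1)))) * (p - 1))) t := by
    intro t ht
    have := ((((hasDerivAt_rpow_const_of_pos p ht).const_mul κ).const_mul (-σ)).mul_const
      (p - 1)).exp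
    rw [← hGexp] at this
    exact this.congr_of_eventuallyEq (Eventually.of_forall hGexp)
  have hhd : ∀ t, 0 < t → HasDerivAt h ((k - p) * t ^ ((k - p) - 1) * G t +
      t ^ (k - p) * (G t * ((-σ * (κ * (p * t ^ (p - 1)))) * (p - 1)))) t := fun t ht =>
    (hasDerivAt_rpow_const_of_pos (k - p) ht).mul (hGd t ht)
  have hhC : ContDiffOn ℝ 1 h (Ioi 0) := by
    refine (contDiffOn_rpow_const_Ioi _).mul ?_
    refine ContDiffOn.congr ?_ fun t _ => hGexp t
    exact (((contDiffOn_const.mul (contDiffOn_const.mul (contDiffOn_rpow_const_Ioi p))).mul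
      contDiffOn_const)).exp
  have hφ := hv.infDist_mul hcl hne (fun x hx => hx.2) hhC
  have hφ0 : ∀ x, 0 ≤ h (d x) * v x := fun x => by
    have : 0 ≤ d x := Metric.infDist_nonneg
    simp only [hh, hG, hvdef]
    positivity
  have hI := hC.integral_nonneg hΩ hc hne hp1 hpk hφ hφ0
  set I : EuclideanSpace ℝ (Fin n) → ℝ := fun x => d x ^ (1 - k : ℝ) *
    inner ℝ (∇ d x) (∇ (fun x => h (d x) * v x) x) with hIdef
  have iI : Integrable I := (hφ.mono fun x hx => hx.2).integrable_inner_gradient hcl hne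
    (measurable_id.pow_const _) (continuousOn_rpow_const_Ioi (1 - k : ℝ))
  have hI' : 0 ≤ σ * ∫ x, I x := by
    have h2 : 0 ≤ |p - k| * (σ * ∫ x, I x) := by
      refine hI.trans_eq ?_
      rw [← hσp, show σ * (p - k) * (σ * ∫ x, I x) = σ * σ * ((p - k) * ∫ x, I x) by ring, hσσ,
        one_mul]
    exact nonneg_of_mul_nonneg_right h2 hpk0
  have iP := (integrable_rpow_div_infDist hp1 hcl hne huK).const_mul (A ^ p)
  have iN := hvK.integrable.const_mul (p * (p - 1) * A ^ (p - 1) / 6 * κ)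
  have iA : Integrable fun x => ‖∇ u x‖ ^ p := by
    simpa using huK.integrable_gradient_rpow hcl hne (h := fun _ => 1) measurable_const
      continuousOn_const hp0
  have iI2 := iI.const_mul (A ^ (p - 1) * σ)
  have key : ∀ᵐ x, p * (p - 1) * A ^ (p - 1) / 6 * κ * v x + A ^ p * (|u x| ^ p / d x ^ p) +
      A ^ (p - 1) * σ * I x ≤ ‖∇ u x‖ ^ p := by
    filter_upwards [hvK.ae_inner_gradient_infDist_mul hc hne hhd, huK.ae_differentiableAt]
      with x hx hux
    by_cases hxs : x ∈ tsupport u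
    swap
    · have e1 : u x = 0 := image_eq_zero_of_notMem_tsupport hxs
      have e2 : ∇ (fun x => h (d x) * v x) x = 0 :=
        gradient_eq_zero_of_notMem_tsupport fun hx' => hxs (closure_mono (fun y hy => by
          simp only [Function.mem_support, hvdef] at hy ⊢
          rintro h0
          exact hy (by rw [h0, abs_zero, Real.zero_rpow hp0.ne', mul_zero])) hx')
      have e3 : I x = 0 := by
        simp only [hIdef]
        rw [e2, inner_zero_right, mul_zero]
      rw [e3]
      simp only [hvdef, e1, abs_zero, Real.zero_rpow hp0.ne', zero_div, mul_zero, add_zero]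
      positivity
    have hxU := hu.support_subset hxs
    have hpos : 0 < d x := (hcl.notMem_iff_infDist_pos hne).1 hxU.2
    have hdD : d x ≤ D := hD x hxU.1
    set s : ℝ := κ * d x ^ p with hs
    have hs0 : 0 ≤ s := by positivity
    have hss : (p + 24 * A) * s ≤ 1 := by
      have h3 : d x ^ p ≤ D ^ p := by gcongr
      calc (p + 24 * A) * s ≤ (p + 24 * A) * (κ * D ^ p) := by rw [hs]; gcongr
        _ = 1 := by rw [hκ]; field_simp
    have hex := rpow_add_le_of_exp hp hA0 hσ hs0 (by nlinarith) (by nlinarith)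
    set E := Real.exp (-σ * s) with hE
    have hE0 : 0 < E := Real.exp_pos _
    have hGE : G (d x) = E ^ (p - 1) := rfl
    have hAE : (A * E) ^ (p - 1) = A ^ (p - 1) * E ^ (p - 1) := Real.mul_rpow hA0.le hE0.le
    have hIx : I x = d x ^ (1 - p) * E ^ (p - 1) * inner ℝ (∇ d x) (∇ v x) +
        ((k - p) - σ * (p * (p - 1)) * s) * E ^ (p - 1) * (v x / d x ^ p) := by
      have e1 : d x ^ (1 - k : ℝ) * d x ^ (k - p) = d x ^ (1 - p) := by
        rw [← Real.rpow_add hpos]; ring_nf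
      have e2 : d x ^ (1 - k : ℝ) * d x ^ ((k - p) - 1) = (d x ^ p)⁻¹ := by
        rw [← Real.rpow_add hpos, ← Real.rpow_neg hpos.le]; ring_nf
      have e3 : d x ^ (1 - p) * d x ^ (p - 1) = 1 := by
        rw [← Real.rpow_add hpos]; simp
      have e4 : d x ^ p * (d x ^ p)⁻¹ = 1 := mul_inv_cancel₀ (by positivity)
      simp only [hIdef]
      rw [hx]
      simp only [hh]
      rw [div_eq_mul_inv, hs]
      linear_combination (E ^ (p - 1) * inner ℝ (∇ d x) (∇ v x)) * e1 +
        ((k - p) * E ^ (p - 1) * v x) * e2 + (E ^ (p - 1) * (-σ * (κ * p) * (p - 1)) * v x) *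
        (d x ^ (p - 1) * e1 + e3 - e4)
    have hgrad : σ * inner ℝ (∇ d x) (∇ v x) ≤ p * (|u x| ^ (p - 1) * ‖∇ u x‖) := by
      have h3 : ‖∇ v x‖ = p * |u x| ^ (p - 1) * ‖∇ u x‖ := norm_gradient_abs_rpow hux hp1
      refine (le_abs_self _).trans ?_
      rw [abs_mul, hσ, one_mul]
      refine (abs_real_inner_le_norm _ _).trans ?_
      rw [h3]
      exact (mul_le_of_le_one_left (by positivity) (norm_gradient_infDist_le x)).trans_eq
        (mul_assoc _ _ _)
    have hy := young_mul_rpow_sub_one hp1 (norm_nonneg (∇ u x))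
      (by positivity : 0 ≤ A * E * (|u x| / d x))
    have hmul : ∀ t : ℝ, (A * E * (|u x| / d x)) ^ t = (A * E) ^ t * (|u x| ^ t / d x ^ t) :=
      fun t => by
        rw [Real.mul_rpow (by positivity) (by positivity), Real.div_rpow (abs_nonneg _) hpos.le]
    rw [hmul, hmul] at hy
    have hd1 : d x ^ (1 - p) = (d x ^ (p - 1))⁻¹ := by
      rw [← Real.rpow_neg hpos.le]; ring_nf
    have h4 : A ^ (p - 1) * σ * (d x ^ (1 - p) * E ^ (p - 1) * inner ℝ (∇ d x) (∇ v x)) ≤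
        p * (‖∇ u x‖ * ((A * E) ^ (p - 1) * (|u x| ^ (p - 1) / d x ^ (p - 1)))) := by
      have h5 := mul_le_mul_of_nonneg_left hgrad
        (by positivity : 0 ≤ A ^ (p - 1) * (d x ^ (1 - p) * E ^ (p - 1)))
      rw [hAE, div_eq_mul_inv, ← hd1]
      linarith
    have h6 := mul_le_mul_of_nonneg_right hex (by positivity : 0 ≤ v x / d x ^ p)
    have h7 : A ^ (p - 1) * σ *
        (((k - p) - σ * (p * (p - 1)) * s) * E ^ (p - 1) * (v x / d x ^ p)) =
        - (p * A * (A * E) ^ (p - 1) + p * (p - 1) * s * (A * E) ^ (p - 1)) * (v x / d x ^ p) := by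
      rw [hAE, hA', ← hσp]
      linear_combination (-A ^ (p - 1) * E ^ (p - 1) * (v x / d x ^ p) * (p * (p - 1)) * s) * hσσ
    have h8 : s * (v x / d x ^ p) = κ * v x := by
      rw [hs]; field_simp
    have h9 : p * (p - 1) * A ^ (p - 1) / 6 * κ * v x =
        p * (p - 1) * A ^ (p - 1) / 6 * s * (v x / d x ^ p) := by
      rw [mul_assoc _ κ, ← h8]; ring
    rw [hIx, mul_add, h7, h9]
    change _ * (v x / d x ^ p) + A ^ p * (v x / d x ^ p) + _ ≤ _
    have h10 : |u x| ^ p / d x ^ p = v x / d x ^ p := rfl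
    rw [h10] at hy
    linarith
  have hint := integral_mono_ae ((iN.add iP).add iI2) iA key
  rw [integral_add' (iN.add iP) iI2, integral_add' iN iP, integral_const_mul, integral_const_mul,
    integral_const_mul] at hint
  have : 0 ≤ A ^ (p - 1) * σ * ∫ x, I x := by
    rw [mul_assoc]; positivity
  linarith

end ConditionC

/-! ### Integrals over the domain -/

section Domain

variable {n k : ℕ} {Ω K : Set (EuclideanSpace ℝ (Fin n))}
  {u : EuclideanSpace ℝ (Fin n) → ℝ} {p q : ℝ}

/-- In codimension one `K` is the boundary of a nonempty bounded open set, which is not empty. -/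
lemma IsAdmissiblePair.nonempty (h : IsAdmissiblePair k Ω K) (hk : 1 ≤ k) (hkn : k < n) :
    K.Nonempty := by
  rcases hk.eq_or_lt with hk1 | hk1
  · rw [h.eq_frontier hk1.symm]
    have : Nonempty (Fin n) := ⟨⟨0, by omega⟩⟩
    refine nonempty_frontier_iff.2 ⟨h.isConnected.nonempty, fun hu => ?_⟩
    exact NormedSpace.unbounded_univ ℝ (EuclideanSpace ℝ (Fin n)) (hu ▸ h.isBounded)
  · exact (h.inter_closure_nonempty hk1).mono inter_subset_left

lemma IsTestFunction.hardyFunctional_eq (hu : IsTestFunction (Ω \ K) u) (hp : 0 < p) :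
    hardyFunctional k p Ω K u = (∫ x, ‖∇ u x‖ ^ p) -
      |(p - k) / p| ^ p * ∫ x, |u x| ^ p / Metric.infDist x K ^ p := by
  have h0 : ∀ x, x ∉ Ω → x ∉ tsupport u := fun x hx hxu => hx (hu.support_subset hxu).1
  rw [hardyFunctional, setIntegral_eq_integral_of_forall_compl_eq_zero fun x hx => by
      rw [gradient_eq_zero_of_notMem_tsupport (h0 x hx), norm_zero, Real.zero_rpow hp.ne'],
    setIntegral_eq_integral_of_forall_compl_eq_zero fun x hx => by
      rw [image_eq_zero_of_notMem_tsupport (h0 x hx), abs_zero, Real.zero_rpow hp.ne', zero_div]]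

lemma IsTestFunction.setIntegral_abs_rpow (hu : IsTestFunction (Ω \ K) u) (hp : 0 < p) :
    ∫ x in Ω, |u x| ^ p = ∫ x, |u x| ^ p :=
  setIntegral_eq_integral_of_forall_compl_eq_zero fun x hx => by
    rw [image_eq_zero_of_notMem_tsupport fun hxu => hx (hu.support_subset hxu).1, abs_zero,
      Real.zero_rpow hp.ne']

lemma IsTestFunction.criticalTerm_eq (hu : IsTestFunction (Ω \ K) u) (hq : 0 < q) :
    criticalTerm p q Ω K u =
      (∫ x, Metric.infDist x K ^ (-q + (q - p) / p * n) * |u x| ^ q) ^ (p / q) := by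
  rw [criticalTerm, setIntegral_eq_integral_of_forall_compl_eq_zero fun x hx => by
    rw [image_eq_zero_of_notMem_tsupport fun hxu => hx (hu.support_subset hxu).1, abs_zero,
      Real.zero_rpow hq.ne', mul_zero]]

end Domain

theorem theorem1p1 (n k : ℕ) (p q : ℝ) (hk : 1 ≤ k) (hkn : k < n) (hp : 2 ≤ p) (hpn : p < n)
    (hpk : p ≠ k) (hpq : p < q) (hq : q ≤ n * p / (n - p)) :
    (∀ Ω K : Set (EuclideanSpace ℝ (Fin n)), IsAdmissiblePair k Ω K → ConditionC k p Ω K →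
      ∃ c : ℝ, 0 < c ∧ ∀ u : EuclideanSpace ℝ (Fin n) → ℝ, IsTestFunction (Ω \ K) u →
        hardyFunctional k p Ω K u ≥ c * criticalTerm p q Ω K u) ∧
    (∃ c : ℝ, 0 < c ∧ ∀ Ω K : Set (EuclideanSpace ℝ (Fin n)), IsAdmissiblePair k Ω K →
      ∃ M : ℝ, 0 < M ∧ ∀ u : EuclideanSpace ℝ (Fin n) → ℝ, IsTestFunction (Ω \ K) u →
        hardyFunctional k p Ω K u + M * (∫ x in Ω, |u x| ^ p) ≥
          c * criticalTerm p q Ω K u) := by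
  have hp0 : 0 < p := by linarith
  have hq0 : 0 < q := by linarith
  obtain ⟨c, hc, hmain⟩ := exists_hardy_sobolev_const hkn hp hpn hpk hpq hq
  have hii : ∀ Ω K : Set (EuclideanSpace ℝ (Fin n)), IsAdmissiblePair k Ω K →
      ∃ M : ℝ, 0 < M ∧ ∀ u : EuclideanSpace ℝ (Fin n) → ℝ, IsTestFunction (Ω \ K) u →
        hardyFunctional k p Ω K u + M * (∫ x in Ω, |u x| ^ p) ≥
          c * criticalTerm p q Ω K u := by
    intro Ω K h
    obtain ⟨M, hM, hMu⟩ := hmain K h.isC2Submanifold h.isCompact (h.nonempty hk hkn)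
    refine ⟨M, hM, fun u hu => ?_⟩
    rw [hu.hardyFunctional_eq hp0, hu.criticalTerm_eq hq0, hu.setIntegral_abs_rpow hp0]
    exact hMu u (hu.isLipschitzTest.mono fun x hx => hx.2)
  refine ⟨fun Ω K h hC => ?_, c, hc, hii⟩
  obtain ⟨M, hM, hMu⟩ := hii Ω K h
  obtain ⟨c₁, hc₁, hlow⟩ := hC.exists_mul_integral_le h.isOpen h.isBounded h.isCompact
    (h.nonempty hk hkn) hp hpk
  refine ⟨c / (1 + M / c₁), by positivity, fun u hu => ?_⟩
  have h1 := hlow u hu.isLipschitzTest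
  rw [← hu.hardyFunctional_eq hp0, ← hu.setIntegral_abs_rpow hp0] at h1
  have h2 := hMu u hu
  have h3 : M * (∫ x in Ω, |u x| ^ p) ≤ M / c₁ * hardyFunctional k p Ω K u := by
    calc M * (∫ x in Ω, |u x| ^ p) = M / c₁ * (c₁ * ∫ x in Ω, |u x| ^ p) := by field_simp
      _ ≤ _ := by gcongr
  rw [ge_iff_le, div_mul_eq_mul_div, div_le_iff₀ (by positivity)]
  linarith
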